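/- **Setting.** Consider a discounted MDP with finite non-empty state and action sets $\mathcal S,\mathcal A$, transitions $P$, rewards $r(s,a)\in[0,1]$ and discount $\gamma\in[0,1)$. For an initial distribution $\nu$ and a stationary policy $\pi\in\Delta(\mathcal A)^{\mathcal S}$ let $$J_\nu(\pi,\lambda)=\mathbb E_{s_0\sim\nu,\pi}\sum_{t\ge0}\gamma^t\big(r(s_t,a_t)-\lambda\,\Omega(\pi(\cdot|s_t))\big),\qquad d_{\pi,\nu}(s)=(1-\gamma)\sum_{t\ge0}\gamma^tP(s_t=s\mid s_0\sim\nu,\pi).$$ Here $\lambda\ge0$ is fixed and $\Omega$ is a convex regularizer, differentiable at the points of $\Delta(\mathcal A)$, with $0\le\Omega\le C_\Phi$ there; $\widetilde C_\Phi\ge C_\Phi$ is a constant with $|\partial_a\Omega|\le\widetilde C_\Phi$ on $\Delta(\mathcal A)$ and $|\partial_a\Omega(p)-\partial_a\Omega(q)|\le\widetilde C_\Phi\|p-q\|_1$ for $p,q\in\Delta(\mathcal A)$ and all $a$ (for $C^2$ functions this holds if the entries of the Hessian are bounded by $\widetilde C_\Phi$). Assume $\min_s\nu(s)>0$, let $\pi_\lambda^*$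 maximize $J_\nu(\cdot,\lambda)$ over all policies, and assume $\|d_{\pi^*_\lambda,\nu}/d_{\pi,\nu}\|_\infty\le\rho_\nu$ for every policy $\pi$. A function is called $L$-smooth if it is differentiable at every policy and its gradient in $\mathbb R^{\mathcal S\times\mathcal A}$ is $L$-Lipschitz on the set of policies, in the Euclidean norm. **Algorithm.** Given $\eta>0$, $N$, $K$ and $\pi_0$, at step $t$ draw, independently of the past given $\pi_t$, $N$ independent trajectories as follows. Draw a state from $\nu$; repeatedly accept the current state with probability $1-\gamma$ and otherwise move one step with $\pi_t$; after $K$ refusals accept the current state. The accepted state is $s_0$. Draw $a_0$ uniformly from $\mathcal A$ and follow $\pi_t$ to obtain $(s_0,a_0,\dots,s_{K-1},a_{K-1})$ (only $(s_0,a_0)$ if $K=0$). Put $\widehat Q=r(s_0,a_0)+\sum_{k=1}^{K-1}\gamma^k\big(r(s_k,a_k)-\lambda\Omega(\pi_t(\cdot|s_k))\big)$ and $$\widetilde\nabla_{s,a}=\frac{|\mathcal A|}{1-\gamma}\,\frac1N\sum_{n=1}^N\big[\widehat Q_n-\lambda\,\partial_a\Omega(\pi_t(\cdot|s))\big]\mathbf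 1\{s_{0,n}=s,\ a_{0,n}=a\},$$ $$\pi_{t+1}=\mathop{\rm argmin}_{\pi\in\Delta(\mathcal A)^{\mathcal S}}\Big[\langle-\widetilde\nabla,\pi-\pi_t\rangle+\tfrac1{2\eta}\|\pi-\pi_t\|_2^2\Big].$$ For $0<\varepsilon\le1$, $0<\delta<1$, $T\ge1$ and a constant $c$ put $$K_\varepsilon=\frac{1}{\log\frac1\gamma}\max\Big\{\log\frac{12(1+\lambda C_\Phi)}{\varepsilon(1-\gamma)^2},\ \log\frac{c\sqrt{|\mathcal A|}\,(1+\lambda\widetilde C_\Phi)}{\sqrt\varepsilon\,(1-\gamma)^2}\Big\}\quad(K_\varepsilon=0\text{ if }\gamma=0),$$ $$N_{\varepsilon,\delta,T}=c\,\frac{|\mathcal S||\mathcal A|^2(1+\lambda\widetilde C_\Phi)^2}{\varepsilon^2(1-\gamma)^4}\,\log\frac{2|\mathcal A|T}{\delta}.$$ **Theorem.** There are absolute constants $c,C>0$ such that in every such setting the following hold. 1. $J_\nu(\cdot,\lambda)$ is $\frac{4|\mathcal A|(1+\lambda\widetilde C_\Phi)}{(1-\gamma)^3}$-smooth. 2.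 Let $L_\lambda>0$ be any number for which $J_\nu(\cdot,\lambda)$ is $L_\lambda$-smooth, and let $\eta=1/L_\lambda$. For all $0<\varepsilon\le1$, $0<\delta<1$, $T\ge1$, $\pi_0$ and all integers $K\ge K_\varepsilon$, $N\ge N_{\varepsilon,\delta,T}$, with probability at least $1-\delta$, $$\min_{0\le t\le T-1}J_\nu(\pi_\lambda^*,\lambda)-J_\nu(\pi_{t+1},\lambda)\le4\rho_\nu\sqrt{|\mathcal S|}\sqrt{\frac{L_\lambda\,(J_\nu(\pi_\lambda^*,\lambda)-J_\nu(\pi_0,\lambda))}{T}+\varepsilon}.$$ 3. Let $\mu$ be a distribution with $\|\mu/\nu\|_\infty\le\rho$, let $0<\varepsilon'\le1$, $0<\delta<1$, let $\pi_0$ be any policy, and let $L_\lambda$ and $\eta$ be as in 2 with $L_\lambda\le\frac{4|\mathcal A|(1+\lambda\widetilde C_\Phi)}{(1-\gamma)^3}$. With $\varepsilon=\frac{\varepsilon'^2}{32\rho^2\rho_\nu^2|\mathcal S|}$, $X=\frac{|\mathcal S||\mathcal A|\rho^2\rho_\nu^2(1+\lambda\widetilde C_\Phi)^2}{\varepsilon'^2(1-\gamma)^4}$,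 $T=\lceil cX\rceil$, $N=\lceil N_{\varepsilon,\delta,T}\rceil$ and $K=\lceil K_\varepsilon\rceil$, the number of iterations is $T\le CX$, the total number of trajectories satisfies $$TN\le C\,\frac{|\mathcal S|^4|\mathcal A|^3\rho^6\rho_\nu^6(1+\lambda\widetilde C_\Phi)^4}{\varepsilon'^6(1-\gamma)^8}\,\log\frac{2|\mathcal S||\mathcal A|\rho\rho_\nu(1+\lambda\widetilde C_\Phi)}{\varepsilon'(1-\gamma)\delta},$$ and with probability at least $1-\delta$ there is $t\in\{0,\dots,T-1\}$ with $J_\nu(\pi_\lambda^*,\lambda)-J_\nu(\pi_{t+1},\lambda)\le\varepsilon'/\rho$ and $J_\mu(\pi',\lambda)-J_\mu(\pi_{t+1},\lambda)\le\varepsilon'$ for every policy $\pi'$. -/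

import Mathlib

open scoped ENNReal

universe u v

noncomputable section

/-- The discounted MDP data: transition probabilities, rewards in `[0,1]`, discount in `[0,1)`. -/
structure MDP (S : Type u) (A : Type v) [Fintype S] where
  P : S → A → stdSimplex ℝ S
  r : S → A → ℝ
  γ : ℝ
  r_nonneg : ∀ s a, 0 ≤ r s a
  r_le_one : ∀ s a, r s a ≤ 1
  γ_nonneg : 0 ≤ γ
  γ_lt_one : γ < 1

/-- Stationary randomized policies: one point of the simplex `Δ(A)` per state. -/
abbrev Policy (S : Type u) (A : Type v) [Fintype A] : Type (max u v) := S → stdSimplex ℝ A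

/-- The matrix `π(a|s)` of a policy. -/
def Policy.mat {S : Type u} {A : Type v} [Fintype A] (π : Policy S A) : S → A → ℝ :=
  fun s a => (π s).1 a

section Values

variable {S : Type u} {A : Type v} [Fintype S] [Fintype A]

/-- `P(s_t = s | s_0 ∼ ν, π)`, written for arbitrary matrices `π` so that one can differentiate
in `π`. -/
def stateProb (M : MDP S A) (ν : stdSimplex ℝ S) (π : S → A → ℝ) : ℕ → S → ℝ
  | 0 => fun s => ν.1 s
  | t + 1 => fun s' => ∑ s, ∑ a, stateProb M ν π t s * π s a * (M.P s a).1 s'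

/-- Discounted state visitation distribution `d_{π,ν}`. -/
def visit (M : MDP S A) (ν : stdSimplex ℝ S) (π : S → A → ℝ) (s : S) : ℝ :=
  (1 - M.γ) * ∑' t : ℕ, M.γ ^ t * stateProb M ν π t s

/-- Regularized objective
`J_ν(π,λ) = E_{s_0 ∼ ν, π} ∑_t γ^t (r(s_t,a_t) - λ Ω(π(·|s_t)))`. -/
def J (M : MDP S A) (Ω : (A → ℝ) → ℝ) (lam : ℝ) (ν : stdSimplex ℝ S) (π : S → A → ℝ) : ℝ :=
  ∑' t : ℕ, M.γ ^ t *
    ∑ s, stateProb M ν π t s * ((∑ a, π s a * M.r s a) - lam * Ω (π s))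

/-- `π` maximizes `J_ν(·,λ)` among all policies. -/
def IsOptimal (M : MDP S A) (Ω : (A → ℝ) → ℝ) (lam : ℝ) (ν : stdSimplex ℝ S)
    (π : Policy S A) : Prop :=
  ∀ π' : Policy S A, J M Ω lam ν π'.mat ≤ J M Ω lam ν π.mat

/-- Euclidean norm on `ℝ^{S × A}`. -/
def norm2 (x : S → A → ℝ) : ℝ := Real.sqrt (∑ s, ∑ a, x s a ^ 2)

variable [DecidableEq S] [DecidableEq A]

/-- Partial derivative `∂Ω/∂p(a)`. -/
def gradΩ (Ω : (A → ℝ) → ℝ) (p : A → ℝ) (a : A) : ℝ := fderiv ℝ Ω p (Pi.single a 1)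

/-- Partial derivatives `∂F/∂π(a|s)`. -/
def gradπ (F : (S → A → ℝ) → ℝ) (π : S → A → ℝ) (s : S) (a : A) : ℝ :=
  fderiv ℝ F π (Pi.single s (Pi.single a 1))

/-- `F` is `L`-smooth on the set of policies (Lipschitz gradient, Euclidean norm). -/
def SmoothOnPolicies (F : (S → A → ℝ) → ℝ) (L : ℝ) : Prop :=
  (∀ π : Policy S A, DifferentiableAt ℝ F π.mat) ∧
  ∀ π π' : Policy S A,
    norm2 (gradπ F π.mat - gradπ F π'.mat) ≤ L * norm2 (π.mat - π'.mat)

/-- Smooth convex regularizer on `Δ(A)` with `0 ≤ Ω ≤ CΦ`, where `Ct ≥ CΦ` also bounds the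
entries of the gradient and of the Hessian; the bound on the Hessian is stated as the Lipschitz
estimate which, for `C²` functions, follows from a bound on its entries. -/
structure IsRegularizer (Ω : (A → ℝ) → ℝ) (CΦ Ct : ℝ) : Prop where
  convex : ConvexOn ℝ (stdSimplex ℝ A) Ω
  nonneg : ∀ p ∈ stdSimplex ℝ A, 0 ≤ Ω p
  le_CΦ : ∀ p ∈ stdSimplex ℝ A, Ω p ≤ CΦ
  CΦ_le : CΦ ≤ Ct
  differentiable : ∀ p ∈ stdSimplex ℝ A, DifferentiableAt ℝ Ω p
  grad_le : ∀ p ∈ stdSimplex ℝ A, ∀ a, |gradΩ Ω p a| ≤ Ct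
  grad_lip : ∀ p ∈ stdSimplex ℝ A, ∀ q ∈ stdSimplex ℝ A, ∀ a,
    |gradΩ Ω p a - gradΩ Ω q a| ≤ Ct * ∑ b, |p b - q b|

end Values

section Sampling

/-- A point of the simplex as a probability mass function. -/
def toPMF {X : Type*} [Fintype X] (p : stdSimplex ℝ X) : PMF X :=
  PMF.ofFintype (fun x => ENNReal.ofReal (p.1 x)) (by
    rw [← ENNReal.ofReal_sum_of_nonneg (fun x _ => p.2.1 x), p.2.2, ENNReal.ofReal_one])

/-- Law of `n` independent draws. -/
def iidPMF {X : Type*} (p : PMF X) : (n : ℕ) → PMF (Fin n → X)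
  | 0 => PMF.pure Fin.elim0
  | n + 1 => p.bind fun x => (iidPMF p n).map fun w => Fin.cons (α := fun _ => X) x w

variable {S : Type u} {A : Type v} [Fintype S] [Fintype A]

/-- The coin which says `true` (accept) with probability `1 - γ`. -/
def acceptCoin (M : MDP S A) : PMF Bool :=
  PMF.ofFintype (fun b => cond b (ENNReal.ofReal (1 - M.γ)) (ENNReal.ofReal M.γ)) (by
    rw [Fintype.sum_bool]
    simp only [cond_true, cond_false]
    rw [← ENNReal.ofReal_add (by linarith [M.γ_lt_one]) M.γ_nonneg]
    simp)

/-- From the current state, accept it with probability `1 - γ`, otherwise make one transition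
under `π` and try again; after `n` refusals the current state is accepted. -/
def acceptLaw (M : MDP S A) (π : Policy S A) : ℕ → S → PMF S
  | 0, s => PMF.pure s
  | n + 1, s => (acceptCoin M).bind fun b =>
      if b then PMF.pure s
      else (toPMF (π s)).bind fun a => (toPMF (M.P s a)).bind fun s' => acceptLaw M π n s'

/-- Law of the next `n` state-action pairs after `(s,a)` when following `π`. -/
def rolloutLaw (M : MDP S A) (π : Policy S A) : ℕ → S → A → PMF (List (S × A))
  | 0, _, _ => PMF.pure []
  | n + 1, s, a => (toPMF (M.P s a)).bind fun s' => (toPMF (π s')).bind fun a' =>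
      (rolloutLaw M π n s' a').map fun l => (s', a') :: l

/-- A sampled trajectory: `s_0`, `a_0` and the list `(s_1,a_1), (s_2,a_2), …`. -/
abbrev Trajectory (S : Type u) (A : Type v) : Type (max u v) := S × A × List (S × A)

/-- One trajectory of the `ν`-restart model truncated at length `K`: `s_0` from the acceptance
scheme started at `ν`, `a_0` uniform on `A`, then `K - 1` further steps with `π`. -/
def trajectoryLaw [Nonempty A] (M : MDP S A) (ν : stdSimplex ℝ S) (K : ℕ) (π : Policy S A) :
    PMF (Trajectory S A) :=
  ((toPMF ν).bind fun s => acceptLaw M π K s).bind fun s₀ =>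
    (PMF.uniformOfFintype A).bind fun a₀ =>
      (rolloutLaw M π (K - 1) s₀ a₀).map fun l => (s₀, a₀, l)

/-- Truncated return
`r(s_0,a_0) + ∑_{t ≥ 1} γ^t (r(s_t,a_t) - λ Ω(π(·|s_t)))` along a sampled trajectory. -/
def returnEst (M : MDP S A) (Ω : (A → ℝ) → ℝ) (lam : ℝ) (π : Policy S A)
    (τ : Trajectory S A) : ℝ :=
  M.r τ.1 τ.2.1 + ∑ i : Fin τ.2.2.length, M.γ ^ ((i : ℕ) + 1) *
    (M.r (τ.2.2.get i).1 (τ.2.2.get i).2 - lam * Ω (π.mat (τ.2.2.get i).1))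

/-- Gradient estimator from `N` trajectories. -/
def gradEst [DecidableEq S] [DecidableEq A] (M : MDP S A) (Ω : (A → ℝ) → ℝ) (lam : ℝ)
    (π : Policy S A) {N : ℕ} (τ : Fin N → Trajectory S A) (s : S) (a : A) : ℝ :=
  (Fintype.card A : ℝ) / (1 - M.γ) * ((1 / (N : ℝ)) * ∑ n,
    if (τ n).1 = s ∧ (τ n).2.1 = a
    then returnEst M Ω lam π (τ n) - lam * gradΩ Ω (π.mat s) a else 0)

/-- Objective of the proximal step: `⟨-g, π' - π⟩ + ‖π' - π‖² / (2η)`. -/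
def stepObjective (η : ℝ) (π : Policy S A) (g : S → A → ℝ) (π' : Policy S A) : ℝ :=
  (∑ s, ∑ a, -g s a * (π'.mat s a - π.mat s a)) + 1 / (2 * η) * norm2 (π'.mat - π.mat) ^ 2

theorem exists_step [Nonempty A] (η : ℝ) (π : Policy S A) (g : S → A → ℝ) :
    ∃ π₁ : Policy S A, ∀ π', stepObjective η π g π₁ ≤ stepObjective η π g π' := by
  have hm : ∀ s a, Continuous fun π' : Policy S A => π'.mat s a := fun s a =>
    (continuous_apply a).comp (continuous_subtype_val.comp (continuous_apply s))
  have hc : Continuous (stepObjective η π g) := by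
    unfold stepObjective norm2
    simp only [Pi.sub_apply]
    fun_prop
  obtain ⟨x, -, hx⟩ := isCompact_univ.exists_isMinOn
    (Set.univ_nonempty (α := Policy S A)) hc.continuousOn
  exact ⟨x, fun π' => hx (Set.mem_univ π')⟩

/-- Projected gradient ascent step: the minimizer of the proximal objective over all policies. -/
def pgaStep [Nonempty A] (η : ℝ) (π : Policy S A) (g : S → A → ℝ) : Policy S A :=
  (exists_step η π g).choose

/-- Joint law of the iterates `π_0, …, π_T` of projected gradient ascent with sampling: at each
step, `N` fresh independent trajectories of length `K` are drawn with the current policy. -/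
def iteratesLaw [Nonempty A] [DecidableEq S] [DecidableEq A] (M : MDP S A) (Ω : (A → ℝ) → ℝ)
    (lam : ℝ) (ν : stdSimplex ℝ S) (K N : ℕ) (η : ℝ) (π₀ : Policy S A) :
    (T : ℕ) → PMF (Fin (T + 1) → Policy S A)
  | 0 => PMF.pure fun _ => π₀
  | T + 1 => (iteratesLaw M Ω lam ν K N η π₀ T).bind fun h =>
      (iidPMF (trajectoryLaw M ν K (h (Fin.last T))) N).map fun τ =>
        Fin.snoc (α := fun _ => Policy S A) h
          (pgaStep η (h (Fin.last T)) (gradEst M Ω lam (h (Fin.last T)) τ))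

end Sampling

/-- Truncation length (before rounding up). -/
def horizon (c cardA γ lam CΦ Ct ε : ℝ) : ℝ :=
  max (Real.log (12 * (1 + lam * CΦ) / (ε * (1 - γ) ^ 2)) / Real.log (1 / γ))
    (Real.log (c * Real.sqrt cardA * (1 + lam * Ct) / (Real.sqrt ε * (1 - γ) ^ 2)) /
      Real.log (1 / γ))

/-- Number of trajectories per step (before rounding up). -/
def batchSize (c cardS cardA γ lam Ct ε δ T : ℝ) : ℝ :=
  c * (cardS * cardA ^ 2 * (1 + lam * Ct) ^ 2 / (ε ^ 2 * (1 - γ) ^ 4)) *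
    Real.log (2 * cardA * T / δ)

end

set_option linter.unusedSectionVars false

/-! The objective is a sum of stage rewards against the unnormalized occupancy measure, and its
analysis rests on one exact identity, `RowBound.J_sub`: the difference of `J` at a matrix `x` and at
a policy `π` is the occupancy of `x` summed against a one-step gain computed with the Q-function of
`π`. The gain vanishes at `x = π`, so differentiability needs only continuity of the occupancy, and
the gradient is occupancy times (Q minus `lam` times the gradient of `Ω`). Both factors are bounded
and Lipschitz, whence smoothness. Together with convexity of `Ω`, the same identity yields gradient
domination (`exists_gap_le_inner`): the gap to the optimum is at most `ρν` times a first-order gain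
towards some policy.

A proximal step with direction error `e` either makes progress or lands at a nearly stationary point
(`inner_le_of_step`). Hence the squared gap after the step is at most a constant times `L * progress
+ 4 * e ^ 2`. Progress telescopes, so one of the `T` steps has at most average progress, and the gap
after that step is small.

Each trajectory contributes a bounded vector whose mean differs from the gradient by a bias decaying
like `γ ^ max K 1`. A Hoeffding inequality in Euclidean space, with the hyperbolic cosine of the
norm as potential, controls the fluctuation without any dependence on dimension
(`expect_iidPMF_tail_le`). A union bound makes all steps accurate at once.

Since `ν` charges every state, a maximizer of `J_ν` is optimal from every state
(`IsOptimal.regValue_le`). A gap under `ν` therefore transfers to `μ` at the cost of a factor `ρ`,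
and the complexity bounds become arithmetic. -/

noncomputable section

/-! ### Occupancy measures, also for matrices that are not policies. -/

section Occupancy

variable {S : Type u} {A : Type v} [Fintype S] [Fintype A]

lemma Policy.mat_mem (π : Policy S A) (s : S) : π.mat s ∈ stdSimplex ℝ A := (π s).2

lemma Policy.mat_nonneg (π : Policy S A) (s : S) (a : A) : 0 ≤ π.mat s a := (π s).2.1 a

lemma Policy.sum_mat (π : Policy S A) (s : S) : ∑ a, π.mat s a = 1 := (π s).2.2

lemma Policy.sum_abs_mat (π : Policy S A) (s : S) : ∑ a, |π.mat s a| = 1 := by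
  simp only [abs_of_nonneg (π.mat_nonneg s _), π.sum_mat]

/-- A policy from a matrix whose rows are probability vectors. -/
def Policy.ofMat (x : S → A → ℝ) (h : ∀ s, x s ∈ stdSimplex ℝ A) : Policy S A :=
  fun s => ⟨x s, h s⟩

lemma MDP.one_sub_pos (M : MDP S A) : 0 < 1 - M.γ := by linarith [M.γ_lt_one]

lemma MDP.P_nonneg (M : MDP S A) (s : S) (a : A) (s' : S) : 0 ≤ (M.P s a).1 s' :=
  (M.P s a).2.1 s'

lemma MDP.sum_P (M : MDP S A) (s : S) (a : A) : ∑ s', (M.P s a).1 s' = 1 := (M.P s a).2.2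

/-- Expectation of `V` at the next state. -/
def nextValue (M : MDP S A) (V : S → ℝ) (s : S) (a : A) : ℝ := ∑ s', (M.P s a).1 s' * V s'

lemma nextValue_sub (M : MDP S A) (V W : S → ℝ) (s : S) (a : A) :
    nextValue M (V - W) s a = nextValue M V s a - nextValue M W s a := by
  simp [nextValue, mul_sub, Finset.sum_sub_distrib]

lemma abs_nextValue_le (M : MDP S A) {V : S → ℝ} {B : ℝ} (h : ∀ s, |V s| ≤ B) (s : S) (a : A) :
    |nextValue M V s a| ≤ B := by
  calc |nextValue M V s a| ≤ ∑ s', |(M.P s a).1 s' * V s'| := Finset.abs_sum_le_sum_abs _ _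
    _ ≤ ∑ s', (M.P s a).1 s' * B := by
        refine Finset.sum_le_sum fun s' _ => ?_
        rw [abs_mul, abs_of_nonneg (M.P_nonneg s a s')]
        exact mul_le_mul_of_nonneg_left (h s') (M.P_nonneg s a s')
    _ = B := by rw [← Finset.sum_mul, M.sum_P, one_mul]

lemma le_nextValue (M : MDP S A) {V : S → ℝ} {B : ℝ} (h : ∀ s, B ≤ V s) (s : S) (a : A) :
    B ≤ nextValue M V s a := by
  calc B = ∑ s', (M.P s a).1 s' * B := by rw [← Finset.sum_mul, M.sum_P, one_mul]
    _ ≤ _ := Finset.sum_le_sum fun s' _ => mul_le_mul_of_nonneg_left (h s') (M.P_nonneg s a s')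

/-- One step multiplies the `ℓ¹` mass by at most the largest absolute row sum. Signed matrices are
allowed because derivatives look at a whole neighbourhood of a policy. -/
lemma sum_abs_stateProb_le (M : MDP S A) (ν : stdSimplex ℝ S) {π : S → A → ℝ} {q : ℝ}
    (hq : 0 ≤ q) (hπ : ∀ s, ∑ a, |π s a| ≤ q) (t : ℕ) :
    ∑ s, |stateProb M ν π t s| ≤ q ^ t := by
  induction t with
  | zero => simp [stateProb, abs_of_nonneg (ν.2.1 _), ν.2.2]
  | succ t ih =>
    calc ∑ s', |∑ s, ∑ a, stateProb M ν π t s * π s a * (M.P s a).1 s'|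
        ≤ ∑ s', ∑ s, ∑ a, |stateProb M ν π t s| * |π s a| * (M.P s a).1 s' := by
          refine Finset.sum_le_sum fun s' _ => (Finset.abs_sum_le_sum_abs _ _).trans
            (Finset.sum_le_sum fun s _ => (Finset.abs_sum_le_sum_abs _ _).trans
              (Finset.sum_le_sum fun a _ => ?_))
          rw [abs_mul, abs_mul, abs_of_nonneg (M.P_nonneg s a s')]
      _ = ∑ s, |stateProb M ν π t s| * ∑ a, |π s a| := by
          rw [Finset.sum_comm]
          refine Finset.sum_congr rfl fun s _ => ?_
          rw [Finset.sum_comm, Finset.mul_sum]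
          refine Finset.sum_congr rfl fun a _ => ?_
          rw [← Finset.mul_sum, M.sum_P, mul_one]
      _ ≤ ∑ s, |stateProb M ν π t s| * q :=
          Finset.sum_le_sum fun s _ => mul_le_mul_of_nonneg_left (hπ s) (abs_nonneg _)
      _ ≤ q ^ (t + 1) := by
          rw [← Finset.sum_mul, pow_succ]
          exact mul_le_mul_of_nonneg_right ih hq

/-- A matrix for which discounted occupation sums converge geometrically. -/
structure RowBound (M : MDP S A) (π : S → A → ℝ) (q : ℝ) : Prop where
  nonneg : 0 ≤ q
  contract : M.γ * q < 1
  row : ∀ s, ∑ a, |π s a| ≤ q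

lemma Policy.rowBound (M : MDP S A) (π : Policy S A) : RowBound M π.mat 1 :=
  ⟨zero_le_one, by linarith [M.γ_lt_one], fun s => (π.sum_abs_mat s).le⟩

/-- Unnormalized discounted occupancy measure. -/
def occupancy (M : MDP S A) (ν : stdSimplex ℝ S) (π : S → A → ℝ) (s : S) : ℝ :=
  ∑' t : ℕ, M.γ ^ t * stateProb M ν π t s

variable {M : MDP S A} {ν : stdSimplex ℝ S} {π : S → A → ℝ} {q : ℝ}

lemma RowBound.abs_le (h : RowBound M π q) (ν : stdSimplex ℝ S) (s : S) (t : ℕ) :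
    |M.γ ^ t * stateProb M ν π t s| ≤ (M.γ * q) ^ t := by
  rw [abs_mul, abs_of_nonneg (pow_nonneg M.γ_nonneg t), mul_pow]
  refine mul_le_mul_of_nonneg_left ?_ (pow_nonneg M.γ_nonneg t)
  exact (Finset.single_le_sum (f := fun s => |stateProb M ν π t s|) (fun _ _ => abs_nonneg _)
    (Finset.mem_univ s)).trans (sum_abs_stateProb_le M ν h.nonneg h.row t)

lemma RowBound.summable (h : RowBound M π q) (ν : stdSimplex ℝ S) (s : S) :
    Summable fun t => M.γ ^ t * stateProb M ν π t s :=
  Summable.of_norm_bounded (summable_geometric_of_lt_one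
    (mul_nonneg M.γ_nonneg h.nonneg) h.contract) (h.abs_le ν s)

lemma RowBound.abs_occupancy_le (h : RowBound M π q) (ν : stdSimplex ℝ S) (s : S) :
    |occupancy M ν π s| ≤ (1 - M.γ * q)⁻¹ := by
  rw [occupancy, ← Real.norm_eq_abs]
  exact tsum_of_norm_bounded (hasSum_geometric_of_lt_one
    (mul_nonneg M.γ_nonneg h.nonneg) h.contract) (h.abs_le ν s)

/-- Split off the term `t = 0` of the series and factor one transition out of the remaining terms.
-/
lemma RowBound.occupancy_flow (h : RowBound M π q) (ν : stdSimplex ℝ S) (s' : S) :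
    occupancy M ν π s' =
      ν.1 s' + M.γ * ∑ s, ∑ a, occupancy M ν π s * π s a * (M.P s a).1 s' := by
  have h1 : HasSum (fun t => ∑ s, ∑ a, (M.γ ^ t * stateProb M ν π t s) * π s a * (M.P s a).1 s')
      (∑ s, ∑ a, occupancy M ν π s * π s a * (M.P s a).1 s') :=
    hasSum_sum fun s _ => hasSum_sum fun a _ =>
      (((h.summable ν s).hasSum.mul_right _).mul_right _)
  have h2 : ∀ t, M.γ ^ (t + 1) * stateProb M ν π (t + 1) s' =
      M.γ * ∑ s, ∑ a, (M.γ ^ t * stateProb M ν π t s) * π s a * (M.P s a).1 s' := by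
    intro t
    simp only [stateProb, Finset.mul_sum]
    refine Finset.sum_congr rfl fun s _ => Finset.sum_congr rfl fun a _ => by ring
  rw [occupancy, (h.summable ν s').tsum_eq_zero_add]
  simp only [h2, tsum_mul_left, h1.tsum_eq]
  simp [stateProb]

lemma RowBound.sum_occupancy_mul (h : RowBound M π q) (ν : stdSimplex ℝ S) (V : S → ℝ) :
    ∑ s, occupancy M ν π s * V s = ∑ s, ν.1 s * V s +
      ∑ s, occupancy M ν π s * (M.γ * ∑ a, π s a * nextValue M V s a) := by
  have : ∀ s', occupancy M ν π s' * V s' = ν.1 s' * V s' +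
      ∑ s, ∑ a, M.γ * occupancy M ν π s * π s a * ((M.P s a).1 s' * V s') := by
    intro s'
    conv_lhs => rw [h.occupancy_flow ν s']
    rw [add_mul, mul_assoc, Finset.sum_mul, Finset.mul_sum]
    congr 1
    refine Finset.sum_congr rfl fun s _ => ?_
    rw [Finset.sum_mul, Finset.mul_sum]
    exact Finset.sum_congr rfl fun a _ => by ring
  rw [Finset.sum_congr rfl fun s' _ => this s', Finset.sum_add_distrib, Finset.sum_comm]
  congr 1
  refine Finset.sum_congr rfl fun s _ => ?_
  rw [Finset.sum_comm, Finset.mul_sum, Finset.mul_sum]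
  refine Finset.sum_congr rfl fun a _ => ?_
  rw [nextValue, ← Finset.mul_sum]
  ring

/-- Performance difference identity. -/
lemma RowBound.performance_difference (h : RowBound M π q) (ν : stdSimplex ℝ S) (c V : S → ℝ) :
    ∑ s, occupancy M ν π s * c s - ∑ s, ν.1 s * V s =
      ∑ s, occupancy M ν π s * (c s + M.γ * ∑ a, π s a * nextValue M V s a - V s) := by
  have := h.sum_occupancy_mul ν V
  simp only [mul_sub, mul_add, Finset.sum_sub_distrib, Finset.sum_add_distrib]
  linarith

lemma stateProb_nonneg (M : MDP S A) (ν : stdSimplex ℝ S) (π : Policy S A) (t : ℕ) (s : S) :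
    0 ≤ stateProb M ν π.mat t s := by
  induction t generalizing s with
  | zero => exact ν.2.1 s
  | succ t ih =>
    exact Finset.sum_nonneg fun s _ => Finset.sum_nonneg fun a _ =>
      mul_nonneg (mul_nonneg (ih s) (π.mat_nonneg s a)) (M.P_nonneg _ _ _)

/-- This is the term `t = 0` of a nonnegative series. It turns full support of `ν` into positivity
of every occupancy. -/
lemma le_occupancy (M : MDP S A) (ν : stdSimplex ℝ S) (π : Policy S A) (s : S) :
    ν.1 s ≤ occupancy M ν π.mat s := by
  have := ((π.rowBound M).summable ν s).sum_le_tsum {0} fun t _ =>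
    mul_nonneg (pow_nonneg M.γ_nonneg t) (stateProb_nonneg M ν π t s)
  simpa [stateProb, occupancy] using this

lemma occupancy_nonneg (M : MDP S A) (ν : stdSimplex ℝ S) (π : Policy S A) (s : S) :
    0 ≤ occupancy M ν π.mat s := (ν.2.1 s).trans (le_occupancy M ν π s)

lemma sum_occupancy (M : MDP S A) (ν : stdSimplex ℝ S) (π : Policy S A) :
    ∑ s, occupancy M ν π.mat s = 1 / (1 - M.γ) := by
  have h1 := (π.rowBound M).sum_occupancy_mul ν (fun _ => 1)
  simp only [nextValue, mul_one, M.sum_P, π.sum_mat, ν.2.2] at h1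
  rw [← Finset.sum_mul] at h1
  rw [eq_div_iff M.one_sub_pos.ne']
  linarith

lemma visit_eq (M : MDP S A) (ν : stdSimplex ℝ S) (π : S → A → ℝ) (s : S) :
    visit M ν π s = (1 - M.γ) * occupancy M ν π s := rfl

/-- A weighted occupancy sum is at most the largest weight over `1 - γ`. -/
lemma sum_occupancy_mul_le (M : MDP S A) (ν : stdSimplex ℝ S) (π : Policy S A) {f : S → ℝ} {B : ℝ}
    (h : ∀ s, f s ≤ B) : ∑ s, occupancy M ν π.mat s * f s ≤ B / (1 - M.γ) := by
  calc ∑ s, occupancy M ν π.mat s * f s ≤ ∑ s, occupancy M ν π.mat s * B :=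
        Finset.sum_le_sum fun s _ => mul_le_mul_of_nonneg_left (h s) (occupancy_nonneg M ν π s)
    _ = B / (1 - M.γ) := by rw [← Finset.sum_mul, sum_occupancy]; ring

end Occupancy

/-! ### Policy evaluation: the linear equation dual to the flow equation. -/

section Value

variable {S : Type u} {A : Type v} [Fintype S] [Fintype A]

lemma sum_mat_mul_le (π : Policy S A) (s : S) {f : A → ℝ} {B : ℝ} (h : ∀ a, f a ≤ B) :
    ∑ a, π.mat s a * f a ≤ B := by
  calc ∑ a, π.mat s a * f a ≤ ∑ a, π.mat s a * B :=
        Finset.sum_le_sum fun a _ => mul_le_mul_of_nonneg_left (h a) (π.mat_nonneg s a)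
    _ = B := by rw [← Finset.sum_mul, π.sum_mat, one_mul]

lemma abs_sum_mat_mul_le (π : Policy S A) (s : S) {f : A → ℝ} {B : ℝ} (h : ∀ a, |f a| ≤ B) :
    |∑ a, π.mat s a * f a| ≤ B := by
  rw [abs_le]
  constructor
  · have := sum_mat_mul_le π s (f := fun a => -f a) (B := B) fun a => by
      linarith [(abs_le.1 (h a)).1]
    simp only [mul_neg, Finset.sum_neg_distrib] at this
    linarith
  · exact sum_mat_mul_le π s fun a => (abs_le.1 (h a)).2

/-- Bound on a function from a bound on its Bellman residual. -/
lemma abs_le_of_residual (M : MDP S A) (π : Policy S A) {V : S → ℝ} {B : ℝ}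
    (h : ∀ s, |V s - M.γ * ∑ a, π.mat s a * nextValue M V s a| ≤ B) (s : S) :
    |V s| ≤ B / (1 - M.γ) := by
  have : Nonempty S := ⟨s⟩
  -- Maximum principle: where `|V|` is largest, the averaged next value is no larger, so `(1 - γ) *
  -- |V m|` is bounded by the residual.
  obtain ⟨m, hm⟩ := Finite.exists_max fun s => |V s|
  refine (hm s).trans ?_
  rw [le_div_iff₀ M.one_sub_pos]
  have h1 := abs_sum_mat_mul_le π m fun a => abs_nextValue_le M hm m a
  have h2 := abs_sub_abs_le_abs_sub (V m) (M.γ * ∑ a, π.mat m a * nextValue M V m a)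
  rw [abs_mul, abs_of_nonneg M.γ_nonneg] at h2
  have h3 := mul_le_mul_of_nonneg_left h1 M.γ_nonneg
  linarith [h m]

/-- Minimum principle: at a minimizer `m` the averaged next value is at least `V m`, so a negative
`V m` would make the residual there negative. -/
lemma nonneg_of_residual (M : MDP S A) (π : Policy S A) {V : S → ℝ}
    (h : ∀ s, 0 ≤ V s - M.γ * ∑ a, π.mat s a * nextValue M V s a) (s : S) : 0 ≤ V s := by
  have : Nonempty S := ⟨s⟩
  obtain ⟨m, hm⟩ := Finite.exists_min V
  refine le_trans ?_ (hm s)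
  have h1 : V m ≤ ∑ a, π.mat m a * nextValue M V m a := by
    have := sum_mat_mul_le π m (f := fun a => -nextValue M V m a) (B := -V m) fun a =>
      neg_le_neg (le_nextValue M hm m a)
    simp only [mul_neg, Finset.sum_neg_distrib] at this
    linarith
  have h2 := mul_le_mul_of_nonneg_left h1 M.γ_nonneg
  have h3 := h m
  by_contra hneg
  push Not at hneg
  nlinarith [M.one_sub_pos]

/-- In finite dimension injectivity of `V ↦ V - γ P_π V` gives surjectivity, and injectivity is the
residual bound with `B = 0`. -/
lemma exists_value (M : MDP S A) (π : Policy S A) (c : S → ℝ) :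
    ∃ V : S → ℝ, ∀ s, V s = c s + M.γ * ∑ a, π.mat s a * nextValue M V s a := by
  let F : (S → ℝ) →ₗ[ℝ] (S → ℝ) :=
    { toFun := fun V s => V s - M.γ * ∑ a, π.mat s a * nextValue M V s a
      map_add' := fun V W => by
        ext s
        simp only [nextValue, Pi.add_apply, mul_add, Finset.sum_add_distrib]
        ring
      map_smul' := fun k V => by
        ext s
        simp only [nextValue, Pi.smul_apply, smul_eq_mul, RingHom.id_apply, mul_sub,
          Finset.mul_sum]
        congr 1
        refine Finset.sum_congr rfl fun a _ => Finset.sum_congr rfl fun s' _ => by ring }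
  have hinj : Function.Injective F := by
    rw [← LinearMap.ker_eq_bot, LinearMap.ker_eq_bot']
    intro V hV
    ext s
    have := abs_le_of_residual M π (V := V) (B := 0) (fun s => by
      have : F V s = 0 := by rw [hV]; rfl
      exact (abs_nonpos_iff.2 this)) s
    simpa using this
  obtain ⟨V, hV⟩ := (LinearMap.injective_iff_surjective.1 hinj) c
  refine ⟨V, fun s => ?_⟩
  have : F V s = c s := by rw [hV]
  change V s - _ = c s at this
  linarith

/-- The solution of the evaluation equation `V = c + γ P_π V`. -/
def value (M : MDP S A) (π : Policy S A) (c : S → ℝ) : S → ℝ := (exists_value M π c).choose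

lemma value_eq (M : MDP S A) (π : Policy S A) (c : S → ℝ) (s : S) :
    value M π c s = c s + M.γ * ∑ a, π.mat s a * nextValue M (value M π c) s a :=
  (exists_value M π c).choose_spec s

lemma abs_value_le (M : MDP S A) (π : Policy S A) {c : S → ℝ} {B : ℝ} (h : ∀ s, |c s| ≤ B)
    (s : S) : |value M π c s| ≤ B / (1 - M.γ) := by
  refine abs_le_of_residual M π (fun s => ?_) s
  have := value_eq M π c s
  rw [show value M π c s - M.γ * ∑ a, π.mat s a * nextValue M (value M π c) s a = c s by linarith]
  exact h s

/-- Occupancy sums compared with those of a policy. -/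
lemma RowBound.sum_occupancy_sub {M : MDP S A} {x : S → A → ℝ} {q : ℝ} (h : RowBound M x q)
    (ν : stdSimplex ℝ S) (π : Policy S A) (c c₀ : S → ℝ) :
    ∑ s, occupancy M ν x s * c s - ∑ s, occupancy M ν π.mat s * c₀ s =
      ∑ s, occupancy M ν x s * (c s - c₀ s + M.γ *
        ∑ a, (x s a - π.mat s a) * nextValue M (value M π c₀) s a) := by
  have h1 := h.performance_difference ν c (value M π c₀)
  have h2 := (π.rowBound M).performance_difference ν c₀ (value M π c₀)
  have h3 : ∑ s, occupancy M ν π.mat s *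
      (c₀ s + M.γ * ∑ a, π.mat s a * nextValue M (value M π c₀) s a - value M π c₀ s) = 0 :=
    Finset.sum_eq_zero fun s _ => by
      rw [← value_eq M π c₀ s]; ring
  rw [h3] at h2
  rw [show ∑ s, occupancy M ν π.mat s * c₀ s = ∑ s, ν.1 s * value M π c₀ s by linarith, h1]
  refine Finset.sum_congr rfl fun s _ => ?_
  conv_lhs => rw [value_eq M π c₀ s]
  simp only [sub_mul, Finset.sum_sub_distrib]
  ring

/-- Occupancy and value are dual: the performance difference is taken with `V` the value of `π`
itself, whose Bellman residual is zero. -/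
lemma sum_occupancy_eq_sum_value (M : MDP S A) (ν : stdSimplex ℝ S) (π : Policy S A) (c : S → ℝ) :
    ∑ s, occupancy M ν π.mat s * c s = ∑ s, ν.1 s * value M π c s := by
  have h2 := (π.rowBound M).performance_difference ν c (value M π c)
  have h3 : ∑ s, occupancy M ν π.mat s *
      (c s + M.γ * ∑ a, π.mat s a * nextValue M (value M π c) s a - value M π c s) = 0 :=
    Finset.sum_eq_zero fun s _ => by
      rw [← value_eq M π c s]; ring
  linarith

end Value

/-! ### Two facts from differential calculus. -/

section Calculus

/-- Where one factor vanishes, the product rule asks only continuity of the other: the term `(f x -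
f x₀) * g' (x - x₀)` is already of smaller order. -/
lemma HasFDerivAt.mul_of_eq_zero {E : Type*} [NormedAddCommGroup E] [NormedSpace ℝ E]
    {f g : E → ℝ} {g' : E →L[ℝ] ℝ} {x₀ : E} (hf : ContinuousAt f x₀) (hg : HasFDerivAt g g' x₀)
    (h0 : g x₀ = 0) : HasFDerivAt (fun x => f x * g x) (f x₀ • g') x₀ := by
  rw [hasFDerivAt_iff_isLittleO] at hg ⊢
  have h1 : (fun x => f x * (g x - g x₀ - g' (x - x₀))) =o[nhds x₀] fun x => (1 : ℝ) * ‖x - x₀‖ :=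
    (hf.isBigO_one ℝ).mul_isLittleO hg.norm_right
  have h2 : (fun x => (f x - f x₀) * g' (x - x₀)) =o[nhds x₀] fun x => (1 : ℝ) * ‖x - x₀‖ := by
    refine Asymptotics.IsLittleO.mul_isBigO ?_ (g'.isBigO_sub _ _).norm_right
    rw [Asymptotics.isLittleO_one_iff]
    have := hf.sub (continuousAt_const (y := f x₀))
    simpa [ContinuousAt, Pi.sub_def] using this
  have h3 := h1.add h2
  simp only [one_mul] at h3
  refine Asymptotics.IsLittleO.of_norm_right (h3.congr_left fun x => ?_)
  simp only [h0, _root_.smul_apply, smul_eq_mul]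
  ring

/-- First-order condition for convex functions. -/
lemma ConvexOn.add_fderiv_le {E : Type*} [NormedAddCommGroup E] [NormedSpace ℝ E]
    {s : Set E} {f : E → ℝ} (hf : ConvexOn ℝ s f) {p q : E} (hp : p ∈ s) (hq : q ∈ s)
    (hd : DifferentiableAt ℝ f p) : f p + fderiv ℝ f p (q - p) ≤ f q := by
  have hl : HasDerivAt (fun t : ℝ => p + t • (q - p)) (q - p) 0 := by
    simpa using ((hasDerivAt_id (0 : ℝ)).smul_const (q - p)).const_add p
  have hd' : HasFDerivAt f (fderiv ℝ f p) (p + (0 : ℝ) • (q - p)) := by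
    simpa using hd.hasFDerivAt
  have hφ := hd'.comp_hasDerivAt (0 : ℝ) hl
  have hlim := hφ.tendsto_slope_zero_right
  have : fderiv ℝ f p (q - p) ≤ f q - f p := by
    refine le_of_tendsto hlim ?_
    have hmem : Set.Ioo (0 : ℝ) 1 ∈ nhdsWithin (0 : ℝ) (Set.Ioi 0) :=
      Ioo_mem_nhdsGT one_pos
    filter_upwards [hmem] with t ht
    have hc := hf.2 hp hq (show 0 ≤ 1 - t by linarith [ht.2]) ht.1.le (by ring)
    have he : (1 - t) • p + t • q = p + t • (q - p) := by
      rw [sub_smul, smul_sub, one_smul]; abel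
    rw [he] at hc
    simp only [smul_eq_mul] at hc
    simp only [zero_add, Function.comp, zero_smul, add_zero, smul_eq_mul]
    rw [inv_mul_le_iff₀ ht.1]
    linarith
  linarith

end Calculus

/-! ### State-action matrices in the Euclidean norm. -/

section Euclid

variable {S : Type u} {A : Type v} [Fintype S] [Fintype A]

/-- State-action matrices as vectors of a Euclidean space. -/
def toEuclid : (S → A → ℝ) →ₗ[ℝ] EuclideanSpace ℝ (S × A) where
  toFun x := WithLp.toLp 2 fun p => x p.1 p.2
  map_add' _ _ := rfl
  map_smul' _ _ := rfl

lemma toEuclid_apply (x : S → A → ℝ) (p : S × A) : toEuclid x p = x p.1 p.2 := rfl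

lemma norm_toEuclid (x : S → A → ℝ) : ‖toEuclid x‖ = norm2 x := by
  rw [EuclideanSpace.norm_eq, norm2, Fintype.sum_prod_type]
  simp [toEuclid_apply]

lemma inner_toEuclid (x y : S → A → ℝ) :
    inner ℝ (toEuclid x) (toEuclid y) = ∑ s, ∑ a, x s a * y s a := by
  rw [PiLp.inner_apply, Fintype.sum_prod_type]
  simp [toEuclid_apply, mul_comm]

lemma norm2_nonneg (x : S → A → ℝ) : 0 ≤ norm2 x := Real.sqrt_nonneg _

lemma norm2_sq (x : S → A → ℝ) : norm2 x ^ 2 = ∑ s, ∑ a, x s a ^ 2 :=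
  Real.sq_sqrt (Finset.sum_nonneg fun _ _ => Finset.sum_nonneg fun _ _ => sq_nonneg _)

lemma norm2_add_le (x y : S → A → ℝ) : norm2 (x + y) ≤ norm2 x + norm2 y := by
  simp only [← norm_toEuclid, map_add]
  exact norm_add_le _ _

lemma norm2_sub_comm (x y : S → A → ℝ) : norm2 (x - y) = norm2 (y - x) := by
  simp only [← norm_toEuclid, map_sub]
  exact norm_sub_rev _ _

/-- Cauchy–Schwarz on a single row. Used for the difference of two policies, it contributes one
factor `√|A|` to the smoothness constant. -/
lemma row_sum_abs_le (x : S → A → ℝ) (s : S) :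
    ∑ a, |x s a| ≤ Real.sqrt (Fintype.card A) * norm2 x := by
  refine abs_le_of_sq_le_sq' ?_ (mul_nonneg (Real.sqrt_nonneg _) (norm2_nonneg x)) |>.2
  rw [mul_pow, norm2_sq, Real.sq_sqrt (Nat.cast_nonneg _)]
  calc (∑ a, |x s a|) ^ 2 ≤ (Fintype.card A : ℝ) * ∑ a, |x s a| ^ 2 := by
        simpa using sq_sum_le_card_mul_sum_sq (s := Finset.univ) (f := fun a => |x s a|)
    _ ≤ _ := by
        refine mul_le_mul_of_nonneg_left ?_ (Nat.cast_nonneg _)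
        simp only [sq_abs]
        exact Finset.single_le_sum (f := fun s => ∑ a, x s a ^ 2)
          (fun _ _ => Finset.sum_nonneg fun _ _ => sq_nonneg _) (Finset.mem_univ s)

/-- The action sum costs `√|A|`. In the state variable `ℓ²` is bounded by `ℓ¹`, so no factor `√|S|`
appears. -/
lemma norm2_mul_le (f : S → ℝ) {g : S → A → ℝ} {B : ℝ} (hB : 0 ≤ B) (hg : ∀ s a, |g s a| ≤ B) :
    norm2 (fun s a => f s * g s a) ≤ Real.sqrt (Fintype.card A) * B * ∑ s, |f s| := by
  have hS : 0 ≤ ∑ s, |f s| := Finset.sum_nonneg fun _ _ => abs_nonneg _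
  refine abs_le_of_sq_le_sq' ?_ (by positivity) |>.2
  rw [mul_pow, mul_pow, norm2_sq, Real.sq_sqrt (Nat.cast_nonneg _)]
  calc ∑ s, ∑ a, (f s * g s a) ^ 2 ≤ ∑ s, ∑ _a : A, |f s| ^ 2 * B ^ 2 := by
        refine Finset.sum_le_sum fun s _ => Finset.sum_le_sum fun a _ => ?_
        rw [mul_pow, sq_abs]
        refine mul_le_mul_of_nonneg_left ?_ (sq_nonneg _)
        rw [← sq_abs]
        exact pow_le_pow_left₀ (abs_nonneg _) (hg s a) 2
    _ = Fintype.card A * B ^ 2 * ∑ s, |f s| ^ 2 := by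
        simp only [Finset.sum_const, Finset.card_univ, nsmul_eq_mul, Finset.mul_sum]
        exact Finset.sum_congr rfl fun s _ => by ring
    _ ≤ _ := by
        refine mul_le_mul_of_nonneg_left ?_ (by positivity)
        exact Finset.sum_sq_le_sq_sum_of_nonneg fun _ _ => abs_nonneg _

end Euclid

/-! ### Consequences of convexity of the regularizer. -/

section Regularizer

variable {A : Type v} [Fintype A] [DecidableEq A] {Ω : (A → ℝ) → ℝ} {CΦ Ct : ℝ}

lemma fderiv_eq_sum_gradΩ (Ω : (A → ℝ) → ℝ) (p h : A → ℝ) :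
    fderiv ℝ Ω p h = ∑ a, h a * gradΩ Ω p a := by
  conv_lhs => rw [show h = ∑ a, h a • (Pi.single a 1 : A → ℝ) by
    ext b; simp [Finset.sum_apply, Pi.single_apply]]
  simp [gradΩ, map_sum]

namespace IsRegularizer

lemma add_grad_le (hΩ : IsRegularizer Ω CΦ Ct) {p q : A → ℝ} (hp : p ∈ stdSimplex ℝ A)
    (hq : q ∈ stdSimplex ℝ A) : Ω p + ∑ a, (q a - p a) * gradΩ Ω p a ≤ Ω q := by
  have := hΩ.convex.add_fderiv_le hp hq (hΩ.differentiable p hp)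
  rwa [fderiv_eq_sum_gradΩ] at this

lemma nonneg_bound [Nonempty A] (hΩ : IsRegularizer Ω CΦ Ct) : 0 ≤ CΦ := by
  have ⟨a⟩ := ‹Nonempty A›
  have h := single_mem_stdSimplex ℝ a
  exact (hΩ.nonneg _ h).trans (hΩ.le_CΦ _ h)

lemma nonneg_const [Nonempty A] (hΩ : IsRegularizer Ω CΦ Ct) : 0 ≤ Ct :=
  hΩ.nonneg_bound.trans hΩ.CΦ_le

/-- The Lipschitz bound comes from the first-order inequality at `p` and the gradient bound there;
no mean value theorem along the segment is needed. -/
lemma sub_le (hΩ : IsRegularizer Ω CΦ Ct) {p q : A → ℝ} (hp : p ∈ stdSimplex ℝ A)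
    (hq : q ∈ stdSimplex ℝ A) : Ω p - Ω q ≤ Ct * ∑ a, |p a - q a| := by
  have h1 := hΩ.add_grad_le hp hq
  have h2 : -(Ct * ∑ a, |p a - q a|) ≤ ∑ a, (q a - p a) * gradΩ Ω p a := by
    rw [Finset.mul_sum, ← Finset.sum_neg_distrib]
    refine Finset.sum_le_sum fun a _ => ?_
    have h3 : |(q a - p a) * gradΩ Ω p a| ≤ |p a - q a| * Ct := by
      rw [abs_mul, abs_sub_comm]
      exact mul_le_mul_of_nonneg_left (hΩ.grad_le p hp a) (abs_nonneg _)
    linarith [(abs_le.1 h3).1]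
  linarith

lemma abs_sub_le (hΩ : IsRegularizer Ω CΦ Ct) {p q : A → ℝ} (hp : p ∈ stdSimplex ℝ A)
    (hq : q ∈ stdSimplex ℝ A) : |Ω p - Ω q| ≤ Ct * ∑ a, |p a - q a| := by
  rw [abs_le]
  have := hΩ.sub_le hq hp
  simp only [abs_sub_comm (q _)] at this
  exact ⟨by linarith, hΩ.sub_le hp hq⟩

end IsRegularizer

end Regularizer

/-! ### Performance differences and the policy gradient. -/

section Gradient

variable {S : Type u} {A : Type v} [Fintype S] [Fintype A]

/-- Expected regularized reward of one step. -/
def stageReward (M : MDP S A) (Ω : (A → ℝ) → ℝ) (lam : ℝ) (π : S → A → ℝ) (s : S) : ℝ :=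
  (∑ a, π s a * M.r s a) - lam * Ω (π s)

lemma RowBound.J_eq {M : MDP S A} {π : S → A → ℝ} {q : ℝ} (h : RowBound M π q)
    (Ω : (A → ℝ) → ℝ) (lam : ℝ) (ν : stdSimplex ℝ S) :
    J M Ω lam ν π = ∑ s, occupancy M ν π s * stageReward M Ω lam π s := by
  have h1 : HasSum (fun t => ∑ s, (M.γ ^ t * stateProb M ν π t s) * stageReward M Ω lam π s)
      (∑ s, occupancy M ν π s * stageReward M Ω lam π s) :=
    hasSum_sum fun s _ => (h.summable ν s).hasSum.mul_right _
  rw [← h1.tsum_eq, J]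
  refine tsum_congr fun t => ?_
  rw [Finset.mul_sum]
  exact Finset.sum_congr rfl fun s _ => by rw [stageReward]; ring

/-- State value of a policy for the regularized reward. -/
def regValue (M : MDP S A) (Ω : (A → ℝ) → ℝ) (lam : ℝ) (π : Policy S A) : S → ℝ :=
  value M π (stageReward M Ω lam π.mat)

/-- State-action value of a policy (without the regularizer of the first step). -/
def regQ (M : MDP S A) (Ω : (A → ℝ) → ℝ) (lam : ℝ) (π : Policy S A) (s : S) (a : A) : ℝ :=
  M.r s a + M.γ * nextValue M (regValue M Ω lam π) s a

lemma regValue_eq (M : MDP S A) (Ω : (A → ℝ) → ℝ) (lam : ℝ) (π : Policy S A) (s : S) :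
    regValue M Ω lam π s = (∑ a, π.mat s a * regQ M Ω lam π s a) - lam * Ω (π.mat s) := by
  have := value_eq M π (stageReward M Ω lam π.mat) s
  rw [regValue, this, stageReward]
  simp only [regQ, regValue, mul_add, Finset.sum_add_distrib, Finset.mul_sum]
  have : ∀ a, π.mat s a * (M.γ * nextValue M (value M π (stageReward M Ω lam π.mat)) s a) =
    M.γ * (π.mat s a * nextValue M (value M π (stageReward M Ω lam π.mat)) s a) :=
    fun a => by ring
  simp only [this]
  ring

lemma J_eq_sum_regValue (M : MDP S A) (Ω : (A → ℝ) → ℝ) (lam : ℝ) (ν : stdSimplex ℝ S)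
    (π : Policy S A) : J M Ω lam ν π.mat = ∑ s, ν.1 s * regValue M Ω lam π s := by
  rw [(π.rowBound M).J_eq, sum_occupancy_eq_sum_value]; rfl

/-- Performance difference of a matrix and a policy. -/
lemma RowBound.J_sub {M : MDP S A} {x : S → A → ℝ} {q : ℝ} (h : RowBound M x q)
    (Ω : (A → ℝ) → ℝ) (lam : ℝ) (ν : stdSimplex ℝ S) (π : Policy S A) :
    J M Ω lam ν x - J M Ω lam ν π.mat =
      ∑ s, occupancy M ν x s * (∑ a, (x s a - π.mat s a) * regQ M Ω lam π s a -
        lam * (Ω (x s) - Ω (π.mat s))) := by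
  rw [h.J_eq, (π.rowBound M).J_eq, h.sum_occupancy_sub]
  refine Finset.sum_congr rfl fun s _ => ?_
  congr 1
  simp only [regQ, regValue]
  generalize value M π (stageReward M Ω lam π.mat) = V
  have : ∀ y : S → A → ℝ, ∑ a, y s a * (M.γ * nextValue M V s a) =
      M.γ * ∑ a, y s a * nextValue M V s a := by
    intro y
    rw [Finset.mul_sum]
    exact Finset.sum_congr rfl fun a _ => by ring
  simp only [stageReward, mul_add, Finset.sum_add_distrib, sub_mul, Finset.sum_sub_distrib, this]
  ring

lemma eventually_rowBound (M : MDP S A) (π : Policy S A) :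
    ∃ q, ∀ᶠ x in nhds π.mat, RowBound M x q := by
  have hg := M.γ_nonneg
  have hg1 := M.γ_lt_one
  -- The number `2 / (1 + γ)` exceeds `1`, so nearby matrices satisfy the row bound, while `γ * (2 /
  -- (1 + γ)) < 1` still gives geometric convergence.
  have hq : 1 < 2 / (1 + M.γ) := by rw [lt_div_iff₀ (by linarith)]; linarith
  refine ⟨2 / (1 + M.γ), ?_⟩
  have hev : ∀ s, ∀ᶠ x : S → A → ℝ in nhds π.mat, ∑ a, |x s a| < 2 / (1 + M.γ) := fun s => by
    have hc : Continuous fun x : S → A → ℝ => ∑ a, |x s a| := by fun_prop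
    exact hc.continuousAt.eventually_lt continuousAt_const (by rw [π.sum_abs_mat]; exact hq)
  filter_upwards [Filter.eventually_all.2 hev] with x hx
  refine ⟨by linarith, ?_, fun s => (hx s).le⟩
  rw [← mul_div_assoc, div_lt_one (by linarith)]
  linarith

variable [DecidableEq S] [DecidableEq A]

/-- With the indicator of `s₀` as reward, the comparison formula writes the difference of
occupancies as locally bounded occupancies times a continuous function of `x` that vanishes at `π`.
-/
lemma continuousAt_occupancy (M : MDP S A) (ν : stdSimplex ℝ S) (π : Policy S A) (s₀ : S) :
    ContinuousAt (fun x => occupancy M ν x s₀) π.mat := by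
  obtain ⟨q, hq⟩ := eventually_rowBound M π
  set c : S → ℝ := Pi.single s₀ 1 with hc
  have hsum : ∀ x, ∑ s, occupancy M ν x s * c s = occupancy M ν x s₀ := fun x => by
    simp [hc, Pi.single_apply]
  set W := nextValue M (value M π c)
  have hb : ∀ᶠ x in nhds π.mat, ‖occupancy M ν x s₀ - occupancy M ν π.mat s₀‖ ≤
      ∑ s, (1 - M.γ * q)⁻¹ * |M.γ * ∑ a, (x s a - π.mat s a) * W s a| := by
    filter_upwards [hq] with x hx
    rw [← hsum, ← hsum, hx.sum_occupancy_sub, Real.norm_eq_abs]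
    refine (Finset.abs_sum_le_sum_abs _ _).trans (Finset.sum_le_sum fun s _ => ?_)
    rw [sub_self, zero_add, abs_mul]
    exact mul_le_mul_of_nonneg_right (hx.abs_occupancy_le ν s) (abs_nonneg _)
  rw [ContinuousAt, tendsto_iff_norm_sub_tendsto_zero]
  refine squeeze_zero' (Filter.Eventually.of_forall fun _ => norm_nonneg _) hb ?_
  have hcont : Continuous fun x : S → A → ℝ =>
      ∑ s, (1 - M.γ * q)⁻¹ * |M.γ * ∑ a, (x s a - π.mat s a) * W s a| := by fun_prop
  have := hcont.tendsto π.mat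
  simpa using this

/-- State-action value minus the gradient of the regularizer. -/
def regAdv (M : MDP S A) (Ω : (A → ℝ) → ℝ) (lam : ℝ) (π : Policy S A) (s : S) (a : A) : ℝ :=
  regQ M Ω lam π s a - lam * gradΩ Ω (π.mat s) a

/-- Near `π` the identity `RowBound.J_sub` writes `J` as a constant plus a sum of products of an
occupancy and a gain vanishing at `π`. Each product is differentiated by
`HasFDerivAt.mul_of_eq_zero`. -/
lemma hasFDerivAt_J (M : MDP S A) {Ω : (A → ℝ) → ℝ} {CΦ Ct : ℝ} (hΩ : IsRegularizer Ω CΦ Ct)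
    (lam : ℝ) (ν : stdSimplex ℝ S) (π : Policy S A) :
    ∃ L : (S → A → ℝ) →L[ℝ] ℝ, HasFDerivAt (J M Ω lam ν) L π.mat ∧
      ∀ h, L h = ∑ s, occupancy M ν π.mat s * ∑ a, h s a * regAdv M Ω lam π s a := by
  let pr : S → (S → A → ℝ) →L[ℝ] (A → ℝ) := fun s => ContinuousLinearMap.proj s
  let b' : S → (S → A → ℝ) →L[ℝ] ℝ := fun s =>
    (∑ a, regQ M Ω lam π s a • (ContinuousLinearMap.proj a).comp (pr s)) -
      lam • (fderiv ℝ Ω (π.mat s)).comp (pr s)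
  have hb : ∀ s, HasFDerivAt (fun x : S → A → ℝ =>
      ∑ a, (x s a - π.mat s a) * regQ M Ω lam π s a - lam * (Ω (x s) - Ω (π.mat s)))
      (b' s) π.mat := by
    intro s
    refine HasFDerivAt.sub (HasFDerivAt.fun_sum fun a _ => ?_) ?_
    · have := (((ContinuousLinearMap.proj (R := ℝ) (φ := fun _ : A => ℝ) a).comp
        (pr s)).hasFDerivAt (x := π.mat)).sub_const (π.mat s a)
      exact this.mul_const _
    · refine HasFDerivAt.const_mul (HasFDerivAt.sub_const _ ?_) lam
      exact ((hΩ.differentiable _ (π.mat_mem s)).hasFDerivAt).comp π.mat (pr s).hasFDerivAt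
  have hsum := HasFDerivAt.fun_sum (u := Finset.univ) fun s _ =>
    (hb s).mul_of_eq_zero (continuousAt_occupancy M ν π s) (by simp)
  refine ⟨_, (hsum.const_add (J M Ω lam ν π.mat)).congr_of_eventuallyEq ?_, fun h => ?_⟩
  · obtain ⟨q, hq⟩ := eventually_rowBound M π
    filter_upwards [hq] with x hx
    rw [← hx.J_sub]
    ring
  · simp only [_root_.sum_apply, _root_.smul_apply, smul_eq_mul]
    refine Finset.sum_congr rfl fun s _ => ?_
    congr 1
    simp only [b', pr, _root_.sub_apply, _root_.sum_apply,
      _root_.smul_apply, ContinuousLinearMap.comp_apply,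
      ContinuousLinearMap.proj_apply, smul_eq_mul, fderiv_eq_sum_gradΩ, regAdv, mul_sub,
      Finset.sum_sub_distrib, Finset.mul_sum]
    congr 1
    · exact Finset.sum_congr rfl fun a _ => by ring
    · exact Finset.sum_congr rfl fun a _ => by ring

lemma differentiableAt_J (M : MDP S A) {Ω : (A → ℝ) → ℝ} {CΦ Ct : ℝ} (hΩ : IsRegularizer Ω CΦ Ct)
    (lam : ℝ) (ν : stdSimplex ℝ S) (π : Policy S A) :
    DifferentiableAt ℝ (J M Ω lam ν) π.mat :=
  (hasFDerivAt_J M hΩ lam ν π).choose_spec.1.differentiableAt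

/-- Policy gradient formula. -/
lemma gradπ_J (M : MDP S A) {Ω : (A → ℝ) → ℝ} {CΦ Ct : ℝ} (hΩ : IsRegularizer Ω CΦ Ct)
    (lam : ℝ) (ν : stdSimplex ℝ S) (π : Policy S A) :
    gradπ (J M Ω lam ν) π.mat =
      fun s a => occupancy M ν π.mat s * regAdv M Ω lam π s a := by
  obtain ⟨L, hL, hL'⟩ := hasFDerivAt_J M hΩ lam ν π
  ext s a
  rw [gradπ, hL.fderiv, hL', Finset.sum_eq_single s]
  · rw [Finset.sum_eq_single a] <;> simp +contextual
  · intro t _ ht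
    simp [Pi.single_eq_of_ne ht]
  · simp

end Gradient

/-! ### Smoothness of the objective on policies. -/

section Smoothness

variable {S : Type u} {A : Type v} [Fintype S] [Fintype A]

lemma abs_sum_mul_le {ι : Type*} [Fintype ι] (x : ι → ℝ) {f : ι → ℝ} {B : ℝ}
    (h : ∀ a, |f a| ≤ B) : |∑ a, x a * f a| ≤ (∑ a, |x a|) * B := by
  rw [Finset.sum_mul]
  refine (Finset.abs_sum_le_sum_abs _ _).trans (Finset.sum_le_sum fun a _ => ?_)
  rw [abs_mul]
  exact mul_le_mul_of_nonneg_left (h a) (abs_nonneg _)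

/-- `ℓ¹`-Lipschitz continuity of the occupancy measure. -/
lemma sum_abs_occupancy_sub_le (M : MDP S A) (ν : stdSimplex ℝ S) (π π' : Policy S A) {m : ℝ}
    (hm : ∀ s, ∑ a, |π.mat s a - π'.mat s a| ≤ m) :
    ∑ s, |occupancy M ν π.mat s - occupancy M ν π'.mat s| ≤ m / (1 - M.γ) ^ 2 := by
  rcases isEmpty_or_nonempty S with hS | ⟨⟨s₀⟩⟩
  · have h1 : ∑ s, ν.1 s = 1 := ν.2.2
    simp at h1
  have hm0 : 0 ≤ m := (Finset.sum_nonneg fun _ _ => abs_nonneg _).trans (hm s₀)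
  have hγ := M.one_sub_pos
  -- Summing against the signs of the differences turns the `ℓ¹` distance into a difference of two
  -- occupancy sums. One factor `1 / (1 - γ)` then comes from the value of `σ`, the other from the
  -- total occupancy.
  set σ : S → ℝ := fun s => SignType.sign (occupancy M ν π.mat s - occupancy M ν π'.mat s)
  have hσ : ∀ s, |σ s| ≤ 1 := fun s => by
    simp only [σ]
    rcases lt_trichotomy (occupancy M ν π.mat s - occupancy M ν π'.mat s) 0 with h | h | h <;>
      simp [h, sign_neg, sign_pos]
  have h1 : ∑ s, |occupancy M ν π.mat s - occupancy M ν π'.mat s| =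
      ∑ s, occupancy M ν π.mat s * σ s - ∑ s, occupancy M ν π'.mat s * σ s := by
    rw [← Finset.sum_sub_distrib]
    refine Finset.sum_congr rfl fun s _ => ?_
    rw [← sub_mul, self_mul_sign]
  rw [h1, (π.rowBound M).sum_occupancy_sub]
  have hW : ∀ s a, |nextValue M (value M π' σ) s a| ≤ 1 / (1 - M.γ) :=
    fun s a => abs_nextValue_le M (abs_value_le M π' hσ) s a
  refine (sum_occupancy_mul_le M ν π (B := m * (1 / (1 - M.γ))) fun s => ?_).trans (le_of_eq ?_)
  · rw [sub_self, zero_add]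
    have h2 := (le_abs_self _).trans
      (abs_sum_mul_le (fun a => π.mat s a - π'.mat s a) (hW s))
    have h3 : (∑ a, |π.mat s a - π'.mat s a|) * (1 / (1 - M.γ)) ≤ m * (1 / (1 - M.γ)) :=
      mul_le_mul_of_nonneg_right (hm s) (by positivity)
    have h4 : 0 ≤ m * (1 / (1 - M.γ)) := by positivity
    nlinarith [M.γ_nonneg, M.γ_lt_one]
  · field_simp

variable [Nonempty A] [DecidableEq A] {M : MDP S A} {Ω : (A → ℝ) → ℝ} {CΦ Ct lam : ℝ}

lemma stageReward_le (hΩ : IsRegularizer Ω CΦ Ct) (hlam : 0 ≤ lam) (π : Policy S A) (s : S) :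
    stageReward M Ω lam π.mat s ≤ 1 := by
  have h1 := sum_mat_mul_le π s (M.r_le_one s)
  have h2 := mul_nonneg hlam (hΩ.nonneg _ (π.mat_mem s))
  rw [stageReward]
  linarith

lemma le_stageReward (hΩ : IsRegularizer Ω CΦ Ct) (hlam : 0 ≤ lam) (π : Policy S A) (s : S) :
    -(lam * CΦ) ≤ stageReward M Ω lam π.mat s := by
  have h1 : 0 ≤ ∑ a, π.mat s a * M.r s a :=
    Finset.sum_nonneg fun a _ => mul_nonneg (π.mat_nonneg s a) (M.r_nonneg s a)
  have h2 := mul_le_mul_of_nonneg_left (hΩ.le_CΦ _ (π.mat_mem s)) hlam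
  rw [stageReward]
  linarith

lemma abs_stageReward_le (hΩ : IsRegularizer Ω CΦ Ct) (hlam : 0 ≤ lam) (π : Policy S A) (s : S) :
    |stageReward M Ω lam π.mat s| ≤ 1 + lam * CΦ := by
  have h1 := stageReward_le (M := M) hΩ hlam π s
  have h2 := le_stageReward (M := M) hΩ hlam π s
  have h3 := mul_nonneg hlam hΩ.nonneg_bound
  rw [abs_le]
  constructor <;> linarith

lemma abs_regValue_le (hΩ : IsRegularizer Ω CΦ Ct) (hlam : 0 ≤ lam) (π : Policy S A) (s : S) :
    |regValue M Ω lam π s| ≤ (1 + lam * CΦ) / (1 - M.γ) :=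
  abs_value_le M π (abs_stageReward_le hΩ hlam π) s

lemma IsRegularizer.const_le (hΩ : IsRegularizer Ω CΦ Ct) (hlam : 0 ≤ lam) :
    1 + lam * CΦ ≤ 1 + lam * Ct := by
  linarith [mul_le_mul_of_nonneg_left hΩ.CΦ_le hlam]

lemma IsRegularizer.one_le_const (hΩ : IsRegularizer Ω CΦ Ct) (hlam : 0 ≤ lam) :
    1 ≤ 1 + lam * Ct := by
  linarith [mul_nonneg hlam hΩ.nonneg_const]

/-- With `G = 1 + lam * Ct`, the Q-function omits the regularizer of its first step, and this leaves
exactly the room for `lam * Ct`: `G + γ * G / (1 - γ) = G / (1 - γ)`. -/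
lemma abs_regQ_add_le (hΩ : IsRegularizer Ω CΦ Ct) (hlam : 0 ≤ lam) (π : Policy S A) (s : S)
    (a : A) : |regQ M Ω lam π s a| + lam * Ct ≤ (1 + lam * Ct) / (1 - M.γ) := by
  have hγ := M.one_sub_pos
  have hV : ∀ s, |regValue M Ω lam π s| ≤ (1 + lam * Ct) / (1 - M.γ) := fun s =>
    (abs_regValue_le hΩ hlam π s).trans (div_le_div_of_nonneg_right (hΩ.const_le hlam) hγ.le)
  have h1 := abs_nextValue_le M hV s a
  have h2 : |regQ M Ω lam π s a| ≤ 1 + M.γ * ((1 + lam * Ct) / (1 - M.γ)) := by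
    refine (abs_add_le _ _).trans (add_le_add ?_ ?_)
    · rw [abs_of_nonneg (M.r_nonneg s a)]; exact M.r_le_one s a
    · rw [abs_mul, abs_of_nonneg M.γ_nonneg]; exact mul_le_mul_of_nonneg_left h1 M.γ_nonneg
  have h3 : 1 + M.γ * ((1 + lam * Ct) / (1 - M.γ)) + lam * Ct = (1 + lam * Ct) / (1 - M.γ) := by
    field_simp
    ring
  linarith

lemma abs_lam_gradΩ_le (hΩ : IsRegularizer Ω CΦ Ct) (hlam : 0 ≤ lam) (π : Policy S A) (s : S)
    (a : A) : |lam * gradΩ Ω (π.mat s) a| ≤ lam * Ct := by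
  rw [abs_mul, abs_of_nonneg hlam]
  exact mul_le_mul_of_nonneg_left (hΩ.grad_le _ (π.mat_mem s) a) hlam

variable [DecidableEq S]

lemma abs_regAdv_le (hΩ : IsRegularizer Ω CΦ Ct) (hlam : 0 ≤ lam) (π : Policy S A) (s : S)
    (a : A) : |regAdv M Ω lam π s a| ≤ (1 + lam * Ct) / (1 - M.γ) := by
  refine (abs_sub _ _).trans (le_trans ?_ (abs_regQ_add_le hΩ hlam π s a))
  gcongr
  exact abs_lam_gradΩ_le hΩ hlam π s a

lemma abs_regValue_sub_le (hΩ : IsRegularizer Ω CΦ Ct) (hlam : 0 ≤ lam) (π π' : Policy S A) {m : ℝ}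
    (hm : ∀ s, ∑ a, |π.mat s a - π'.mat s a| ≤ m) (s : S) :
    |(regValue M Ω lam π - regValue M Ω lam π') s| ≤
      (1 + lam * Ct) / (1 - M.γ) * m / (1 - M.γ) := by
  refine abs_le_of_residual M π (fun s => ?_) s
  have hγ := M.one_sub_pos
  -- The residual under `π` of the difference of values is the one-step gain of `π` over `π'`,
  -- computed with the Q-function of `π'`.
  have key : (regValue M Ω lam π - regValue M Ω lam π') s -
      M.γ * ∑ a, π.mat s a * nextValue M (regValue M Ω lam π - regValue M Ω lam π') s a =
      ∑ a, (π.mat s a - π'.mat s a) * regQ M Ω lam π' s a -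
        lam * (Ω (π.mat s) - Ω (π'.mat s)) := by
    rw [Pi.sub_apply]
    conv_lhs => rw [regValue_eq, regValue_eq M Ω lam π']
    simp only [nextValue_sub, regQ, mul_sub, sub_mul, mul_add, Finset.sum_sub_distrib,
      Finset.sum_add_distrib, Finset.mul_sum, mul_left_comm M.γ]
    ring
  rw [key]
  have h1 : |∑ a, (π.mat s a - π'.mat s a) * regQ M Ω lam π' s a| ≤
      (∑ a, |π.mat s a - π'.mat s a|) * ((1 + lam * Ct) / (1 - M.γ) - lam * Ct) :=
    abs_sum_mul_le _ fun a => by linarith [abs_regQ_add_le (M := M) hΩ hlam π' s a]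
  have h2 : |lam * (Ω (π.mat s) - Ω (π'.mat s))| ≤
      lam * (Ct * ∑ a, |π.mat s a - π'.mat s a|) := by
    rw [abs_mul, abs_of_nonneg hlam]
    exact mul_le_mul_of_nonneg_left (hΩ.abs_sub_le (π.mat_mem s) (π'.mat_mem s)) hlam
  have h3 : (1 + lam * Ct) / (1 - M.γ) * (∑ a, |π.mat s a - π'.mat s a|) ≤
      (1 + lam * Ct) / (1 - M.γ) * m :=
    mul_le_mul_of_nonneg_left (hm s) (div_nonneg (by linarith [hΩ.one_le_const hlam]) hγ.le)
  refine (abs_sub _ _).trans ((add_le_add h1 h2).trans (le_trans (le_of_eq ?_) h3))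
  ring

lemma abs_regAdv_sub_le (hΩ : IsRegularizer Ω CΦ Ct) (hlam : 0 ≤ lam) (π π' : Policy S A) {m : ℝ}
    (hm : ∀ s, ∑ a, |π.mat s a - π'.mat s a| ≤ m) (s : S) (a : A) :
    |regAdv M Ω lam π s a - regAdv M Ω lam π' s a| ≤ (1 + lam * Ct) / (1 - M.γ) ^ 2 * m := by
  have hγ := M.one_sub_pos
  have hγ0 := M.γ_nonneg
  have hm0 : 0 ≤ m := (Finset.sum_nonneg fun _ _ => abs_nonneg _).trans (hm s)
  have h1 := abs_nextValue_le M (abs_regValue_sub_le (M := M) hΩ hlam π π' hm) s a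
  rw [nextValue_sub] at h1
  have h2 : |lam * (gradΩ Ω (π.mat s) a - gradΩ Ω (π'.mat s) a)| ≤ lam * (Ct * m) := by
    rw [abs_mul, abs_of_nonneg hlam]
    refine mul_le_mul_of_nonneg_left ?_ hlam
    exact (hΩ.grad_lip _ (π.mat_mem s) _ (π'.mat_mem s) a).trans
      (mul_le_mul_of_nonneg_left (hm s) hΩ.nonneg_const)
  have h3 : regAdv M Ω lam π s a - regAdv M Ω lam π' s a =
      M.γ * (nextValue M (regValue M Ω lam π) s a - nextValue M (regValue M Ω lam π') s a) -
        lam * (gradΩ Ω (π.mat s) a - gradΩ Ω (π'.mat s) a) := by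
    rw [regAdv, regAdv, regQ, regQ]; ring
  rw [h3]
  refine (abs_sub _ _).trans ?_
  rw [abs_mul M.γ, abs_of_nonneg hγ0]
  have h4 := mul_le_mul_of_nonneg_left h1 hγ0
  refine (add_le_add h4 h2).trans ?_
  have hc := hΩ.one_le_const hlam
  have h5 : lam * (Ct * m) ≤ (1 + lam * Ct) * m := by nlinarith
  have h6 : (1 + lam * Ct) * m = (1 - M.γ) ^ 2 * ((1 + lam * Ct) / (1 - M.γ) ^ 2 * m) := by
    field_simp
  have h7 : M.γ * ((1 + lam * Ct) / (1 - M.γ) * m / (1 - M.γ)) =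
    M.γ * ((1 + lam * Ct) / (1 - M.γ) ^ 2 * m) := by field_simp
  have h8 : 0 ≤ (1 + lam * Ct) / (1 - M.γ) ^ 2 * m := by positivity
  rw [h7]
  refine (add_le_add le_rfl (h5.trans_eq h6)).trans ?_
  -- The two contributions add up because `γ + (1 - γ)² = 1 - γ * (1 - γ) ≤ 1`.
  nlinarith [mul_nonneg h8 (mul_nonneg hγ0 hγ.le)]

/-- The gradient is a product of two bounded Lipschitz factors. Varying the occupancy and varying
the advantage contribute equally, so the argument gives the constant with `2` in place of `4`. -/
theorem smoothOnPolicies_J (hΩ : IsRegularizer Ω CΦ Ct) (hlam : 0 ≤ lam) (ν : stdSimplex ℝ S) :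
    SmoothOnPolicies (J M Ω lam ν)
      (4 * (Fintype.card A : ℝ) * (1 + lam * Ct) / (1 - M.γ) ^ 3) := by
  refine ⟨differentiableAt_J M hΩ lam ν, fun π π' => ?_⟩
  have hγ := M.one_sub_pos
  have hc := hΩ.one_le_const hlam
  set m := Real.sqrt (Fintype.card A) * norm2 (π.mat - π'.mat) with hmdef
  have hm : ∀ s, ∑ a, |π.mat s a - π'.mat s a| ≤ m := row_sum_abs_le (π.mat - π'.mat)
  have hm0 : 0 ≤ m := mul_nonneg (Real.sqrt_nonneg _) (norm2_nonneg _)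
  rw [gradπ_J M hΩ, gradπ_J M hΩ]
  have hsplit : (fun s a => occupancy M ν π.mat s * regAdv M Ω lam π s a) -
      (fun s a => occupancy M ν π'.mat s * regAdv M Ω lam π' s a) =
      (fun s a => (occupancy M ν π.mat s - occupancy M ν π'.mat s) * regAdv M Ω lam π s a) +
      (fun s a => occupancy M ν π'.mat s * (regAdv M Ω lam π s a - regAdv M Ω lam π' s a)) := by
    ext s a
    simp only [Pi.sub_apply, Pi.add_apply]
    ring
  rw [hsplit]
  refine (norm2_add_le _ _).trans ?_
  have h1 := norm2_mul_le (fun s => occupancy M ν π.mat s - occupancy M ν π'.mat s)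
    (div_nonneg (by linarith) hγ.le) (abs_regAdv_le (M := M) hΩ hlam π)
  have h2 := norm2_mul_le (occupancy M ν π'.mat)
    (mul_nonneg (div_nonneg (by linarith) (sq_nonneg _)) hm0)
    (abs_regAdv_sub_le (M := M) hΩ hlam π π' hm)
  have h3 := sum_abs_occupancy_sub_le M ν π π' hm
  simp only [abs_of_nonneg (occupancy_nonneg M ν π' _), sum_occupancy] at h2
  have h4 : Real.sqrt (Fintype.card A) * ((1 + lam * Ct) / (1 - M.γ)) *
      (∑ s, |occupancy M ν π.mat s - occupancy M ν π'.mat s|) ≤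
      Real.sqrt (Fintype.card A) * ((1 + lam * Ct) / (1 - M.γ)) * (m / (1 - M.γ) ^ 2) :=
    mul_le_mul_of_nonneg_left h3 (by positivity)
  have hs : Real.sqrt (Fintype.card A) ^ 2 = Fintype.card A := Real.sq_sqrt (Nat.cast_nonneg _)
  have h5 : Real.sqrt (Fintype.card A) * ((1 + lam * Ct) / (1 - M.γ)) * (m / (1 - M.γ) ^ 2) +
      Real.sqrt (Fintype.card A) * ((1 + lam * Ct) / (1 - M.γ) ^ 2 * m) * (1 / (1 - M.γ)) =
      2 * (Fintype.card A : ℝ) * (1 + lam * Ct) / (1 - M.γ) ^ 3 * norm2 (π.mat - π'.mat) := by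
    rw [hmdef]
    conv_rhs => rw [← hs]
    field_simp
    ring
  refine ((add_le_add (h1.trans h4) h2).trans h5.le).trans ?_
  refine mul_le_mul_of_nonneg_right ?_ (norm2_nonneg _)
  refine div_le_div_of_nonneg_right ?_ (by positivity)
  have : 0 ≤ (Fintype.card A : ℝ) * (1 + lam * Ct) := by positivity
  nlinarith

end Smoothness

/-! ### Inexact projected gradient steps and gradient domination. -/

section Descent

/-- One-dimensional Taylor bound from a Lipschitz derivative. -/
lemma le_of_deriv_sub_ge {φ φ' : ℝ → ℝ} {K : ℝ}
    (hφ : ∀ t ∈ Set.Icc (0 : ℝ) 1, HasDerivAt φ (φ' t) t)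
    (hK : ∀ t ∈ Set.Icc (0 : ℝ) 1, φ' 0 - K * t ≤ φ' t) :
    φ 0 + φ' 0 - K / 2 ≤ φ 1 := by
  have hψ : ∀ t ∈ Set.Icc (0 : ℝ) 1, HasDerivAt (fun t => φ t - φ' 0 * t + K / 2 * t ^ 2)
      (φ' t - φ' 0 + K * t) t := by
    intro t ht
    have h1 : HasDerivAt (fun t : ℝ => φ' 0 * t) (φ' 0) t := by
      simpa using (hasDerivAt_id t).const_mul (φ' 0)
    have h2 : HasDerivAt (fun t : ℝ => K / 2 * t ^ 2) (K * t) t :=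
      ((hasDerivAt_pow 2 t).const_mul (K / 2)).congr_deriv (by norm_num; ring)
    exact ((hφ t ht).sub h1).add h2
  have hmono : MonotoneOn (fun t => φ t - φ' 0 * t + K / 2 * t ^ 2) (Set.Icc 0 1) := by
    refine monotoneOn_of_deriv_nonneg (convex_Icc 0 1)
      (fun t ht => (hψ t ht).continuousAt.continuousWithinAt)
      (fun t ht => (hψ t (interior_subset ht)).differentiableAt.differentiableWithinAt)
      (fun t ht => ?_)
    rw [(hψ t (interior_subset ht)).deriv]
    linarith [hK t (interior_subset ht)]
  have := hmono (Set.left_mem_Icc.2 zero_le_one) (Set.right_mem_Icc.2 zero_le_one) zero_le_one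
  norm_num at this
  linarith

variable {S : Type u} {A : Type v} [Fintype S] [Fintype A]

/-- Smoothness is known only at policies. Convexity of the policy set keeps the segments used in
Taylor expansions and first-order comparisons inside it. -/
lemma exists_segment (π π' : Policy S A) {t : ℝ} (ht : t ∈ Set.Icc (0 : ℝ) 1) :
    ∃ σ : Policy S A, σ.mat = π.mat + t • (π'.mat - π.mat) := by
  refine ⟨Policy.ofMat (π.mat + t • (π'.mat - π.mat)) fun s => ?_, rfl⟩
  have := convex_stdSimplex ℝ A (π.mat_mem s) (π'.mat_mem s)
    (show 0 ≤ 1 - t by linarith [ht.2]) ht.1 (by ring)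
  convert this using 1
  ext a
  simp only [Pi.add_apply, Pi.smul_apply, Pi.sub_apply, smul_eq_mul]
  ring

variable [DecidableEq S] [DecidableEq A]

lemma fderiv_eq_sum_gradπ (F : (S → A → ℝ) → ℝ) (x h : S → A → ℝ) :
    fderiv ℝ F x h = inner ℝ (toEuclid (gradπ F x)) (toEuclid h) := by
  rw [inner_toEuclid]
  conv_lhs => rw [show h = ∑ s, ∑ a, h s a • (Pi.single s (Pi.single a 1) : S → A → ℝ) by
    ext s a
    simp only [Finset.sum_apply, Pi.smul_apply]
    rw [Finset.sum_eq_single s, Finset.sum_eq_single a] <;> simp +contextual [Pi.single_apply]]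
  simp only [map_sum, map_smul, smul_eq_mul, gradπ]
  exact Finset.sum_congr rfl fun s _ => Finset.sum_congr rfl fun a _ => mul_comm _ _

lemma SmoothOnPolicies.norm_sub_le {F : (S → A → ℝ) → ℝ} {L : ℝ} (h : SmoothOnPolicies F L)
    (π π' : Policy S A) : ‖toEuclid (gradπ F π'.mat) - toEuclid (gradπ F π.mat)‖ ≤
      L * ‖toEuclid (π'.mat - π.mat)‖ := by
  rw [← map_sub, norm_toEuclid, norm_toEuclid]
  exact h.2 π' π

lemma SmoothOnPolicies.neg {F : (S → A → ℝ) → ℝ} {L : ℝ} (h : SmoothOnPolicies F L) :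
    SmoothOnPolicies (-F) L := by
  refine ⟨fun π => (h.1 π).neg, fun π π' => ?_⟩
  have hg : ∀ x, gradπ (-F) x = - gradπ F x := fun x => by
    ext s a; simp [gradπ, fderiv_neg]
  rw [hg, hg, neg_sub_neg, norm2_sub_comm]
  exact h.2 π π'

lemma SmoothOnPolicies.quadratic_lower {F : (S → A → ℝ) → ℝ} {L : ℝ} (h : SmoothOnPolicies F L)
    (π π' : Policy S A) :
    F π.mat + inner ℝ (toEuclid (gradπ F π.mat)) (toEuclid (π'.mat - π.mat)) -
      L * ‖toEuclid (π'.mat - π.mat)‖ ^ 2 / 2 ≤ F π'.mat := by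
  set Δ := π'.mat - π.mat with hΔ
  have hline : ∀ t : ℝ, HasDerivAt (fun t : ℝ => π.mat + t • Δ) Δ t := fun t => by
    simpa using ((hasDerivAt_id t).smul_const Δ).const_add π.mat
  have hφ : ∀ t ∈ Set.Icc (0 : ℝ) 1, HasDerivAt (fun t : ℝ => F (π.mat + t • Δ))
      (fderiv ℝ F (π.mat + t • Δ) Δ) t := by
    intro t ht
    obtain ⟨σ, hσ⟩ := exists_segment π π' ht
    have hd : HasFDerivAt F (fderiv ℝ F (π.mat + t • Δ)) (π.mat + t • Δ) := by
      rw [hΔ, ← hσ]; exact (h.1 σ).hasFDerivAt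
    exact hd.comp_hasDerivAt t (hline t)
  have := le_of_deriv_sub_ge (K := L * ‖toEuclid Δ‖ ^ 2) hφ fun t ht => by
    obtain ⟨σ, hσ⟩ := exists_segment π π' ht
    rw [← hΔ] at hσ
    rw [zero_smul, add_zero, ← hσ, fderiv_eq_sum_gradπ, fderiv_eq_sum_gradπ]
    have h1 := h.norm_sub_le π σ
    rw [show σ.mat - π.mat = t • Δ by rw [hσ]; abel, map_smul, norm_smul, Real.norm_eq_abs,
      abs_of_nonneg ht.1] at h1
    have h2 := abs_real_inner_le_norm
      (toEuclid (gradπ F σ.mat) - toEuclid (gradπ F π.mat)) (toEuclid Δ)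
    rw [inner_sub_left] at h2
    have h3 := mul_le_mul_of_nonneg_right h1 (norm_nonneg (toEuclid Δ))
    have h4 := (abs_le.1 h2).1
    nlinarith
  simp only [zero_smul, add_zero, one_smul, fderiv_eq_sum_gradπ] at this
  rwa [show π.mat + Δ = π'.mat by rw [hΔ]; abel] at this

lemma SmoothOnPolicies.quadratic_upper {F : (S → A → ℝ) → ℝ} {L : ℝ} (h : SmoothOnPolicies F L)
    (π π' : Policy S A) :
    F π'.mat ≤ F π.mat + inner ℝ (toEuclid (gradπ F π.mat)) (toEuclid (π'.mat - π.mat)) +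
      L * ‖toEuclid (π'.mat - π.mat)‖ ^ 2 / 2 := by
  have h1 := h.neg.quadratic_lower π π'
  have hg : gradπ (-F) π.mat = - gradπ F π.mat := by
    ext s a; simp [gradπ, fderiv_neg]
  rw [hg, map_neg, inner_neg_left, Pi.neg_apply, Pi.neg_apply] at h1
  linarith

lemma stepObjective_eq (η : ℝ) (π : Policy S A) (g : S → A → ℝ) (π' : Policy S A) :
    stepObjective η π g π' = -inner ℝ (toEuclid g) (toEuclid (π'.mat - π.mat)) +
      1 / (2 * η) * ‖toEuclid (π'.mat - π.mat)‖ ^ 2 := by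
  rw [stepObjective, norm_toEuclid, inner_toEuclid]
  simp [neg_mul, Finset.sum_neg_distrib]

/-- Variational inequality of the proximal step. -/
lemma pgaStep_inner_le [Nonempty A] {L : ℝ} (π : Policy S A) (g : S → A → ℝ)
    (π' : Policy S A) :
    inner ℝ (toEuclid g - L • toEuclid ((pgaStep (1 / L) π g).mat - π.mat))
      (toEuclid (π'.mat - (pgaStep (1 / L) π g).mat)) ≤ 0 := by
  set π₁ := pgaStep (1 / L) π g with hπ₁
  have hmin : ∀ σ, stepObjective (1 / L) π g π₁ ≤ stepObjective (1 / L) π g σ :=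
    (exists_step (1 / L) π g).choose_spec
  set d := toEuclid (π'.mat - π₁.mat) with hd
  set Δ := toEuclid (π₁.mat - π.mat) with hΔ
  have hη : 1 / (2 * (1 / L)) = L / 2 := by
    by_cases hL : L = 0
    · simp [hL]
    · field_simp
  -- Compare the minimizer with the point at parameter `t` on the segment to `π'` and divide by `t`;
  -- letting `t` tend to `0` removes the quadratic term.
  have key : ∀ t ∈ Set.Ioc (0 : ℝ) 1,
      inner ℝ (toEuclid g - L • Δ) d ≤ t * (L / 2 * ‖d‖ ^ 2) := by
    intro t ht
    obtain ⟨σ, hσ⟩ := exists_segment π₁ π' ⟨ht.1.le, ht.2⟩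
    have h1 := hmin σ
    rw [stepObjective_eq, stepObjective_eq, hη] at h1
    have h2 : toEuclid (σ.mat - π.mat) = Δ + t • d := by
      rw [hσ, hd, hΔ, ← map_smul, ← map_add]; congr 1; abel
    rw [h2, ← hΔ, inner_add_right, real_inner_smul_right, norm_add_sq_real,
      real_inner_smul_right, norm_smul, mul_pow, Real.norm_eq_abs, sq_abs] at h1
    rw [inner_sub_left, real_inner_smul_left]
    have h3 : t * (inner ℝ (toEuclid g) d - L * inner ℝ Δ d) ≤
        t * (t * (L / 2 * ‖d‖ ^ 2)) := by linarith
    exact le_of_mul_le_mul_left h3 ht.1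
  refine ge_of_tendsto (x := nhdsWithin (0 : ℝ) (Set.Ioi 0))
    (f := fun t => t * (L / 2 * ‖d‖ ^ 2)) ?_ ?_
  · have : Filter.Tendsto (fun t : ℝ => t * (L / 2 * ‖d‖ ^ 2)) (nhds 0) (nhds 0) := by
      have hc : Continuous fun t : ℝ => t * (L / 2 * ‖d‖ ^ 2) := by fun_prop
      simpa using hc.tendsto 0
    exact this.mono_left nhdsWithin_le_nhds
  · filter_upwards [Ioc_mem_nhdsGT one_pos] with t ht
    exact key t ht

/-- One inexact projected gradient step: the progress controls the first-order optimality gap at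
the new point. -/
lemma inner_le_of_step {E : Type*} [NormedAddCommGroup E] [InnerProductSpace ℝ E]
    {Δ g G₀ G₁ d : E} {L f₀ f₁ e R : ℝ} (hL : 0 < L)
    (h1 : inner ℝ (g - L • Δ) (-Δ) ≤ 0)
    (h2 : f₀ + inner ℝ G₀ Δ - L * ‖Δ‖ ^ 2 / 2 ≤ f₁)
    (h3 : f₀ ≤ f₁ + inner ℝ G₁ (-Δ) + L * ‖Δ‖ ^ 2 / 2)
    (h4 : ‖G₁ - G₀‖ ≤ L * ‖Δ‖) (h5 : ‖g - G₀‖ ≤ e)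
    (h6 : inner ℝ (g - L • Δ) d ≤ 0) (h7 : ‖d‖ ≤ R) :
    ∃ z, 0 ≤ z ∧ inner ℝ G₁ d ≤ R * z ∧ z ^ 2 ≤ 8 * (L * (f₁ - f₀) + 4 * e ^ 2) := by
  have he : 0 ≤ e := (norm_nonneg _).trans h5
  set w := ‖(G₁ - G₀) + L • Δ‖ with hw
  refine ⟨w + e, by positivity, ?_, ?_⟩
  -- Split `G₁` as `((G₁ - G₀) + L • Δ) - (g - G₀) + (g - L • Δ)`: the last part is nonpositive on
  -- `d` by the variational inequality, and the other two have norms at most `w` and `e`.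
  · have e1 : inner ℝ G₁ d = inner ℝ ((G₁ - G₀) + L • Δ) d - inner ℝ (g - G₀) d +
        inner ℝ (g - L • Δ) d := by
      rw [← inner_sub_left, ← inner_add_left]; congr 1; abel
    have e2 := (abs_le.1 (abs_real_inner_le_norm ((G₁ - G₀) + L • Δ) d)).2
    have e3 := (abs_le.1 (abs_real_inner_le_norm (g - G₀) d)).1
    have e4 : w * ‖d‖ ≤ w * R := mul_le_mul_of_nonneg_left h7 (norm_nonneg _)
    have e5 : ‖g - G₀‖ * ‖d‖ ≤ e * R := mul_le_mul h5 h7 (norm_nonneg _) he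
    linarith
  · rw [inner_neg_right, inner_sub_left, real_inner_smul_left, real_inner_self_eq_norm_sq] at h1
    rw [inner_neg_right] at h3
    have e1 := (abs_le.1 (abs_real_inner_le_norm (g - G₀) Δ)).2
    rw [inner_sub_left] at e1
    have e2 : ‖g - G₀‖ * ‖Δ‖ ≤ e * ‖Δ‖ := mul_le_mul_of_nonneg_right h5 (norm_nonneg _)
    -- The upper quadratic bound controls the cross term. For `e = 0` this gives `w ^ 2 ≤ 4 * D`,
    -- against `8 * D` from the triangle inequality `w ≤ 2 * x`; the slack absorbs the error terms.
    have e3 : w ^ 2 = ‖G₁ - G₀‖ ^ 2 + 2 * (L * (inner ℝ G₁ Δ - inner ℝ G₀ Δ)) +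
        (L * ‖Δ‖) ^ 2 := by
      rw [hw, norm_add_sq_real, real_inner_smul_right, inner_sub_left, norm_smul,
        Real.norm_eq_abs, abs_of_pos hL]
    have e4 : ‖G₁ - G₀‖ ^ 2 ≤ (L * ‖Δ‖) ^ 2 := pow_le_pow_left₀ (norm_nonneg _) h4 2
    set x := L * ‖Δ‖ with hx
    set D := L * (f₁ - f₀) with hD
    have m1 : x ^ 2 / 2 - e * x ≤ D := by
      have : L * (L * ‖Δ‖ ^ 2 / 2 - e * ‖Δ‖) ≤ L * (f₁ - f₀) :=
        mul_le_mul_of_nonneg_left (by linarith) hL.le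
      rw [hD, hx]; nlinarith
    have m2 : x ^ 2 / 2 - e * x + L * (inner ℝ G₁ Δ - inner ℝ G₀ Δ) ≤ D := by
      have : L * (L * ‖Δ‖ ^ 2 / 2 - e * ‖Δ‖ + (inner ℝ G₁ Δ - inner ℝ G₀ Δ)) ≤ L * (f₁ - f₀) :=
        mul_le_mul_of_nonneg_left (by linarith) hL.le
      rw [hD, hx]; nlinarith
    have m3 : w ^ 2 ≤ 4 * D + 4 * (e * x) := by linarith
    have m4 : x ^ 2 ≤ 4 * D + 4 * e ^ 2 := by nlinarith [sq_nonneg (x - 2 * e)]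
    have m5 : w ^ 2 ≤ 5 * D + 17 * e ^ 2 := by nlinarith [sq_nonneg (x - 8 * e)]
    have m6 : 0 ≤ D + e ^ 2 := by nlinarith [sq_nonneg x]
    -- From `2 * w * e ≤ w ^ 2 / 5 + 5 * e ^ 2` one gets `6 * D + 26.4 * e ^ 2`. Since `D` may be
    -- negative, passing to `8 * D + 32 * e ^ 2` uses `m6`.
    nlinarith [sq_nonneg (w - 5 * e)]

/-- For entries in `[0,1]` one has `(p - q)² ≤ p + q`, so each row contributes at most `2`. -/
lemma norm_toEuclid_sub_le (π π' : Policy S A) :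
    ‖toEuclid (π'.mat - π.mat)‖ ≤ Real.sqrt (2 * Fintype.card S) := by
  rw [norm_toEuclid, norm2]
  refine Real.sqrt_le_sqrt ?_
  have hrow : ∀ s, ∑ a, ((π'.mat - π.mat) s a) ^ 2 ≤ 2 := fun s => by
    have h1 : ∀ a, ((π'.mat - π.mat) s a) ^ 2 ≤ π'.mat s a + π.mat s a := fun a => by
      have n1 := π.mat_nonneg s a
      have n2 := π'.mat_nonneg s a
      have l1 : π.mat s a ≤ 1 := by
        rw [← π.sum_mat s]
        exact Finset.single_le_sum (fun a _ => π.mat_nonneg s a) (Finset.mem_univ a)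
      have l2 : π'.mat s a ≤ 1 := by
        rw [← π'.sum_mat s]
        exact Finset.single_le_sum (fun a _ => π'.mat_nonneg s a) (Finset.mem_univ a)
      simp only [Pi.sub_apply]
      nlinarith [mul_nonneg n1 n2]
    refine (Finset.sum_le_sum fun a _ => h1 a).trans ?_
    rw [Finset.sum_add_distrib, π.sum_mat, π'.sum_mat]
    norm_num
  refine (Finset.sum_le_sum fun s _ => hrow s).trans ?_
  simp [mul_comm]

variable [Nonempty A] {M : MDP S A} {Ω : (A → ℝ) → ℝ} {CΦ Ct lam : ℝ} {ν : stdSimplex ℝ S}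

/-- Gradient domination. -/
lemma exists_gap_le_inner (hΩ : IsRegularizer Ω CΦ Ct) (hlam : 0 ≤ lam) (πstar π : Policy S A)
    {ρν : ℝ} (hocc : ∀ s, occupancy M ν πstar.mat s ≤ ρν * occupancy M ν π.mat s) :
    ∃ π' : Policy S A, J M Ω lam ν πstar.mat - J M Ω lam ν π.mat ≤
      ρν * inner ℝ (toEuclid (gradπ (J M Ω lam ν) π.mat)) (toEuclid (π'.mat - π.mat)) := by
  -- The comparison policy is greedy for the advantage of `π` in every state.
  choose b hb using fun s => Finite.exists_max (regAdv M Ω lam π s)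
  refine ⟨Policy.ofMat (fun s => Pi.single (b s) 1) fun s => single_mem_stdSimplex ℝ _, ?_⟩
  rw [(πstar.rowBound M).J_sub, inner_toEuclid, gradπ_J M hΩ, Finset.mul_sum]
  refine Finset.sum_le_sum fun s _ => ?_
  have hval : ∑ a, occupancy M ν π.mat s * regAdv M Ω lam π s a *
      ((Policy.ofMat (fun s => Pi.single (b s) (1 : ℝ)) fun s => single_mem_stdSimplex ℝ _).mat -
        π.mat) s a = occupancy M ν π.mat s *
        (regAdv M Ω lam π s (b s) - ∑ a, π.mat s a * regAdv M Ω lam π s a) := by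
    have : ∀ a, (Policy.ofMat (fun s => Pi.single (b s) (1 : ℝ))
      fun s => single_mem_stdSimplex ℝ _).mat s a = (Pi.single (b s) (1 : ℝ) : A → ℝ) a :=
      fun a => rfl
    simp only [Pi.sub_apply, this, mul_sub, Finset.sum_sub_distrib]
    congr 1
    · rw [Finset.sum_eq_single (b s)] <;> simp +contextual
    · rw [Finset.mul_sum]
      exact Finset.sum_congr rfl fun a _ => by ring
  rw [hval]
  have hmax : ∀ σ : Policy S A, ∑ a, σ.mat s a * regAdv M Ω lam π s a ≤ regAdv M Ω lam π s (b s) :=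
    fun σ => sum_mat_mul_le σ s (hb s)
  have hconv := hΩ.add_grad_le (π.mat_mem s) (πstar.mat_mem s)
  have h1 : ∑ a, (πstar.mat s a - π.mat s a) * regQ M Ω lam π s a -
      lam * (Ω (πstar.mat s) - Ω (π.mat s)) ≤
      regAdv M Ω lam π s (b s) - ∑ a, π.mat s a * regAdv M Ω lam π s a := by
    have h2 : ∑ a, πstar.mat s a * regAdv M Ω lam π s a - ∑ a, π.mat s a * regAdv M Ω lam π s a =
        ∑ a, (πstar.mat s a - π.mat s a) * regQ M Ω lam π s a -
          lam * ∑ a, (πstar.mat s a - π.mat s a) * gradΩ Ω (π.mat s) a := by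
      rw [← Finset.sum_sub_distrib, Finset.mul_sum, ← Finset.sum_sub_distrib]
      exact Finset.sum_congr rfl fun a _ => by rw [regAdv]; ring
    have h3 := mul_le_mul_of_nonneg_left
      (show ∑ a, (πstar.mat s a - π.mat s a) * gradΩ Ω (π.mat s) a ≤
        Ω (πstar.mat s) - Ω (π.mat s) by linarith) hlam
    linarith [hmax πstar]
  -- Nonnegativity in each state is what permits replacing the occupancy of `πstar` by `ρν` times
  -- that of `π` term by term.
  have h4 : 0 ≤ regAdv M Ω lam π s (b s) - ∑ a, π.mat s a * regAdv M Ω lam π s a := by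
    linarith [hmax π]
  calc _ ≤ occupancy M ν πstar.mat s *
        (regAdv M Ω lam π s (b s) - ∑ a, π.mat s a * regAdv M Ω lam π s a) :=
        mul_le_mul_of_nonneg_left h1 (occupancy_nonneg M ν πstar s)
    _ ≤ _ := by
        rw [← mul_assoc]
        exact mul_le_mul_of_nonneg_right (hocc s) h4

/-- `π'` arises from `π` by a projected gradient step whose direction has error at most `e`. -/
def IsInexactStep (F : (S → A → ℝ) → ℝ) (η e : ℝ) (π π' : Policy S A) : Prop :=
  ∃ g : S → A → ℝ, norm2 (g - gradπ F π.mat) ≤ e ∧ π' = pgaStep η π g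

/-- Gradient domination is applied at the new point `π₁`, where the step controls the first-order
gain. The constant is `16 = 8 * 2`, with `2 * |S|` the squared diameter bound for the policy set. -/
lemma gap_sq_le_of_isInexactStep (hΩ : IsRegularizer Ω CΦ Ct) (hlam : 0 ≤ lam)
    {πstar : Policy S A} (hopt : IsOptimal M Ω lam ν πstar) {ρν : ℝ} (hρ : 0 ≤ ρν)
    (hocc : ∀ (π : Policy S A) s, occupancy M ν πstar.mat s ≤ ρν * occupancy M ν π.mat s)
    {L e : ℝ} (hL : 0 < L) (hsm : SmoothOnPolicies (J M Ω lam ν) L) {π π₁ : Policy S A}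
    (hstep : IsInexactStep (J M Ω lam ν) (1 / L) e π π₁) :
    (J M Ω lam ν πstar.mat - J M Ω lam ν π₁.mat) ^ 2 ≤
      16 * ρν ^ 2 * Fintype.card S *
        (L * (J M Ω lam ν π₁.mat - J M Ω lam ν π.mat) + 4 * e ^ 2) := by
  obtain ⟨g, hg, rfl⟩ := hstep
  set π₁ := pgaStep (1 / L) π g with hπ₁
  obtain ⟨π', hπ'⟩ := exists_gap_le_inner hΩ hlam πstar π₁ (hocc π₁)
  have hneg : toEuclid (π.mat - π₁.mat) = -toEuclid (π₁.mat - π.mat) := by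
    rw [← map_neg, neg_sub]
  have h1 := pgaStep_inner_le (L := L) π g π
  have h3 := hsm.quadratic_upper π₁ π
  rw [← hπ₁, hneg] at h1
  rw [hneg, norm_neg] at h3
  rw [← norm_toEuclid, map_sub] at hg
  obtain ⟨z, hz, hz1, hz2⟩ := inner_le_of_step hL h1
    (hsm.quadratic_lower π π₁) h3 (hsm.norm_sub_le π π₁) hg (pgaStep_inner_le π g π')
    (norm_toEuclid_sub_le π₁ π')
  have hgap : 0 ≤ J M Ω lam ν πstar.mat - J M Ω lam ν π₁.mat := sub_nonneg.2 (hopt π₁)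
  have h4 := hπ'.trans (mul_le_mul_of_nonneg_left hz1 hρ)
  have h5 := pow_le_pow_left₀ hgap h4 2
  rw [mul_pow, mul_pow, Real.sq_sqrt (by positivity)] at h5
  have h6 := mul_le_mul_of_nonneg_left hz2 (show 0 ≤ ρν ^ 2 * (2 * (Fintype.card S : ℝ)) by
    positivity)
  linarith

/-- The increments of `J` telescope to at most the initial gap, so some step has progress at most
the average. An error `√ε / 2` makes `4 * e ^ 2` equal to `ε`. -/
theorem exists_gap_le_of_steps (hΩ : IsRegularizer Ω CΦ Ct) (hlam : 0 ≤ lam)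
    {πstar : Policy S A} (hopt : IsOptimal M Ω lam ν πstar) {ρν : ℝ} (hρ : 0 ≤ ρν)
    (hocc : ∀ (π : Policy S A) s, occupancy M ν πstar.mat s ≤ ρν * occupancy M ν π.mat s)
    {L ε : ℝ} (hL : 0 < L) (hsm : SmoothOnPolicies (J M Ω lam ν) L) (hε : 0 ≤ ε) {T : ℕ}
    (hT : 1 ≤ T) (h : Fin (T + 1) → Policy S A)
    (hsteps : ∀ t : Fin T,
      IsInexactStep (J M Ω lam ν) (1 / L) (Real.sqrt ε / 2) (h t.castSucc) (h t.succ)) :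
    ∃ t : Fin T, J M Ω lam ν πstar.mat - J M Ω lam ν (h t.succ).mat ≤
      4 * ρν * Real.sqrt (Fintype.card S) *
        Real.sqrt (L * (J M Ω lam ν πstar.mat - J M Ω lam ν (h 0).mat) / T + ε) := by
  have hTpos : (0 : ℝ) < T := by exact_mod_cast hT
  have hne : (Finset.univ : Finset (Fin T)).Nonempty := ⟨⟨0, hT⟩, Finset.mem_univ _⟩
  obtain ⟨t, -, ht⟩ : ∃ t ∈ (Finset.univ : Finset (Fin T)),
      L * (J M Ω lam ν (h t.succ).mat - J M Ω lam ν (h t.castSucc).mat) ≤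
        L * (J M Ω lam ν πstar.mat - J M Ω lam ν (h 0).mat) / T := by
    refine Finset.exists_le_of_sum_le hne ?_
    have h1 : ∑ t : Fin T, (J M Ω lam ν (h t.succ).mat - J M Ω lam ν (h t.castSucc).mat) =
        J M Ω lam ν (h (Fin.last T)).mat - J M Ω lam ν (h 0).mat := by
      rw [Finset.sum_sub_distrib]
      have e1 := Fin.sum_univ_succ fun t => J M Ω lam ν (h t).mat
      have e2 := Fin.sum_univ_castSucc fun t => J M Ω lam ν (h t).mat
      linarith
    rw [← Finset.mul_sum, h1, Finset.sum_const, Finset.card_univ, Fintype.card_fin, nsmul_eq_mul,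
      mul_div_cancel₀ _ hTpos.ne']
    exact mul_le_mul_of_nonneg_left (by linarith [hopt (h (Fin.last T))]) hL.le
  refine ⟨t, ?_⟩
  have h1 := gap_sq_le_of_isInexactStep hΩ hlam hopt hρ hocc hL hsm (hsteps t)
  rw [div_pow, Real.sq_sqrt hε] at h1
  have hgap : 0 ≤ L * (J M Ω lam ν πstar.mat - J M Ω lam ν (h 0).mat) / T :=
    div_nonneg (mul_nonneg hL.le (sub_nonneg.2 (hopt _))) hTpos.le
  refine abs_le_of_sq_le_sq' ?_ (by positivity) |>.2
  rw [mul_pow, mul_pow, mul_pow, Real.sq_sqrt (Nat.cast_nonneg _), Real.sq_sqrt (by positivity)]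
  refine h1.trans ?_
  have h2 := mul_le_mul_of_nonneg_left
    (show L * (J M Ω lam ν (h t.succ).mat - J M Ω lam ν (h t.castSucc).mat) + 4 * (ε / 2 ^ 2) ≤
      L * (J M Ω lam ν πstar.mat - J M Ω lam ν (h 0).mat) / T + ε by linarith)
    (show 0 ≤ 16 * ρν ^ 2 * (Fintype.card S : ℝ) by positivity)
  linarith

end Descent

/-! ### Expectations of bounded functions under discrete laws. -/

section Expectation

variable {X Y : Type*}

/-- Expectation of a real function under a probability mass function. -/
def PMF.expect (p : PMF X) (f : X → ℝ) : ℝ := ∑' x, (p x).toReal * f x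

lemma PMF.hasSum_toReal (p : PMF X) : HasSum (fun x => (p x).toReal) 1 := by
  have h := (ENNReal.summable_toReal p.tsum_coe_ne_top).hasSum
  rwa [← ENNReal.tsum_toReal_eq p.apply_ne_top, p.tsum_coe, ENNReal.toReal_one] at h

lemma PMF.summable_mul (p : PMF X) {f : X → ℝ} {C : ℝ} (hf : ∀ x, |f x| ≤ C) :
    Summable fun x => (p x).toReal * f x := by
  refine Summable.of_norm_bounded (p.hasSum_toReal.summable.mul_right C) fun x => ?_
  rw [Real.norm_eq_abs, abs_mul, abs_of_nonneg ENNReal.toReal_nonneg]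
  exact mul_le_mul_of_nonneg_left (hf x) ENNReal.toReal_nonneg

lemma PMF.expect_const (p : PMF X) (c : ℝ) : p.expect (fun _ => c) = c := by
  rw [PMF.expect, tsum_mul_right, p.hasSum_toReal.tsum_eq, one_mul]

lemma PMF.expect_mono (p : PMF X) {f g : X → ℝ} {C D : ℝ} (hf : ∀ x, |f x| ≤ C)
    (hg : ∀ x, |g x| ≤ D) (h : ∀ x, f x ≤ g x) : p.expect f ≤ p.expect g :=
  (p.summable_mul hf).tsum_le_tsum
    (fun x => mul_le_mul_of_nonneg_left (h x) ENNReal.toReal_nonneg) (p.summable_mul hg)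

lemma PMF.expect_le (p : PMF X) {f : X → ℝ} {C D : ℝ} (hf : ∀ x, |f x| ≤ C)
    (h : ∀ x, f x ≤ D) : p.expect f ≤ D :=
  (p.expect_mono hf (fun _ => le_rfl) h).trans_eq (p.expect_const D)

lemma PMF.le_expect (p : PMF X) {f : X → ℝ} {C D : ℝ} (hf : ∀ x, |f x| ≤ C)
    (h : ∀ x, D ≤ f x) : D ≤ p.expect f :=
  (p.expect_const D).symm.trans_le (p.expect_mono (fun _ => le_rfl) hf h)

lemma PMF.abs_expect_le (p : PMF X) {f : X → ℝ} {C : ℝ} (hf : ∀ x, |f x| ≤ C) :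
    |p.expect f| ≤ C :=
  abs_le.2 ⟨p.le_expect hf fun x => (abs_le.1 (hf x)).1, p.expect_le hf fun x => (abs_le.1 (hf x)).2⟩

lemma PMF.expect_add (p : PMF X) {f g : X → ℝ} {C D : ℝ} (hf : ∀ x, |f x| ≤ C)
    (hg : ∀ x, |g x| ≤ D) : p.expect (fun x => f x + g x) = p.expect f + p.expect g := by
  simp only [PMF.expect, mul_add]
  exact (p.summable_mul hf).tsum_add (p.summable_mul hg)

lemma PMF.expect_const_mul (p : PMF X) (c : ℝ) (f : X → ℝ) :
    p.expect (fun x => c * f x) = c * p.expect f := by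
  simp only [PMF.expect, mul_left_comm _ c]
  exact tsum_mul_left

lemma PMF.expect_sum {ι : Type*} (p : PMF X) (s : Finset ι) {f : ι → X → ℝ} {C : ι → ℝ}
    (hf : ∀ i x, |f i x| ≤ C i) :
    p.expect (fun x => ∑ i ∈ s, f i x) = ∑ i ∈ s, p.expect (f i) := by
  simp only [PMF.expect, Finset.mul_sum]
  exact Summable.tsum_finsetSum fun i _ => p.summable_mul (hf i)

lemma PMF.expect_pure (a : X) (f : X → ℝ) : (PMF.pure a).expect f = f a := by
  rw [PMF.expect, tsum_eq_single a]
  · simp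
  · intro b hb
    simp [PMF.pure_apply, hb]

/-- Fubini: boundedness of `f` makes the double series absolutely summable. -/
lemma PMF.expect_bind (p : PMF X) (k : X → PMF Y) {f : Y → ℝ} {C : ℝ} (hf : ∀ y, |f y| ≤ C) :
    (p.bind k).expect f = p.expect fun x => (k x).expect f := by
  have h1 : ∀ y, ((p.bind k) y).toReal = ∑' x, (p x).toReal * (k x y).toReal := fun y => by
    rw [PMF.bind_apply, ENNReal.tsum_toReal_eq fun x =>
      ENNReal.mul_ne_top (p.apply_ne_top x) ((k x).apply_ne_top y)]
    simp only [ENNReal.toReal_mul]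
  have h2 : Summable fun z : X × Y => (p z.1).toReal * (k z.1 z.2).toReal := by
    have : ∑' z : X × Y, p z.1 * k z.1 z.2 ≠ ⊤ := by
      rw [ENNReal.tsum_prod']
      simp only [ENNReal.tsum_mul_left, PMF.tsum_coe, mul_one]
      exact ENNReal.one_ne_top
    simpa only [ENNReal.toReal_mul] using ENNReal.summable_toReal this
  have h3 : Summable fun z : X × Y => (p z.1).toReal * ((k z.1 z.2).toReal * f z.2) := by
    refine Summable.of_norm_bounded (h2.mul_right C) fun z => ?_
    rw [← mul_assoc, Real.norm_eq_abs, abs_mul,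
      abs_of_nonneg (mul_nonneg ENNReal.toReal_nonneg ENNReal.toReal_nonneg)]
    exact mul_le_mul_of_nonneg_left (hf z.2)
      (mul_nonneg ENNReal.toReal_nonneg ENNReal.toReal_nonneg)
  simp only [PMF.expect, h1, ← tsum_mul_right, ← tsum_mul_left, mul_assoc]
  exact (Summable.tsum_comm (f := fun x y => (p x).toReal * ((k x y).toReal * f y)) h3)

lemma PMF.expect_map (p : PMF X) (g : X → Y) {f : Y → ℝ} {C : ℝ} (hf : ∀ y, |f y| ≤ C) :
    (p.map g).expect f = p.expect fun x => f (g x) := by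
  rw [PMF.map, p.expect_bind _ hf]
  simp only [Function.comp, PMF.expect_pure]

lemma PMF.expect_eq_sum [Fintype X] (p : PMF X) (f : X → ℝ) :
    p.expect f = ∑ x, (p x).toReal * f x := tsum_fintype _

lemma abs_indicator_one_le (B : Set X) (x : X) : |B.indicator (fun _ => (1 : ℝ)) x| ≤ 1 := by
  by_cases h : x ∈ B <;> simp [h]

lemma PMF.toReal_toOuterMeasure (p : PMF X) (B : Set X) :
    (p.toOuterMeasure B).toReal = p.expect (B.indicator fun _ => 1) := by
  rw [PMF.toOuterMeasure_apply, PMF.expect, ENNReal.tsum_toReal_eq]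
  · refine tsum_congr fun x => ?_
    by_cases h : x ∈ B <;> simp [h]
  · intro x
    by_cases h : x ∈ B <;> simp [h, p.apply_ne_top]

lemma PMF.ofReal_le_toOuterMeasure (p : PMF X) {B : Set X} {c : ℝ}
    (h : c ≤ p.expect (B.indicator fun _ => 1)) : ENNReal.ofReal c ≤ p.toOuterMeasure B := by
  rw [← PMF.toReal_toOuterMeasure] at h
  exact (ENNReal.ofReal_le_ofReal h).trans ENNReal.ofReal_toReal_le

lemma expect_toPMF [Fintype X] (p : stdSimplex ℝ X) (f : X → ℝ) :
    (toPMF p).expect f = ∑ x, p.1 x * f x := by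
  rw [PMF.expect_eq_sum]
  refine Finset.sum_congr rfl fun x _ => ?_
  rw [toPMF, PMF.ofFintype_apply, ENNReal.toReal_ofReal (p.2.1 x)]

end Expectation

/-! ### A dimension-free Hoeffding inequality for vectors. -/

section Concentration

/-- Convexity of `u ↦ cosh √u`. -/
lemma cosh_le_of_sq_eq {r x z θ : ℝ} (h0 : 0 ≤ θ) (h1 : θ ≤ 1)
    (hr : r ^ 2 = (1 - θ) * x ^ 2 + θ * z ^ 2) :
    Real.cosh r ≤ (1 - θ) * Real.cosh x + θ * Real.cosh z := by
  -- The series of `cosh r` runs over powers of `r ^ 2` with nonnegative coefficients, and each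
  -- power is convex on the nonnegative half-line.
  refine hasSum_le (fun n => ?_) (Real.hasSum_cosh r)
    (((Real.hasSum_cosh x).mul_left (1 - θ)).add ((Real.hasSum_cosh z).mul_left θ))
  have hc := (convexOn_pow n).2 (Set.mem_Ici.2 (sq_nonneg x)) (Set.mem_Ici.2 (sq_nonneg z))
    (sub_nonneg.2 h1) h0 (by ring)
  simp only [smul_eq_mul] at hc
  rw [pow_mul, pow_mul, pow_mul, hr, ← mul_div_assoc, ← mul_div_assoc, ← add_div]
  exact div_le_div_of_nonneg_right hc (Nat.cast_nonneg _)

variable {E : Type*} [NormedAddCommGroup E] [InnerProductSpace ℝ E]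

/-- The right side is affine in the inner product, so its linear part disappears on averaging a
centered `x`. If `v = 0` or `b = 0`, the quotient is zero by convention. -/
lemma cosh_norm_add_le (l : ℝ) {b : ℝ} (v x : E) (hx : ‖x‖ ≤ b) :
    Real.cosh (l * ‖v + x‖) ≤ Real.cosh (l * ‖v‖) * Real.cosh (l * b) +
      Real.sinh (l * ‖v‖) * Real.sinh (l * b) / (‖v‖ * b) * inner ℝ v x := by
  have hb0 : 0 ≤ b := (norm_nonneg x).trans hx
  have hmono : ∀ {y z : ℝ}, 0 ≤ y → y ≤ z → Real.cosh (l * y) ≤ Real.cosh (l * z) := by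
    intro y z hy hyz
    rw [Real.cosh_le_cosh, abs_mul, abs_mul, abs_of_nonneg hy, abs_of_nonneg (hy.trans hyz)]
    exact mul_le_mul_of_nonneg_left hyz (abs_nonneg l)
  rcases eq_or_lt_of_le (norm_nonneg v) with hv | hv
  · have : v = 0 := norm_eq_zero.1 hv.symm
    subst this
    simpa using hmono (norm_nonneg x) hx
  rcases eq_or_lt_of_le hb0 with hb | hb
  · have : x = 0 := norm_le_zero_iff.1 (hb ▸ hx)
    subst this
    simp [← hb]
  have hin := abs_le.1 ((abs_real_inner_le_norm v x).trans
    (mul_le_mul_of_nonneg_left hx (norm_nonneg v)))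
  set a := ‖v‖
  set s : ℝ := inner ℝ v x
  have hab : 0 < a * b := mul_pos hv hb
  have hu : 0 ≤ a ^ 2 + 2 * s + b ^ 2 := by nlinarith [sq_nonneg (a - b)]
  have h1 : Real.cosh (l * ‖v + x‖) ≤ Real.cosh (l * Real.sqrt (a ^ 2 + 2 * s + b ^ 2)) := by
    refine hmono (norm_nonneg _) (Real.le_sqrt_of_sq_le ?_)
    rw [norm_add_sq_real]
    have := pow_le_pow_left₀ (norm_nonneg x) hx 2
    linarith
  -- The weight `θ` places `a ^ 2 + 2 * s + b ^ 2` between `(a - b) ^ 2` and `(a + b) ^ 2`; it is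
  -- affine in `s`.
  have h2 := cosh_le_of_sq_eq (r := l * Real.sqrt (a ^ 2 + 2 * s + b ^ 2))
    (x := l * a - l * b) (z := l * a + l * b) (θ := (s + a * b) / (2 * (a * b)))
    (div_nonneg (by linarith) (by linarith)) ((div_le_one (by linarith)).2 (by linarith)) (by
      rw [mul_pow, Real.sq_sqrt hu]
      field_simp
      ring)
  refine h1.trans (h2.trans (le_of_eq ?_))
  rw [Real.cosh_add, Real.cosh_sub]
  field_simp
  ring

variable {X : Type*}

/-- Each independent centered summand multiplies the expected potential by at most `cosh (l * b)`.
The starting vector `v` is arbitrary so that the induction can absorb the first draw into it. -/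
lemma expect_iidPMF_cosh_le (p : PMF X) {Y : X → E} {b : ℝ} (hb : ∀ x, ‖Y x‖ ≤ b)
    (hmean : ∀ v, p.expect (fun x => inner ℝ v (Y x)) = 0) (l : ℝ) (n : ℕ) (v : E) :
    (iidPMF p n).expect (fun w => Real.cosh (l * ‖v + ∑ i, Y (w i)‖)) ≤
      Real.cosh (l * ‖v‖) * Real.cosh (l * b) ^ n := by
  have hbd : ∀ {y z : ℝ}, 0 ≤ y → y ≤ z → |Real.cosh (l * y)| ≤ Real.cosh (l * z) := by
    intro y z hy hyz
    rw [abs_of_pos (Real.cosh_pos _), Real.cosh_le_cosh, abs_mul, abs_mul, abs_of_nonneg hy,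
      abs_of_nonneg (hy.trans hyz)]
    exact mul_le_mul_of_nonneg_left hyz (abs_nonneg l)
  have hsum : ∀ (n : ℕ) (v : E) (w : Fin n → X),
      |Real.cosh (l * ‖v + ∑ i, Y (w i)‖)| ≤ Real.cosh (l * (‖v‖ + n * b)) := by
    intro n v w
    refine hbd (norm_nonneg _) ((norm_add_le _ _).trans (add_le_add le_rfl ?_))
    refine (norm_sum_le_of_le _ fun i _ => hb (w i)).trans (le_of_eq ?_)
    simp
  induction n generalizing v with
  | zero => simp [iidPMF, PMF.expect_pure]
  | succ n ih =>
    rw [iidPMF, PMF.expect_bind _ _ (hsum (n + 1) v)]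
    have h1 : ∀ x, ((iidPMF p n).map fun w => Fin.cons (α := fun _ => X) x w).expect
        (fun w => Real.cosh (l * ‖v + ∑ i, Y (w i)‖)) ≤
        Real.cosh (l * ‖v + Y x‖) * Real.cosh (l * b) ^ n := by
      intro x
      rw [PMF.expect_map _ _ (hsum (n + 1) v)]
      simp only [Fin.sum_univ_succ, Fin.cons_zero, Fin.cons_succ, ← add_assoc]
      exact ih (v + Y x)
    have hc : 0 ≤ Real.cosh (l * b) ^ n := (pow_pos (Real.cosh_pos _) n).le
    have hvb : ∀ x, |Real.cosh (l * ‖v + Y x‖)| ≤ Real.cosh (l * (‖v‖ + b)) := fun x =>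
      hbd (norm_nonneg _) ((norm_add_le _ _).trans (add_le_add le_rfl (hb x)))
    refine (p.expect_mono (fun x => PMF.abs_expect_le _ (hsum (n + 1) v))
      (D := Real.cosh (l * b) ^ n * Real.cosh (l * (‖v‖ + b)))
      (g := fun x => Real.cosh (l * b) ^ n * Real.cosh (l * ‖v + Y x‖)) (fun x => ?_)
      fun x => (h1 x).trans_eq (mul_comm _ _)).trans ?_
    · rw [abs_mul, abs_of_nonneg hc]
      exact mul_le_mul_of_nonneg_left (hvb x) hc
    · rw [PMF.expect_const_mul, pow_succ, ← mul_assoc, mul_right_comm,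
        mul_comm _ (Real.cosh (l * b) ^ n)]
      refine mul_le_mul_of_nonneg_left ?_ hc
      set κ := Real.sinh (l * ‖v‖) * Real.sinh (l * b) / (‖v‖ * b)
      have hin : ∀ x, |κ * inner ℝ v (Y x)| ≤ |κ| * (‖v‖ * b) := fun x => by
        rw [abs_mul]
        exact mul_le_mul_of_nonneg_left ((abs_real_inner_le_norm _ _).trans
          (mul_le_mul_of_nonneg_left (hb x) (norm_nonneg v))) (abs_nonneg _)
      refine (p.expect_mono hvb (fun x => (abs_add_le _ _).trans (add_le_add le_rfl (hin x)))
        fun x => cosh_norm_add_le l v (Y x) (hb x)).trans (le_of_eq ?_)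
      rw [PMF.expect_add p (fun _ => le_rfl) hin, PMF.expect_const, PMF.expect_const_mul, hmean,
        mul_zero, add_zero]

/-- Dimension-free tail bound for sums of independent centered bounded vectors. -/
lemma expect_iidPMF_tail_le (p : PMF X) {Y : X → E} {b : ℝ} (hb0 : 0 < b) (hb : ∀ x, ‖Y x‖ ≤ b)
    (hmean : ∀ v, p.expect (fun x => inner ℝ v (Y x)) = 0) {n : ℕ} (hn : 0 < n) {r : ℝ}
    (hr : 0 ≤ r) :
    (iidPMF p n).expect ({w | r ≤ ‖∑ i, Y (w i)‖}.indicator fun _ => 1) ≤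
      2 * Real.exp (-(r ^ 2 / (2 * n * b ^ 2))) := by
  have hn' : (0 : ℝ) < n := by exact_mod_cast hn
  -- This `l` minimizes the exponent `-l * r + n * l ^ 2 * b ^ 2 / 2`.
  set l := r / (n * b ^ 2) with hl
  have hl0 : 0 ≤ l := by positivity
  have h1 := expect_iidPMF_cosh_le p hb hmean l n 0
  simp only [zero_add, norm_zero, mul_zero, Real.cosh_zero, one_mul] at h1
  have h2 : Real.cosh (l * b) ^ n ≤ Real.exp (n * ((l * b) ^ 2 / 2)) := by
    rw [Real.exp_nat_mul]
    exact pow_le_pow_left₀ (Real.cosh_pos _).le (Real.cosh_le_exp_half_sq _) n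
  have hbd : ∀ w : Fin n → X, |2 * Real.exp (-(l * r)) * Real.cosh (l * ‖∑ i, Y (w i)‖)| ≤
      2 * Real.exp (-(l * r)) * Real.cosh (l * (n * b)) := fun w => by
    rw [abs_of_pos (by have := Real.cosh_pos (l * ‖∑ i, Y (w i)‖); positivity)]
    refine mul_le_mul_of_nonneg_left ?_ (by positivity)
    rw [Real.cosh_le_cosh, abs_of_nonneg (by positivity), abs_of_nonneg (by positivity)]
    refine mul_le_mul_of_nonneg_left ?_ hl0
    exact (norm_sum_le_of_le _ fun i _ => hb (w i)).trans (le_of_eq (by simp))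
  refine ((iidPMF p n).expect_mono (abs_indicator_one_le _) hbd fun w => ?_).trans ?_
  · by_cases hw : r ≤ ‖∑ i, Y (w i)‖
    · rw [Set.indicator_of_mem (by exact hw)]
      -- Bounding `cosh` below by half an exponential is the origin of the factor `2` in the tail.
      have h3 : Real.exp (l * r) / 2 ≤ Real.cosh (l * ‖∑ i, Y (w i)‖) := by
        rw [Real.cosh_eq]
        have := Real.exp_le_exp.2 (mul_le_mul_of_nonneg_left hw hl0)
        have := Real.exp_pos (-(l * ‖∑ i, Y (w i)‖))
        linarith
      have h4 := mul_le_mul_of_nonneg_left h3 (show 0 ≤ 2 * Real.exp (-(l * r)) by positivity)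
      refine le_trans (le_of_eq ?_) h4
      rw [Real.exp_neg]
      field_simp
    · rw [Set.indicator_of_notMem (by exact hw)]
      have := Real.cosh_pos (l * ‖∑ i, Y (w i)‖)
      positivity
  · rw [PMF.expect_const_mul]
    have h3 := mul_le_mul_of_nonneg_left (h1.trans h2)
      (show 0 ≤ 2 * Real.exp (-(l * r)) by positivity)
    refine h3.trans (le_of_eq ?_)
    rw [mul_assoc, ← Real.exp_add]
    congr 2
    rw [hl]
    field_simp
    ring

/-- Concentration of an empirical mean around the true mean in Euclidean space. -/
lemma expect_iidPMF_mean_le {ι : Type*} [Fintype ι] (p : PMF X) {Y : X → EuclideanSpace ℝ ι}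
    {b : ℝ} (hb0 : 0 < b) (hb : ∀ x, ‖Y x‖ ≤ b) {m : EuclideanSpace ℝ ι}
    (hm : ∀ i, p.expect (fun x => Y x i) = m i) {n : ℕ} (hn : 0 < n) {r : ℝ} (hr : 0 ≤ r) :
    (iidPMF p n).expect ({w | r ≤ ‖(1 / (n : ℝ)) • ∑ i, Y (w i) - m‖}.indicator fun _ => 1) ≤
      2 * Real.exp (-(n * r ^ 2 / (8 * b ^ 2))) := by
  have hn' : (0 : ℝ) < n := by exact_mod_cast hn
  have hcoord : ∀ i x, |Y x i| ≤ b := fun i x => (PiLp.norm_apply_le (Y x) i).trans (hb x)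
  have hYv : ∀ v, p.expect (fun x => inner ℝ v (Y x)) = inner ℝ v m := by
    intro v
    simp only [PiLp.inner_apply, RCLike.inner_apply, conj_trivial, mul_comm (Y _ _)]
    rw [p.expect_sum Finset.univ (C := fun i => |v i| * b) fun i x => by
      rw [abs_mul]; exact mul_le_mul_of_nonneg_left (hcoord i x) (abs_nonneg _)]
    exact Finset.sum_congr rfl fun i _ => by rw [p.expect_const_mul, hm, mul_comm]
  have hmb : ‖m‖ ≤ b := by
    have h1 : inner ℝ m m ≤ ‖m‖ * b := by
      rw [← hYv]
      have h2 : ∀ x, |inner ℝ m (Y x)| ≤ ‖m‖ * b := fun x => (abs_real_inner_le_norm _ _).trans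
        (mul_le_mul_of_nonneg_left (hb x) (norm_nonneg m))
      exact (abs_le.1 (p.abs_expect_le h2)).2
    rw [real_inner_self_eq_norm_sq] at h1
    by_contra hlt
    push Not at hlt
    nlinarith
  -- Centering doubles the bound, which changes the `2` in the exponent of the tail bound into `8`.
  have hZ : ∀ x, ‖Y x - m‖ ≤ 2 * b := fun x => (norm_sub_le _ _).trans (by linarith [hb x])
  have hZm : ∀ v, p.expect (fun x => inner ℝ v (Y x - m)) = 0 := by
    intro v
    simp only [inner_sub_right]
    simp only [sub_eq_add_neg]
    rw [p.expect_add (fun x => (abs_real_inner_le_norm v (Y x)).trans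
      (mul_le_mul_of_nonneg_left (hb x) (norm_nonneg v))) (fun _ => le_rfl), p.expect_const, hYv]
    ring
  have h := expect_iidPMF_tail_le p (by linarith : 0 < 2 * b) hZ hZm hn
    (mul_nonneg hn'.le hr)
  have hset : {w : Fin n → X | r ≤ ‖(1 / (n : ℝ)) • ∑ i, Y (w i) - m‖} =
      {w | n * r ≤ ‖∑ i, (Y (w i) - m)‖} := by
    ext w
    have : ∑ i, (Y (w i) - m) = (n : ℝ) • ((1 / (n : ℝ)) • ∑ i, Y (w i) - m) := by
      rw [smul_sub, smul_smul, mul_one_div_cancel hn'.ne', one_smul, Finset.sum_sub_distrib]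
      simp [Nat.cast_smul_eq_nsmul]
    rw [Set.mem_ofPred_eq, Set.mem_ofPred_eq, this, norm_smul, Real.norm_of_nonneg hn'.le]
    exact (mul_le_mul_iff_right₀ hn').symm
  rw [hset]
  refine h.trans (le_of_eq ?_)
  congr 3
  field_simp
  ring

end Concentration

/-! ### Bias and fluctuation of the gradient estimator. -/

section Sampling

variable {S : Type u} {A : Type v} [Fintype S] [Fintype A]

lemma exists_abs_le_of_finite {X : Type*} [Finite X] (f : X → ℝ) : ∃ C, ∀ x, |f x| ≤ C := by
  have := Fintype.ofFinite X
  exact ⟨∑ x, |f x|, fun x =>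
    Finset.single_le_sum (f := fun x => |f x|) (fun _ _ => abs_nonneg _) (Finset.mem_univ x)⟩

lemma expect_acceptCoin (M : MDP S A) (f : Bool → ℝ) :
    (acceptCoin M).expect f = (1 - M.γ) * f true + M.γ * f false := by
  rw [PMF.expect_eq_sum, Fintype.sum_bool]
  simp [acceptCoin, ENNReal.toReal_ofReal M.one_sub_pos.le, ENNReal.toReal_ofReal M.γ_nonneg]

lemma expect_transition (M : MDP S A) (s : S) (a : A) (f : S → ℝ) :
    (toPMF (M.P s a)).expect f = nextValue M f s a := expect_toPMF _ _

lemma expect_policy (π : Policy S A) (s : S) (f : A → ℝ) :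
    (toPMF (π s)).expect f = ∑ a, π.mat s a * f a := expect_toPMF _ _

lemma expect_acceptLaw_succ (M : MDP S A) (π : Policy S A) (n : ℕ) (s : S) (f : S → ℝ) :
    (acceptLaw M π (n + 1) s).expect f = (1 - M.γ) * f s +
      M.γ * ∑ a, π.mat s a * nextValue M (fun s' => (acceptLaw M π n s').expect f) s a := by
  obtain ⟨C, hC⟩ := exists_abs_le_of_finite f
  rw [acceptLaw, PMF.expect_bind _ _ hC, expect_acceptCoin]
  simp only [if_true, PMF.expect_pure, Bool.false_eq_true, if_false]
  rw [PMF.expect_bind _ _ hC, expect_policy]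
  simp only [PMF.expect_bind _ _ hC, expect_transition]

/-- Truncating the acceptance scheme after `n` refusals changes expectations by `O(γⁿ⁺¹)`. -/
lemma abs_expect_acceptLaw_sub_le (M : MDP S A) (π : Policy S A) {f : S → ℝ} {B : ℝ}
    (hf : ∀ s, |f s| ≤ B) (n : ℕ) (s : S) :
    |(acceptLaw M π n s).expect f - (1 - M.γ) * value M π f s| ≤ 2 * B * M.γ ^ (n + 1) := by
  have hγ := M.one_sub_pos
  have hW : ∀ s, |(1 - M.γ) * value M π f s| ≤ B := fun s => by
    rw [abs_mul, abs_of_pos hγ, ← le_div_iff₀' hγ]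
    exact abs_value_le M π hf s
  -- The function `(1 - γ) * value` is a fixed point of the recursion obeyed by the acceptance
  -- scheme, so each further allowed refusal shrinks the error by `γ`.
  have heq : ∀ s, (1 - M.γ) * value M π f s = (1 - M.γ) * f s + M.γ * ∑ a, π.mat s a *
      nextValue M (fun s => (1 - M.γ) * value M π f s) s a := fun s => by
    conv_lhs => rw [value_eq M π f s]
    simp only [nextValue, mul_add, Finset.mul_sum]
    congr 1
    exact Finset.sum_congr rfl fun a _ => Finset.sum_congr rfl fun s' _ => by ring
  have hW' : ∀ s, |∑ a, π.mat s a * nextValue M (fun s => (1 - M.γ) * value M π f s) s a| ≤ B :=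
    fun s => abs_sum_mat_mul_le π s fun a => abs_nextValue_le M hW s a
  induction n generalizing s with
  | zero =>
    rw [acceptLaw, PMF.expect_pure, heq s]
    have h1 := abs_sub (f s) (∑ a, π.mat s a * nextValue M (fun s => (1 - M.γ) * value M π f s) s a)
    calc _ = |M.γ * (f s - ∑ a, π.mat s a *
          nextValue M (fun s => (1 - M.γ) * value M π f s) s a)| := by congr 1; ring
      _ ≤ M.γ * (B + B) := by
          rw [abs_mul, abs_of_nonneg M.γ_nonneg]
          exact mul_le_mul_of_nonneg_left (h1.trans (add_le_add (hf s) (hW' s))) M.γ_nonneg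
      _ = _ := by ring
  | succ n ih =>
    rw [expect_acceptLaw_succ, heq s]
    have hn := fun a => abs_nextValue_le M ih s a
    have key : ∀ g h : S → ℝ, (1 - M.γ) * f s + M.γ * ∑ a, π.mat s a * nextValue M g s a -
        ((1 - M.γ) * f s + M.γ * ∑ a, π.mat s a * nextValue M h s a) =
        M.γ * ∑ a, π.mat s a * nextValue M (fun s => g s - h s) s a := by
      intro g h
      have := fun a => nextValue_sub M g h s a
      simp only [show (fun s => g s - h s) = g - h from rfl, this, mul_sub,
        Finset.sum_sub_distrib]
      ring
    rw [key, abs_mul, abs_of_nonneg M.γ_nonneg]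
    refine (mul_le_mul_of_nonneg_left (abs_sum_mat_mul_le π s hn) M.γ_nonneg).trans
      (le_of_eq (by ring))

/-- Law of the accepted state. -/
def startLaw (M : MDP S A) (ν : stdSimplex ℝ S) (K : ℕ) (π : Policy S A) : PMF S :=
  (toPMF ν).bind fun s => acceptLaw M π K s

/-- Without truncation the accepted state would follow the visitation distribution. Testing against
the signs reduces the `ℓ¹` distance to the truncation error of one expectation. -/
lemma sum_abs_startLaw_sub_le (M : MDP S A) (ν : stdSimplex ℝ S) (K : ℕ) (π : Policy S A) :
    ∑ s, |(startLaw M ν K π s).toReal - (1 - M.γ) * occupancy M ν π.mat s| ≤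
      2 * M.γ ^ (K + 1) := by
  set σ : S → ℝ := fun s => SignType.sign
    ((startLaw M ν K π s).toReal - (1 - M.γ) * occupancy M ν π.mat s) with hσdef
  have hσ : ∀ s, |σ s| ≤ 1 := fun s => by
    simp only [σ]
    rcases lt_trichotomy ((startLaw M ν K π s).toReal - (1 - M.γ) * occupancy M ν π.mat s) 0
      with h | h | h <;> simp [h, sign_neg, sign_pos]
  have h1 : ∑ s, |(startLaw M ν K π s).toReal - (1 - M.γ) * occupancy M ν π.mat s| =
      (startLaw M ν K π).expect σ - (1 - M.γ) * ∑ s, occupancy M ν π.mat s * σ s := by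
    rw [PMF.expect_eq_sum, Finset.mul_sum, ← Finset.sum_sub_distrib]
    refine Finset.sum_congr rfl fun s _ => ?_
    rw [← mul_assoc, ← sub_mul, hσdef, self_mul_sign]
  have h2 : (startLaw M ν K π).expect σ - (1 - M.γ) * ∑ s, occupancy M ν π.mat s * σ s =
      ∑ s, ν.1 s * ((acceptLaw M π K s).expect σ - (1 - M.γ) * value M π σ s) := by
    rw [startLaw, PMF.expect_bind _ _ hσ, expect_toPMF, sum_occupancy_eq_sum_value, Finset.mul_sum,
      ← Finset.sum_sub_distrib]
    exact Finset.sum_congr rfl fun s _ => by ring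
  rw [h1, h2]
  have hν : ∑ s, ν.1 s = 1 := ν.2.2
  calc _ ≤ ∑ s, ν.1 s * (2 * M.γ ^ (K + 1)) := by
        refine Finset.sum_le_sum fun s _ => mul_le_mul_of_nonneg_left ?_ (ν.2.1 s)
        have := (le_abs_self _).trans (abs_expect_acceptLaw_sub_le M π hσ K s)
        linarith
    _ = _ := by rw [← Finset.sum_mul, hν, one_mul]

/-- Discounted return of the part of a trajectory after its first step. -/
def tailReturn (M : MDP S A) (Ω : (A → ℝ) → ℝ) (lam : ℝ) (π : Policy S A)
    (l : List (S × A)) : ℝ :=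
  ∑ i : Fin l.length, M.γ ^ ((i : ℕ) + 1) *
    (M.r (l.get i).1 (l.get i).2 - lam * Ω (π.mat (l.get i).1))

lemma tailReturn_cons (M : MDP S A) (Ω : (A → ℝ) → ℝ) (lam : ℝ) (π : Policy S A)
    (x : S × A) (l : List (S × A)) : tailReturn M Ω lam π (x :: l) =
      M.γ * (M.r x.1 x.2 - lam * Ω (π.mat x.1) + tailReturn M Ω lam π l) := by
  rw [tailReturn, tailReturn]
  simp only [List.length_cons]
  rw [Fin.sum_univ_succ, mul_add, Finset.mul_sum]
  congr 1
  · simp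
  · refine Finset.sum_congr rfl fun i _ => ?_
    simp only [Fin.val_succ, List.get_eq_getElem, List.getElem_cons_succ]
    ring

variable [Nonempty A] [DecidableEq A] {M : MDP S A} {Ω : (A → ℝ) → ℝ} {CΦ Ct lam : ℝ}

lemma abs_reward_sub_le (hΩ : IsRegularizer Ω CΦ Ct) (hlam : 0 ≤ lam) (π : Policy S A)
    (s : S) (a : A) : |M.r s a - lam * Ω (π.mat s)| ≤ 1 + lam * CΦ := by
  have h1 := mul_nonneg hlam (hΩ.nonneg _ (π.mat_mem s))
  have h2 := mul_le_mul_of_nonneg_left (hΩ.le_CΦ _ (π.mat_mem s)) hlam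
  have h3 := M.r_nonneg s a
  have h4 := M.r_le_one s a
  rw [abs_le]
  constructor <;> linarith

lemma abs_tailReturn_le (hΩ : IsRegularizer Ω CΦ Ct) (hlam : 0 ≤ lam) (π : Policy S A)
    (l : List (S × A)) :
    |tailReturn M Ω lam π l| ≤ M.γ * ((1 + lam * CΦ) / (1 - M.γ)) := by
  have hγ := M.one_sub_pos
  have hc : 0 ≤ (1 + lam * CΦ) / (1 - M.γ) :=
    div_nonneg (by linarith [mul_nonneg hlam hΩ.nonneg_bound]) hγ.le
  induction l with
  | nil => simpa [tailReturn] using mul_nonneg M.γ_nonneg hc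
  | cons x l ih =>
    rw [tailReturn_cons, abs_mul, abs_of_nonneg M.γ_nonneg]
    refine mul_le_mul_of_nonneg_left ((abs_add_le _ _).trans
      ((add_le_add (abs_reward_sub_le hΩ hlam π x.1 x.2) ih).trans (le_of_eq ?_))) M.γ_nonneg
    field_simp
    ring

/-- The expected truncated return and `γ` times the next value obey the same one-step recursion, so
their difference contracts by `γ` at each further step. -/
lemma abs_expect_tailReturn_sub_le (hΩ : IsRegularizer Ω CΦ Ct) (hlam : 0 ≤ lam) (π : Policy S A)
    (n : ℕ) (s : S) (a : A) :
    |(rolloutLaw M π n s a).expect (tailReturn M Ω lam π) -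
      M.γ * nextValue M (regValue M Ω lam π) s a| ≤
      M.γ ^ (n + 1) * ((1 + lam * CΦ) / (1 - M.γ)) := by
  have hV := abs_regValue_le (M := M) hΩ hlam π
  have hb := abs_tailReturn_le (M := M) hΩ hlam π
  induction n generalizing s a with
  | zero =>
    rw [rolloutLaw, PMF.expect_pure]
    simp only [tailReturn, List.length_nil, Finset.univ_eq_empty, Finset.sum_empty, zero_sub,
      abs_neg, abs_mul, abs_of_nonneg M.γ_nonneg, zero_add, pow_one]
    exact mul_le_mul_of_nonneg_left (abs_nextValue_le M hV s a) M.γ_nonneg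
  | succ n ih =>
    set ρ : S → A → ℝ := fun s a => (rolloutLaw M π n s a).expect (tailReturn M Ω lam π)
    have h1 : (rolloutLaw M π (n + 1) s a).expect (tailReturn M Ω lam π) =
        M.γ * nextValue M (fun s' => ∑ a', π.mat s' a' *
          (M.r s' a' - lam * Ω (π.mat s') + ρ s' a')) s a := by
      rw [rolloutLaw, PMF.expect_bind _ _ hb, expect_transition]
      have h2 : ∀ s', ((toPMF (π s')).bind fun a' =>
          (rolloutLaw M π n s' a').map fun l => (s', a') :: l).expect (tailReturn M Ω lam π) =
          M.γ * ∑ a', π.mat s' a' * (M.r s' a' - lam * Ω (π.mat s') + ρ s' a') := by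
        intro s'
        rw [PMF.expect_bind _ _ hb, expect_policy, Finset.mul_sum]
        refine Finset.sum_congr rfl fun a' _ => ?_
        rw [PMF.expect_map _ _ hb]
        simp only [tailReturn_cons]
        rw [PMF.expect_const_mul, PMF.expect_add _ (fun _ => le_rfl) hb, PMF.expect_const]
        ring
      simp only [h2, nextValue, Finset.mul_sum]
      exact Finset.sum_congr rfl fun s' _ => Finset.sum_congr rfl fun a' _ => by ring
    have h3 : ∀ s', regValue M Ω lam π s' = ∑ a', π.mat s' a' *
        (M.r s' a' - lam * Ω (π.mat s') + M.γ * nextValue M (regValue M Ω lam π) s' a') := by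
      intro s'
      conv_lhs => rw [regValue_eq]
      simp only [regQ, mul_add, mul_sub, Finset.sum_add_distrib, Finset.sum_sub_distrib,
        ← Finset.sum_mul, π.sum_mat]
      ring
    have h4 : (fun s' => ∑ a', π.mat s' a' * (M.r s' a' - lam * Ω (π.mat s') + ρ s' a')) -
        regValue M Ω lam π = fun s' => ∑ a', π.mat s' a' *
          (ρ s' a' - M.γ * nextValue M (regValue M Ω lam π) s' a') := by
      ext s'
      rw [Pi.sub_apply]
      conv_lhs => rw [h3 s']
      rw [← Finset.sum_sub_distrib]
      exact Finset.sum_congr rfl fun a' _ => by ring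
    rw [h1, ← mul_sub, ← nextValue_sub, h4, abs_mul, abs_of_nonneg M.γ_nonneg, pow_succ' M.γ (n + 1),
      mul_assoc]
    exact mul_le_mul_of_nonneg_left (abs_nextValue_le M
      (fun s' => abs_sum_mat_mul_le π s' fun a' => ih s' a') s a) M.γ_nonneg

lemma expect_uniformOfFintype (f : A → ℝ) :
    (PMF.uniformOfFintype A).expect f = (Fintype.card A : ℝ)⁻¹ * ∑ a, f a := by
  rw [PMF.expect_eq_sum, Finset.mul_sum]
  simp

lemma returnEst_eq (π : Policy S A) (s : S) (a : A) (l : List (S × A)) :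
    returnEst M Ω lam π (s, a, l) = M.r s a + tailReturn M Ω lam π l := rfl

lemma abs_returnEst_sub_le (hΩ : IsRegularizer Ω CΦ Ct) (hlam : 0 ≤ lam) (π : Policy S A)
    (τ : Trajectory S A) :
    |returnEst M Ω lam π τ - lam * gradΩ Ω (π.mat τ.1) τ.2.1| ≤ (1 + lam * Ct) / (1 - M.γ) := by
  obtain ⟨s, a, l⟩ := τ
  have hγ := M.one_sub_pos
  have h1 := abs_tailReturn_le (M := M) hΩ hlam π l
  have h2 := abs_lam_gradΩ_le hΩ hlam π s a
  have h3 : M.γ * ((1 + lam * CΦ) / (1 - M.γ)) ≤ M.γ * ((1 + lam * Ct) / (1 - M.γ)) :=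
    mul_le_mul_of_nonneg_left (div_le_div_of_nonneg_right (hΩ.const_le hlam) hγ.le) M.γ_nonneg
  rw [returnEst_eq]
  have h4 : |M.r s a| ≤ 1 := by rw [abs_of_nonneg (M.r_nonneg s a)]; exact M.r_le_one s a
  refine (abs_sub _ _).trans ((add_le_add (abs_add_le _ _) le_rfl).trans ?_)
  have h5 : 1 + M.γ * ((1 + lam * Ct) / (1 - M.γ)) + lam * Ct = (1 + lam * Ct) / (1 - M.γ) := by
    field_simp
    ring
  simp only at h2 ⊢
  linarith

variable [DecidableEq S]

/-- Contribution of one trajectory to the gradient estimator. -/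
def sampleGrad (M : MDP S A) (Ω : (A → ℝ) → ℝ) (lam : ℝ) (π : Policy S A)
    (τ : Trajectory S A) : EuclideanSpace ℝ (S × A) :=
  EuclideanSpace.single (τ.1, τ.2.1) ((Fintype.card A : ℝ) / (1 - M.γ) *
    (returnEst M Ω lam π τ - lam * gradΩ Ω (π.mat τ.1) τ.2.1))

lemma norm_sampleGrad_le (hΩ : IsRegularizer Ω CΦ Ct) (hlam : 0 ≤ lam) (π : Policy S A)
    (τ : Trajectory S A) :
    ‖sampleGrad M Ω lam π τ‖ ≤ (Fintype.card A : ℝ) * (1 + lam * Ct) / (1 - M.γ) ^ 2 := by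
  have hγ := M.one_sub_pos
  rw [sampleGrad, PiLp.norm_single, norm_mul, Real.norm_of_nonneg (by positivity)]
  refine (mul_le_mul_of_nonneg_left (abs_returnEst_sub_le hΩ hlam π τ) (by positivity)).trans
    (le_of_eq ?_)
  field_simp

lemma toEuclid_gradEst (π : Policy S A) {N : ℕ} (τ : Fin N → Trajectory S A) :
    toEuclid (gradEst M Ω lam π τ) = (1 / (N : ℝ)) • ∑ n, sampleGrad M Ω lam π (τ n) := by
  ext ⟨s, a⟩
  rw [toEuclid_apply, gradEst, PiLp.smul_apply, smul_eq_mul, mul_left_comm]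
  congr 1
  rw [WithLp.ofLp_sum, Finset.sum_apply, Finset.mul_sum]
  refine Finset.sum_congr rfl fun n _ => ?_
  rw [sampleGrad, PiLp.single_apply]
  by_cases h : (τ n).1 = s ∧ (τ n).2.1 = a
  · obtain ⟨rfl, rfl⟩ := h
    simp
  · rw [if_neg h, if_neg (by rintro h'; exact h ⟨(Prod.mk.inj h').1.symm, (Prod.mk.inj h').2.symm⟩),
      mul_zero]

/-- Mean of the state-action weight multiplying the visitation probability in the estimator. -/
def truncAdv (M : MDP S A) (Ω : (A → ℝ) → ℝ) (lam : ℝ) (π : Policy S A) (K : ℕ) (s : S)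
    (a : A) : ℝ :=
  (rolloutLaw M π (K - 1) s a).expect fun l =>
    returnEst M Ω lam π (s, a, l) - lam * gradΩ Ω (π.mat s) a

/-- The factor `|A|` cancels the probability `1 / |A|` of the uniform action, and `1 / (1 - γ)`
rescales visitation to occupancy. -/
lemma expect_sampleGrad (hΩ : IsRegularizer Ω CΦ Ct) (hlam : 0 ≤ lam) (ν : stdSimplex ℝ S)
    (K : ℕ) (π : Policy S A) (p : S × A) :
    (trajectoryLaw M ν K π).expect (fun τ => sampleGrad M Ω lam π τ p) =
      toEuclid (fun s a => (startLaw M ν K π s).toReal *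
        (1 / (1 - M.γ) * truncAdv M Ω lam π K s a)) p := by
  obtain ⟨s, a⟩ := p
  have hγ := M.one_sub_pos
  have hA : (Fintype.card A : ℝ) ≠ 0 := Nat.cast_ne_zero.2 Fintype.card_ne_zero
  have hb : ∀ τ : Trajectory S A, |sampleGrad M Ω lam π τ (s, a)| ≤
      (Fintype.card A : ℝ) * (1 + lam * Ct) / (1 - M.γ) ^ 2 := fun τ =>
    (PiLp.norm_apply_le (sampleGrad M Ω lam π τ) (s, a)).trans (norm_sampleGrad_le hΩ hlam π τ)
  rw [toEuclid_apply, trajectoryLaw, PMF.expect_bind _ _ hb]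
  change (startLaw M ν K π).expect _ = _
  have h1 : ∀ s₀ a₀, ((rolloutLaw M π (K - 1) s₀ a₀).map fun l => (s₀, a₀, l)).expect
      (fun τ => sampleGrad M Ω lam π τ (s, a)) =
      if s₀ = s ∧ a₀ = a then
        (Fintype.card A : ℝ) / (1 - M.γ) * truncAdv M Ω lam π K s a else 0 := by
    intro s₀ a₀
    rw [PMF.expect_map _ _ hb]
    by_cases h : s₀ = s ∧ a₀ = a
    · obtain ⟨rfl, rfl⟩ := h
      simp only [sampleGrad, PiLp.single_apply, if_true, and_self]
      rw [PMF.expect_const_mul, truncAdv]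
    · have hne : ¬ (s, a) = (s₀, a₀) := by
        rintro h'; exact h ⟨(Prod.mk.inj h').1.symm, (Prod.mk.inj h').2.symm⟩
      simp only [sampleGrad, PiLp.single_apply, if_neg h, if_neg hne, PMF.expect_const]
  have h2 : ∀ s₀, ((PMF.uniformOfFintype A).bind fun a₀ =>
      (rolloutLaw M π (K - 1) s₀ a₀).map fun l => (s₀, a₀, l)).expect
      (fun τ => sampleGrad M Ω lam π τ (s, a)) =
      if s₀ = s then 1 / (1 - M.γ) * truncAdv M Ω lam π K s a else 0 := by
    intro s₀
    rw [PMF.expect_bind _ _ hb, expect_uniformOfFintype]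
    simp only [h1]
    by_cases h : s₀ = s
    · simp only [h, true_and, if_true, Finset.sum_ite_eq', Finset.mem_univ]
      field_simp
    · simp [h]
  simp only [h2]
  rw [PMF.expect_eq_sum]
  simp

/-- Bias of the gradient estimator. -/
lemma norm_bias_le (hΩ : IsRegularizer Ω CΦ Ct) (hlam : 0 ≤ lam) (ν : stdSimplex ℝ S)
    (K : ℕ) (π : Policy S A) :
    norm2 ((fun s a => (startLaw M ν K π s).toReal *
        (1 / (1 - M.γ) * truncAdv M Ω lam π K s a)) - gradπ (J M Ω lam ν) π.mat) ≤
      3 * Real.sqrt (Fintype.card A) * (1 + lam * Ct) * M.γ ^ (max K 1) / (1 - M.γ) ^ 2 := by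
  have hγ := M.one_sub_pos
  have hγ0 := M.γ_nonneg
  have hG := hΩ.one_le_const hlam
  have hb := abs_tailReturn_le (M := M) hΩ hlam π
  set G := 1 + lam * Ct with hGdef
  have hadv : ∀ s a, |truncAdv M Ω lam π K s a| ≤ G / (1 - M.γ) := fun s a =>
    PMF.abs_expect_le _ fun l => abs_returnEst_sub_le hΩ hlam π (s, a, l)
  have hdiff : ∀ s a, |truncAdv M Ω lam π K s a - regAdv M Ω lam π s a| ≤
      M.γ ^ (max K 1) * (G / (1 - M.γ)) := by
    intro s a
    have h1 : truncAdv M Ω lam π K s a = M.r s a - lam * gradΩ Ω (π.mat s) a +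
        (rolloutLaw M π (K - 1) s a).expect (tailReturn M Ω lam π) := by
      rw [truncAdv]
      have : (fun l => returnEst M Ω lam π (s, a, l) - lam * gradΩ Ω (π.mat s) a) =
          fun l => (M.r s a - lam * gradΩ Ω (π.mat s) a) + tailReturn M Ω lam π l := by
        ext l; rw [returnEst_eq]; ring
      rw [this, PMF.expect_add _ (fun _ => le_rfl) hb, PMF.expect_const]
    have h2 := abs_expect_tailReturn_sub_le (M := M) hΩ hlam π (K - 1) s a
    -- The subtraction is truncated: for `K = 0` the rollout is empty, as for `K = 1`, and the error
    -- is still of order `γ`.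
    have h3 : K - 1 + 1 = max K 1 := by omega
    rw [h3] at h2
    rw [h1, regAdv, regQ]
    refine le_trans (le_of_eq ?_) (h2.trans (mul_le_mul_of_nonneg_left
      (div_le_div_of_nonneg_right (hΩ.const_le hlam) hγ.le) (pow_nonneg hγ0 _)))
    congr 1
    ring
  rw [gradπ_J M hΩ]
  -- The constant `3` is `2` for the law of the accepted state plus `1` for the truncated return.
  have hsplit : (fun s a => (startLaw M ν K π s).toReal *
        (1 / (1 - M.γ) * truncAdv M Ω lam π K s a)) -
      (fun s a => occupancy M ν π.mat s * regAdv M Ω lam π s a) =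
      (fun s a => ((startLaw M ν K π s).toReal - (1 - M.γ) * occupancy M ν π.mat s) *
        (1 / (1 - M.γ) * truncAdv M Ω lam π K s a)) +
      (fun s a => occupancy M ν π.mat s *
        (truncAdv M Ω lam π K s a - regAdv M Ω lam π s a)) := by
    ext s a
    simp only [Pi.sub_apply, Pi.add_apply]
    field_simp
    ring
  rw [hsplit]
  have hGγ : 0 ≤ G / (1 - M.γ) := div_nonneg (by linarith) hγ.le
  have h1 := norm2_mul_le
    (fun s => (startLaw M ν K π s).toReal - (1 - M.γ) * occupancy M ν π.mat s)
    (B := 1 / (1 - M.γ) * (G / (1 - M.γ)))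
    (g := fun s a => 1 / (1 - M.γ) * truncAdv M Ω lam π K s a) (by positivity) fun s a => by
      rw [abs_mul, abs_of_pos (by positivity)]
      exact mul_le_mul_of_nonneg_left (hadv s a) (by positivity)
  have h2 := norm2_mul_le (occupancy M ν π.mat) (by positivity) hdiff
  simp only [abs_of_nonneg (occupancy_nonneg M ν π _), sum_occupancy] at h2
  have h3 := sum_abs_startLaw_sub_le M ν K π
  have h4 : 2 * M.γ ^ (K + 1) ≤ 2 * M.γ ^ (max K 1) :=
    mul_le_mul_of_nonneg_left (pow_le_pow_of_le_one hγ0 M.γ_lt_one.le (by omega)) zero_le_two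
  have h5 := mul_le_mul_of_nonneg_left (h3.trans h4)
    (show 0 ≤ Real.sqrt (Fintype.card A) * (1 / (1 - M.γ) * (G / (1 - M.γ))) by positivity)
  refine (norm2_add_le _ _).trans ((add_le_add (h1.trans h5) h2).trans (le_of_eq ?_))
  field_simp
  ring

/-- The estimator is accurate with high probability. -/
lemma le_expect_gradEst (hΩ : IsRegularizer Ω CΦ Ct) (hlam : 0 ≤ lam) (ν : stdSimplex ℝ S)
    {K N : ℕ} (hN : 0 < N) (π : Policy S A) {e : ℝ} (he : 0 ≤ e)
    (hK : 3 * Real.sqrt (Fintype.card A) * (1 + lam * Ct) * M.γ ^ (max K 1) / (1 - M.γ) ^ 2 ≤ e) :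
    1 - 2 * Real.exp
        (-(N * e ^ 2 / (8 * ((Fintype.card A : ℝ) * (1 + lam * Ct) / (1 - M.γ) ^ 2) ^ 2))) ≤
      (iidPMF (trajectoryLaw M ν K π) N).expect
        ({τ | norm2 (gradEst M Ω lam π τ - gradπ (J M Ω lam ν) π.mat) ≤ 2 * e}.indicator
          fun _ => 1) := by
  have hγ := M.one_sub_pos
  have hG := hΩ.one_le_const hlam
  have hA : 0 < (Fintype.card A : ℝ) := Nat.cast_pos.2 Fintype.card_pos
  set m : S → A → ℝ := fun s a => (startLaw M ν K π s).toReal *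
        (1 / (1 - M.γ) * truncAdv M Ω lam π K s a) with hm
  have htail := expect_iidPMF_mean_le (trajectoryLaw M ν K π)
    (by positivity) (norm_sampleGrad_le (M := M) hΩ hlam π)
    (expect_sampleGrad (M := M) hΩ hlam ν K π) hN he
  have hbias := (norm_bias_le (M := M) hΩ hlam ν K π).trans hK
  set B := {w : Fin N → Trajectory S A | e ≤
    ‖(1 / (N : ℝ)) • ∑ i, sampleGrad M Ω lam π (w i) - toEuclid m‖} with hB
  have hone : ∀ w : Fin N → Trajectory S A, 1 - B.indicator (fun _ => (1 : ℝ)) w ≤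
      {τ : Fin N → Trajectory S A |
        norm2 (gradEst M Ω lam π τ - gradπ (J M Ω lam ν) π.mat) ≤ 2 * e}.indicator
          (fun _ => (1 : ℝ)) w := by
    intro w
    by_cases hw : w ∈ B
    · rw [Set.indicator_of_mem hw, sub_self]
      exact Set.indicator_nonneg (fun _ _ => zero_le_one) w
    · rw [Set.indicator_of_notMem hw, Set.indicator_of_mem, sub_zero]
      have h1 : ‖toEuclid (gradEst M Ω lam π w) - toEuclid m‖ ≤ e := by
        rw [toEuclid_gradEst]
        exact (not_le.1 hw).le
      rw [← map_sub, norm_toEuclid] at h1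
      have h2 := norm2_add_le (gradEst M Ω lam π w - m) (m - gradπ (J M Ω lam ν) π.mat)
      rw [sub_add_sub_cancel] at h2
      change norm2 _ ≤ 2 * e
      linarith
  have hbound : ∀ w : Fin N → Trajectory S A, |1 - B.indicator (fun _ => (1 : ℝ)) w| ≤ 1 := by
    intro w
    by_cases hw : w ∈ B <;> simp [hw]
  have hexp := (iidPMF (trajectoryLaw M ν K π) N).expect_mono hbound (abs_indicator_one_le _) hone
  refine le_trans ?_ hexp
  have hbound' : ∀ w : Fin N → Trajectory S A, |-1 * B.indicator (fun _ => (1 : ℝ)) w| ≤ 1 := by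
    intro w
    by_cases hw : w ∈ B <;> simp [hw]
  have h6 := (iidPMF (trajectoryLaw M ν K π) N).expect_add
    (f := fun _ => (1 : ℝ)) (fun _ => le_rfl) hbound'
  rw [PMF.expect_const, PMF.expect_const_mul] at h6
  have h7 : (fun w => 1 - B.indicator (fun _ => (1 : ℝ)) w) =
      fun w => 1 + -1 * B.indicator (fun _ => (1 : ℝ)) w := by ext w; ring
  rw [h7, h6]
  linarith

end Sampling

/-! ### Accuracy of all iterations simultaneously. -/

section Iterates

variable {S : Type u} {A : Type v} [Fintype S] [Fintype A] [Nonempty A] [DecidableEq S]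
  [DecidableEq A]

/-- Union bound over the iterations. -/
lemma le_expect_iteratesLaw (M : MDP S A) (Ω : (A → ℝ) → ℝ) (lam : ℝ) (ν : stdSimplex ℝ S)
    (K N : ℕ) (η : ℝ) (π₀ : Policy S A) (good : Policy S A → Policy S A → Prop) {d : ℝ}
    (hgood : ∀ π, 1 - d ≤ (iidPMF (trajectoryLaw M ν K π) N).expect
      ({τ | good π (pgaStep η π (gradEst M Ω lam π τ))}.indicator fun _ => 1)) (T : ℕ) :
    1 - T * d ≤ (iteratesLaw M Ω lam ν K N η π₀ T).expect
      ({h | h 0 = π₀ ∧ ∀ t : Fin T, good (h t.castSucc) (h t.succ)}.indicator fun _ => 1) := by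
  induction T with
  | zero =>
    rw [iteratesLaw, PMF.expect_pure, Set.indicator_of_mem]
    · simp
    · exact ⟨rfl, fun t => t.elim0⟩
  | succ T ih =>
    rw [iteratesLaw, PMF.expect_bind _ _ (abs_indicator_one_le _)]
    set G := {h : Fin (T + 1) → Policy S A | h 0 = π₀ ∧ ∀ t : Fin T, good (h t.castSucc) (h t.succ)}
      with hG
    set G' := {h : Fin (T + 1 + 1) → Policy S A |
      h 0 = π₀ ∧ ∀ t : Fin (T + 1), good (h t.castSucc) (h t.succ)} with hG'
    have hmem : ∀ h ∈ G, ∀ x, good (h (Fin.last T)) x →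
        (Fin.snoc (α := fun _ => Policy S A) h x : Fin (T + 1 + 1) → Policy S A) ∈ G' := by
      intro h hh x hx
      refine ⟨?_, fun t => ?_⟩
      · rw [← Fin.castSucc_zero, Fin.snoc_castSucc]
        exact hh.1
      · induction t using Fin.lastCases with
        | last => rwa [Fin.snoc_castSucc, Fin.succ_last, Fin.snoc_last]
        | cast t =>
          rw [Fin.snoc_castSucc, Fin.succ_castSucc, Fin.snoc_castSucc]
          exact hh.2 t
    have hd : 0 ≤ d := by
      have := (hgood π₀).trans (PMF.expect_le _ (abs_indicator_one_le _)
        fun w => (abs_le.1 (abs_indicator_one_le _ w)).2)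
      linarith
    -- After a good history the next step fails with probability at most `d`; after a bad one the
    -- left side is `-d` and nothing has to be shown.
    have hstep : ∀ h, G.indicator (fun _ => (1 : ℝ)) h + -d ≤
        ((iidPMF (trajectoryLaw M ν K (h (Fin.last T))) N).map fun τ =>
          (Fin.snoc (α := fun _ => Policy S A) h
            (pgaStep η (h (Fin.last T)) (gradEst M Ω lam (h (Fin.last T)) τ)) :
              Fin (T + 1 + 1) → Policy S A)).expect (G'.indicator fun _ => 1) := by
      intro h
      rw [PMF.expect_map _ _ (abs_indicator_one_le _)]
      by_cases hh : h ∈ G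
      · rw [Set.indicator_of_mem hh]
        refine (show (1 : ℝ) + -d ≤ 1 - d by linarith).trans ((hgood (h (Fin.last T))).trans
          (PMF.expect_mono _ (abs_indicator_one_le _) (fun _ => abs_indicator_one_le G' _)
            fun τ => ?_))
        by_cases hτ : good (h (Fin.last T))
            (pgaStep η (h (Fin.last T)) (gradEst M Ω lam (h (Fin.last T)) τ))
        · rw [Set.indicator_of_mem (by exact hτ), Set.indicator_of_mem (hmem h hh _ hτ)]
        · rw [Set.indicator_of_notMem (by exact hτ)]
          exact Set.indicator_nonneg (fun _ _ => zero_le_one) _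
      · rw [Set.indicator_of_notMem hh]
        have : (0 : ℝ) ≤ (iidPMF (trajectoryLaw M ν K (h (Fin.last T))) N).expect fun τ =>
            G'.indicator (fun _ => (1 : ℝ)) (Fin.snoc (α := fun _ => Policy S A) h
              (pgaStep η (h (Fin.last T)) (gradEst M Ω lam (h (Fin.last T)) τ))) :=
          PMF.le_expect _ (fun _ => abs_indicator_one_le G' _)
            fun _ => Set.indicator_nonneg (fun _ _ => zero_le_one) _
        linarith
    have h1 := (iteratesLaw M Ω lam ν K N η π₀ T).expect_mono
      (fun h => (abs_add_le _ _).trans (add_le_add (abs_indicator_one_le G h) le_rfl))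
      (fun h => PMF.abs_expect_le _ (abs_indicator_one_le G')) hstep
    rw [PMF.expect_add _ (abs_indicator_one_le G) (fun _ => le_rfl), PMF.expect_const] at h1
    refine le_trans ?_ h1
    push_cast
    linarith

end Iterates

/-! ### Sufficiency of the prescribed horizon and batch size. -/

section Parameters

lemma pow_mul_le_of_horizon_le {a γ lam CΦ Ct ε : ℝ} {K : ℕ} (ha : 0 < a) (hγ0 : 0 ≤ γ)
    (hγ1 : γ < 1) (hG : 1 ≤ 1 + lam * Ct) (hε : 0 < ε)
    (hK : horizon 128 a γ lam CΦ Ct ε ≤ K) :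
    3 * Real.sqrt a * (1 + lam * Ct) * γ ^ (max K 1) / (1 - γ) ^ 2 ≤ Real.sqrt ε / 4 := by
  have hg : 0 < 1 - γ := by linarith
  have hsε : 0 < Real.sqrt ε := Real.sqrt_pos.2 hε
  have hsa : 0 < Real.sqrt a := Real.sqrt_pos.2 ha
  -- For `γ = 0` the horizon gives no information, but the exponent `max K 1` is positive and the
  -- bias vanishes.
  rcases eq_or_lt_of_le hγ0 with rfl | hγ
  · rw [zero_pow (by omega)]
    simp only [mul_zero, zero_div]
    positivity
  have hlog : 0 < Real.log (1 / γ) := Real.log_pos (by rw [lt_div_iff₀ hγ]; linarith)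
  set Y := 128 * Real.sqrt a * (1 + lam * Ct) / (Real.sqrt ε * (1 - γ) ^ 2) with hY
  have hY0 : 0 < Y := by positivity
  have h1 : Real.log Y / Real.log (1 / γ) ≤ K := (le_max_right _ _).trans hK
  rw [div_le_iff₀ hlog, ← Real.log_pow, Real.log_le_log_iff hY0 (by positivity), one_div,
    inv_pow] at h1
  have h2 : Y * γ ^ K ≤ 1 := by
    have := mul_le_mul_of_nonneg_right h1 (pow_pos hγ K).le
    rwa [inv_mul_cancel₀ (pow_pos hγ K).ne'] at this
  have h3 : γ ^ (max K 1) ≤ γ ^ K := pow_le_pow_of_le_one hγ0 hγ1.le (le_max_left _ _)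
  have h4 : 3 * Real.sqrt a * (1 + lam * Ct) * γ ^ K / (1 - γ) ^ 2 =
      3 * Real.sqrt ε / 128 * (Y * γ ^ K) := by
    rw [hY]; field_simp
  have h5 : 3 * Real.sqrt a * (1 + lam * Ct) * γ ^ (max K 1) / (1 - γ) ^ 2 ≤
      3 * Real.sqrt a * (1 + lam * Ct) * γ ^ K / (1 - γ) ^ 2 := by gcongr
  rw [h4] at h5
  have h6 := mul_le_mul_of_nonneg_left h2 (show 0 ≤ 3 * Real.sqrt ε / 128 by positivity)
  linarith

lemma half_le_log_two : (1 : ℝ) / 2 ≤ Real.log 2 := by linarith [Real.log_two_gt_d9]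

/-- The constant `128 = 8 * 16` cancels the `8` of the tail exponent and the square of `1 / 4`. What
remains is `(s / ε)` times the logarithm, and `s / ε ≥ 1`. -/
lemma tail_le_of_batchSize_le {s a γ lam Ct ε δ T N : ℝ} (hs : 1 ≤ s) (ha : 1 ≤ a)
    (hγ1 : γ < 1) (hG : 1 ≤ 1 + lam * Ct) (hε : 0 < ε) (hε1 : ε ≤ 1) (hδ : 0 < δ) (hδ1 : δ < 1)
    (hT : 1 ≤ T) (hN : batchSize 128 s a γ lam Ct ε δ T ≤ N) :
    2 * Real.exp (-(N * (Real.sqrt ε / 4) ^ 2 / (8 * (a * (1 + lam * Ct) / (1 - γ) ^ 2) ^ 2))) ≤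
      δ / T := by
  have hg : 0 < 1 - γ := by linarith
  set G := 1 + lam * Ct
  have hlog0 : 0 ≤ Real.log (2 * a * T / δ) := by
    refine Real.log_nonneg ?_
    rw [le_div_iff₀ hδ]
    nlinarith [mul_le_mul ha hT zero_le_one (by linarith)]
  have h1 : Real.log (2 * T / δ) ≤ Real.log (2 * a * T / δ) := by
    refine Real.log_le_log (by positivity) (div_le_div_of_nonneg_right ?_ hδ.le)
    nlinarith
  have h2 : Real.log (2 * a * T / δ) ≤
      N * (Real.sqrt ε / 4) ^ 2 / (8 * (a * G / (1 - γ) ^ 2) ^ 2) := by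
    have h3 : N * (Real.sqrt ε / 4) ^ 2 / (8 * (a * G / (1 - γ) ^ 2) ^ 2) =
        N * (ε * (1 - γ) ^ 4 / (128 * (a ^ 2 * G ^ 2))) := by
      rw [div_pow, Real.sq_sqrt hε.le]
      field_simp
      ring
    have h4 := mul_le_mul_of_nonneg_right hN
      (show 0 ≤ ε * (1 - γ) ^ 4 / (128 * (a ^ 2 * G ^ 2)) by positivity)
    rw [h3]
    refine le_trans ?_ h4
    have h5 : batchSize 128 s a γ lam Ct ε δ T * (ε * (1 - γ) ^ 4 / (128 * (a ^ 2 * G ^ 2))) =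
        s / ε * Real.log (2 * a * T / δ) := by
      rw [batchSize, show 1 + lam * Ct = G from rfl]
      field_simp
    rw [h5]
    refine le_mul_of_one_le_left hlog0 ?_
    rw [le_div_iff₀ hε]
    linarith
  have h6 := Real.exp_le_exp.2 (neg_le_neg (h1.trans h2))
  rw [Real.exp_neg (Real.log _), Real.exp_log (by positivity)] at h6
  refine (mul_le_mul_of_nonneg_left h6 zero_le_two).trans (le_of_eq ?_)
  field_simp

lemma one_le_batchSize {s a γ lam Ct ε δ T : ℝ} (hs : 1 ≤ s) (ha : 1 ≤ a) (hγ0 : 0 ≤ γ)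
    (hγ1 : γ < 1) (hG : 1 ≤ 1 + lam * Ct) (hε : 0 < ε) (hε1 : ε ≤ 1) (hδ : 0 < δ) (hδ1 : δ < 1)
    (hT : 1 ≤ T) : 1 ≤ batchSize 128 s a γ lam Ct ε δ T := by
  have hg : 0 < 1 - γ := by linarith
  have h1 : Real.log 2 ≤ Real.log (2 * a * T / δ) := by
    refine Real.log_le_log two_pos ?_
    rw [le_div_iff₀ hδ]
    nlinarith [mul_le_mul ha hT zero_le_one (by linarith)]
  have h2 : 1 ≤ s * a ^ 2 * (1 + lam * Ct) ^ 2 / (ε ^ 2 * (1 - γ) ^ 4) := by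
    rw [le_div_iff₀ (by positivity), one_mul]
    calc ε ^ 2 * (1 - γ) ^ 4 ≤ 1 := mul_le_one₀ (pow_le_one₀ hε.le hε1) (by positivity)
          (pow_le_one₀ hg.le (by linarith))
      _ ≤ s * a ^ 2 * (1 + lam * Ct) ^ 2 := one_le_mul_of_one_le_of_one_le
          (one_le_mul_of_one_le_of_one_le hs (one_le_pow₀ ha)) (one_le_pow₀ hG)
  rw [batchSize]
  have h3 := half_le_log_two
  nlinarith

end Parameters

/-! ### Convergence with high probability. -/

section Convergence

variable {S : Type u} {A : Type v} [Fintype S] [Fintype A] [Nonempty A] [DecidableEq S]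
  [DecidableEq A] {M : MDP S A} {Ω : (A → ℝ) → ℝ} {CΦ Ct lam : ℝ} {ν : stdSimplex ℝ S}

lemma occupancy_pos (hν : ∀ s, 0 < ν.1 s) (π : Policy S A) (s : S) :
    0 < occupancy M ν π.mat s := (hν s).trans_le (le_occupancy M ν π s)

lemma occupancy_le_of_visit (hν : ∀ s, 0 < ν.1 s) {πstar : Policy S A} {ρν : ℝ}
    (hvis : ∀ (π : Policy S A) (s : S), visit M ν πstar.mat s / visit M ν π.mat s ≤ ρν)
    (π : Policy S A) (s : S) : occupancy M ν πstar.mat s ≤ ρν * occupancy M ν π.mat s := by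
  have h := hvis π s
  rwa [visit_eq, visit_eq, mul_div_mul_left _ _ M.one_sub_pos.ne',
    div_le_iff₀ (occupancy_pos hν π s)] at h

lemma one_le_of_visit [Nonempty S] (hν : ∀ s, 0 < ν.1 s) {πstar : Policy S A} {ρν : ℝ}
    (hvis : ∀ (π : Policy S A) (s : S), visit M ν πstar.mat s / visit M ν π.mat s ≤ ρν) :
    1 ≤ ρν := by
  obtain ⟨s⟩ := ‹Nonempty S›
  have h := hvis πstar s
  rwa [div_self] at h
  rw [visit_eq]
  exact (mul_pos M.one_sub_pos (occupancy_pos hν πstar s)).ne'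

theorem le_toOuterMeasure_exists_gap_le [Nonempty S] (hΩ : IsRegularizer Ω CΦ Ct)
    (hlam : 0 ≤ lam) (hν : ∀ s, 0 < ν.1 s) {πstar : Policy S A}
    (hopt : IsOptimal M Ω lam ν πstar) {ρν : ℝ}
    (hvis : ∀ (π : Policy S A) (s : S), visit M ν πstar.mat s / visit M ν π.mat s ≤ ρν)
    {L ε δ : ℝ} {T N K : ℕ} (π₀ : Policy S A) (hL : 0 < L)
    (hsm : SmoothOnPolicies (J M Ω lam ν) L) (hε : 0 < ε) (hε1 : ε ≤ 1) (hδ : 0 < δ) (hδ1 : δ < 1)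
    (hT : 1 ≤ T) (hK : horizon 128 (Fintype.card A) M.γ lam CΦ Ct ε ≤ K)
    (hN : batchSize 128 (Fintype.card S) (Fintype.card A) M.γ lam Ct ε δ T ≤ N) :
    ENNReal.ofReal (1 - δ) ≤
      (iteratesLaw M Ω lam ν K N (1 / L) π₀ T).toOuterMeasure
        {h | ∃ t : Fin T,
          J M Ω lam ν πstar.mat - J M Ω lam ν (h t.succ).mat ≤
            4 * ρν * Real.sqrt (Fintype.card S) *
              Real.sqrt (L * (J M Ω lam ν πstar.mat - J M Ω lam ν π₀.mat) / T + ε)} := by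
  have hA : (1 : ℝ) ≤ Fintype.card A := Nat.one_le_cast.2 Fintype.card_pos
  have hS : (1 : ℝ) ≤ Fintype.card S := Nat.one_le_cast.2 Fintype.card_pos
  have hT' : (1 : ℝ) ≤ T := Nat.one_le_cast.2 hT
  have hG := hΩ.one_le_const hlam
  have hN0 : 0 < N := by
    have := (one_le_batchSize hS hA M.γ_nonneg M.γ_lt_one hG hε hε1 hδ hδ1 hT').trans hN
    exact_mod_cast this
  have htail := tail_le_of_batchSize_le hS hA M.γ_lt_one hG hε hε1 hδ hδ1 hT' hN
  have hbias := pow_mul_le_of_horizon_le (by linarith) M.γ_nonneg M.γ_lt_one hG hε hK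
  -- Bias and fluctuation are each at most `√ε / 4`, except with probability `δ / T`; the union over
  -- `T` steps then costs `δ`.
  have hstep : ∀ π, 1 - δ / T ≤ (iidPMF (trajectoryLaw M ν K π) N).expect
      ({τ | IsInexactStep (J M Ω lam ν) (1 / L) (Real.sqrt ε / 2) π
        (pgaStep (1 / L) π (gradEst M Ω lam π τ))}.indicator fun _ => 1) := by
    intro π
    refine (sub_le_sub_left htail 1).trans
      ((le_expect_gradEst hΩ hlam ν hN0 π (by positivity) hbias).trans
        (PMF.expect_mono _ (abs_indicator_one_le _) (abs_indicator_one_le _) fun τ => ?_))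
    refine Set.indicator_le_indicator_of_subset (fun τ hτ => ?_) (fun _ => zero_le_one) τ
    have hτ' : norm2 (gradEst M Ω lam π τ - gradπ (J M Ω lam ν) π.mat) ≤ 2 * (Real.sqrt ε / 4) := hτ
    exact ⟨gradEst M Ω lam π τ, by linarith, rfl⟩
  have hexp := le_expect_iteratesLaw M Ω lam ν K N (1 / L) π₀ _ hstep T
  rw [mul_div_cancel₀ _ (by linarith : (T : ℝ) ≠ 0)] at hexp
  refine PMF.ofReal_le_toOuterMeasure _ (hexp.trans
    (PMF.expect_mono _ (abs_indicator_one_le _) (abs_indicator_one_le _) fun h => ?_))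
  refine Set.indicator_le_indicator_of_subset (fun h hh => ?_) (fun _ => zero_le_one) h
  have hρ : 0 ≤ ρν := zero_le_one.trans (one_le_of_visit hν hvis)
  have := exists_gap_le_of_steps hΩ hlam hopt hρ (occupancy_le_of_visit hν hvis) hL hsm hε.le hT h
    hh.2
  rw [hh.1] at this
  exact this

end Convergence

/-! ### Optimality from every state and transfer to another initial law. -/

section AllStates

variable {S : Type u} {A : Type v} [Fintype S] [Fintype A] [Nonempty A] [DecidableEq S]
  [DecidableEq A] {M : MDP S A} {Ω : (A → ℝ) → ℝ} {CΦ Ct lam : ℝ} {ν : stdSimplex ℝ S}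

/-- Bellman optimality of a maximizer of `J_ν` when `ν` has full support. -/
lemma IsOptimal.bellman_le (hν : ∀ s, 0 < ν.1 s) {πstar : Policy S A}
    (hopt : IsOptimal M Ω lam ν πstar) (s : S) (p : stdSimplex ℝ A) :
    ∑ a, p.1 a * regQ M Ω lam πstar s a - lam * Ω p.1 ≤ regValue M Ω lam πstar s := by
  -- Changing the policy in a single state leaves one term in the performance difference, and its
  -- occupancy weight is positive.
  set σ : Policy S A := Function.update πstar s p with hσ
  have hs : σ.mat s = p.1 := by
    change (Function.update πstar s p s).1 = p.1
    rw [Function.update_self]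
  have hne : ∀ t, t ≠ s → σ.mat t = πstar.mat t := fun t ht => by
    change (Function.update πstar s p t).1 = (πstar t).1
    rw [Function.update_of_ne ht]
  have h1 := (σ.rowBound M).J_sub Ω lam ν πstar
  rw [Finset.sum_eq_single s (fun t _ ht => by simp [hne t ht]) (by simp)] at h1
  have h2 := hopt σ
  have h3 := occupancy_pos (M := M) hν σ s
  have h4 : ∑ a, (σ.mat s a - πstar.mat s a) * regQ M Ω lam πstar s a -
      lam * (Ω (σ.mat s) - Ω (πstar.mat s)) ≤ 0 := by
    by_contra hc
    push Not at hc
    have := mul_pos h3 hc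
    linarith
  rw [regValue_eq]
  simp only [sub_mul, Finset.sum_sub_distrib, hs] at h4
  linarith

/-- By Bellman optimality the difference of the two values has nonnegative residual under `π`, so
the minimum principle applies. -/
lemma IsOptimal.regValue_le (hν : ∀ s, 0 < ν.1 s) {πstar : Policy S A}
    (hopt : IsOptimal M Ω lam ν πstar) (π : Policy S A) (s : S) :
    regValue M Ω lam π s ≤ regValue M Ω lam πstar s := by
  have := nonneg_of_residual M π (V := regValue M Ω lam πstar - regValue M Ω lam π)
    (fun s => ?_) s
  · simpa using this
  · have h1 := hopt.bellman_le hν s (π s)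
    have h2 := regValue_eq M Ω lam π s
    change ∑ a, π.mat s a * regQ M Ω lam πstar s a - lam * Ω (π.mat s) ≤ _ at h1
    simp only [regQ, mul_add, Finset.sum_add_distrib, mul_left_comm _ M.γ,
      ← Finset.mul_sum] at h1 h2
    simp only [nextValue_sub, mul_sub, Finset.sum_sub_distrib, Pi.sub_apply]
    linarith

/-- Transfer of suboptimality to another initial distribution. -/
lemma IsOptimal.J_sub_le (hν : ∀ s, 0 < ν.1 s) {πstar : Policy S A}
    (hopt : IsOptimal M Ω lam ν πstar) {μ : stdSimplex ℝ S} {ρ : ℝ}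
    (hμ : ∀ s, μ.1 s / ν.1 s ≤ ρ) (π π' : Policy S A) :
    J M Ω lam μ π'.mat - J M Ω lam μ π.mat ≤
      ρ * (J M Ω lam ν πstar.mat - J M Ω lam ν π.mat) := by
  simp only [J_eq_sum_regValue]
  rw [← Finset.sum_sub_distrib, ← Finset.sum_sub_distrib, Finset.mul_sum]
  refine Finset.sum_le_sum fun s _ => ?_
  have h1 := hopt.regValue_le hν π' s
  have h2 := hopt.regValue_le hν π s
  have h3 := (div_le_iff₀ (hν s)).1 (hμ s)
  have h4 : μ.1 s * (regValue M Ω lam π' s - regValue M Ω lam π s) ≤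
      μ.1 s * (regValue M Ω lam πstar s - regValue M Ω lam π s) :=
    mul_le_mul_of_nonneg_left (by linarith) (μ.2.1 s)
  have h5 := mul_le_mul_of_nonneg_right h3 (sub_nonneg.2 h2)
  linarith

lemma J_sub_J_le (hΩ : IsRegularizer Ω CΦ Ct) (hlam : 0 ≤ lam) (π π' : Policy S A) :
    J M Ω lam ν π.mat - J M Ω lam ν π'.mat ≤ (1 + lam * Ct) / (1 - M.γ) := by
  rw [(π.rowBound M).J_eq, (π'.rowBound M).J_eq]
  have h1 := sum_occupancy_mul_le M ν π (stageReward_le (M := M) hΩ hlam π)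
  have h2 := sum_occupancy_mul_le M ν π' (f := fun s => -stageReward M Ω lam π'.mat s)
    (B := lam * CΦ) fun s => by linarith [le_stageReward (M := M) hΩ hlam π' s]
  have h3 := div_le_div_of_nonneg_right (hΩ.const_le hlam) M.one_sub_pos.le
  simp only [mul_neg, Finset.sum_neg_distrib] at h2
  rw [add_div] at h3
  linarith

lemma one_le_of_ratio_le (hν : ∀ s, 0 < ν.1 s) {μ : stdSimplex ℝ S} {ρ : ℝ}
    (hμ : ∀ s, μ.1 s / ν.1 s ≤ ρ) : 1 ≤ ρ := by
  have h1 : ∑ s, μ.1 s = 1 := μ.2.2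
  have h2 : ∑ s, ν.1 s = 1 := ν.2.2
  calc (1 : ℝ) = ∑ s, μ.1 s := h1.symm
    _ ≤ ∑ s, ρ * ν.1 s := Finset.sum_le_sum fun s _ => (div_le_iff₀ (hν s)).1 (hμ s)
    _ = ρ := by rw [← Finset.mul_sum, h2, mul_one]

end AllStates

/-! ### Arithmetic of the complexity bounds. -/

section Complexity

lemma one_le_iterationScale {s a r v G e g : ℝ} (hs : 1 ≤ s) (ha : 1 ≤ a) (hr : 1 ≤ r) (hv : 1 ≤ v)
    (hG : 1 ≤ G) (he : 0 < e) (he1 : e ≤ 1) (hg : 0 < g) (hg1 : g ≤ 1) :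
    1 ≤ s * a * r ^ 2 * v ^ 2 * G ^ 2 / (e ^ 2 * g ^ 4) := by
  rw [le_div_iff₀ (by positivity), one_mul]
  calc e ^ 2 * g ^ 4 ≤ 1 := mul_le_one₀ (pow_le_one₀ he.le he1) (by positivity)
        (pow_le_one₀ hg.le hg1)
    _ ≤ _ := one_le_mul_of_one_le_of_one_le (one_le_mul_of_one_le_of_one_le
        (one_le_mul_of_one_le_of_one_le (one_le_mul_of_one_le_of_one_le hs ha) (one_le_pow₀ hr))
        (one_le_pow₀ hv)) (one_le_pow₀ hG)

/-- Everything is compared with `Z`, the argument of the target logarithm. The left argument is at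
most `258 / 16 * Z ^ 4`, and `Z ≥ 2` makes `Z ^ 5 ≥ 32` absorb the constant, hence the exponent `9`.
-/
lemma log_iterations_le {s a r v G e g δ T : ℝ} (hs : 1 ≤ s) (ha : 1 ≤ a) (hr : 1 ≤ r)
    (hv : 1 ≤ v) (hG : 1 ≤ G) (he : 0 < e) (he1 : e ≤ 1) (hg : 0 < g) (hg1 : g ≤ 1) (hδ : 0 < δ)
    (hδ1 : δ < 1) (hT : 0 < T)
    (hTX : T ≤ 129 * (s * a * r ^ 2 * v ^ 2 * G ^ 2 / (e ^ 2 * g ^ 4))) :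
    Real.log (2 * a * T / δ) ≤ 9 * Real.log (2 * s * a * r * v * G / (e * g * δ)) := by
  set u := s * a * r * v * G / (e * δ) with hu
  have hu1 : 1 ≤ u := by
    rw [hu, le_div_iff₀ (by positivity), one_mul]
    exact (mul_le_one₀ he1 hδ.le hδ1.le).trans (one_le_mul_of_one_le_of_one_le
      (one_le_mul_of_one_le_of_one_le (one_le_mul_of_one_le_of_one_le
        (one_le_mul_of_one_le_of_one_le hs ha) hr) hv) hG)
  have hZ : 2 * s * a * r * v * G / (e * g * δ) = 2 * u / g := by
    rw [hu]; field_simp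
  set Z := 2 * u / g with hZdef
  have hZ2 : 2 ≤ Z := by
    rw [hZdef, le_div_iff₀ hg]; nlinarith
  rw [hZ, show (9 : ℝ) = ((9 : ℕ) : ℝ) by norm_num, ← Real.log_pow]
  refine Real.log_le_log (by positivity) ?_
  have h1 : 2 * a * T / δ ≤ 258 * (u ^ 2 / g ^ 4) := by
    have e1 : 2 * a * T / δ ≤
        2 * a * (129 * (s * a * r ^ 2 * v ^ 2 * G ^ 2 / (e ^ 2 * g ^ 4))) / δ := by gcongr
    have e2 : 2 * a * (129 * (s * a * r ^ 2 * v ^ 2 * G ^ 2 / (e ^ 2 * g ^ 4))) / δ =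
        258 * (u ^ 2 / g ^ 4) * (δ / s) := by
      rw [hu]; field_simp; ring
    have e3 : δ / s ≤ 1 := by rw [div_le_one (by linarith)]; linarith
    rw [e2] at e1
    exact e1.trans (mul_le_of_le_one_right (by positivity) e3)
  have h2 : u ^ 2 / g ^ 4 ≤ Z ^ 4 / 16 := by
    have e1 : Z ^ 4 / 16 = u ^ 4 / g ^ 4 := by rw [hZdef]; field_simp; ring
    rw [e1]
    exact div_le_div_of_nonneg_right (pow_le_pow_right₀ hu1 (by norm_num)) (by positivity)
  have h3 : (32 : ℝ) ≤ Z ^ 5 := by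
    have := pow_le_pow_left₀ zero_le_two hZ2 5
    norm_num at this
    exact this
  have h4 := mul_le_mul_of_nonneg_left h3 (show 0 ≤ Z ^ 4 by positivity)
  have h5 : (Z : ℝ) ^ 9 = Z ^ 4 * Z ^ 5 := by ring
  have h6 : 0 ≤ Z ^ 4 := by positivity
  linarith

/-- The factors of the constant are `129` from `T`, `2` from rounding up the batch, `128` from the
batch size, `1024 = 32 ^ 2` from the inverse square of the accuracy, and `9` from the logarithm. -/
lemma total_samples_le {s a γ r v lam Ct e δ : ℝ} (hs : 1 ≤ s) (ha : 1 ≤ a) (hr : 1 ≤ r)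
    (hv : 1 ≤ v) (hG : 1 ≤ 1 + lam * Ct) (he : 0 < e) (he1 : e ≤ 1) (hγ0 : 0 ≤ γ) (hγ1 : γ < 1)
    (hδ : 0 < δ) (hδ1 : δ < 1) {T N : ℕ} (hT : 1 ≤ T)
    (hTX : (T : ℝ) ≤ 129 * (s * a * r ^ 2 * v ^ 2 * (1 + lam * Ct) ^ 2 / (e ^ 2 * (1 - γ) ^ 4)))
    (hε1 : e ^ 2 / (32 * r ^ 2 * v ^ 2 * s) ≤ 1)
    (hN : N = ⌈batchSize 128 s a γ lam Ct (e ^ 2 / (32 * r ^ 2 * v ^ 2 * s)) δ T⌉₊) :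
    ((T * N : ℕ) : ℝ) ≤
      129 * 2 * 128 * 1024 * 9 * (s ^ 4 * a ^ 3 * r ^ 6 * v ^ 6 * (1 + lam * Ct) ^ 4 /
        (e ^ 6 * (1 - γ) ^ 8)) *
        Real.log (2 * s * a * r * v * (1 + lam * Ct) / (e * (1 - γ) * δ)) := by
  have hg : 0 < 1 - γ := by linarith
  have hT' : (1 : ℝ) ≤ T := Nat.one_le_cast.2 hT
  have hlog := log_iterations_le hs ha hr hv hG he he1 hg (by linarith) hδ hδ1 (by linarith) hTX
  set G := 1 + lam * Ct with hGdef
  set B := batchSize 128 s a γ lam Ct (e ^ 2 / (32 * r ^ 2 * v ^ 2 * s)) δ T with hB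
  have hB1 : 1 ≤ B := one_le_batchSize hs ha hγ0 hγ1 hG (by positivity) hε1 hδ hδ1 hT'
  have hN2 : (N : ℝ) ≤ 2 * B := by
    rw [hN]
    have := Nat.ceil_lt_add_one (zero_le_one.trans hB1)
    linarith
  have hBeq : B = 128 * 1024 * (s ^ 3 * a ^ 2 * r ^ 4 * v ^ 4 * G ^ 2 / (e ^ 4 * (1 - γ) ^ 4)) *
      Real.log (2 * a * T / δ) := by
    rw [hB, batchSize, ← hGdef]
    field_simp
    ring
  have hB2 : B ≤ 128 * 1024 * (s ^ 3 * a ^ 2 * r ^ 4 * v ^ 4 * G ^ 2 / (e ^ 4 * (1 - γ) ^ 4)) *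
      (9 * Real.log (2 * s * a * r * v * G / (e * (1 - γ) * δ))) := by
    rw [hBeq]
    exact mul_le_mul_of_nonneg_left hlog (by positivity)
  push_cast
  refine (mul_le_mul hTX (hN2.trans (mul_le_mul_of_nonneg_left hB2 zero_le_two))
    (Nat.cast_nonneg _) (by positivity)).trans (le_of_eq ?_)
  field_simp

/-- The constant `128 = 4 * 32` makes the optimization term at most the statistical term `e ^ 2 /
(32 * r ^ 2 * v ^ 2 * s)`; then `16 * 2 / 32 = 1`. -/
lemma accuracy_le {s a r v G e g L D T : ℝ} (hs : 1 ≤ s) (ha : 1 ≤ a) (hr : 1 ≤ r) (hv : 1 ≤ v)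
    (hG : 1 ≤ G) (he : 0 < e) (hg : 0 < g) (hL : 0 < L) (hL' : L ≤ 4 * a * G / g ^ 3)
    (hD0 : 0 ≤ D) (hD : D ≤ G / g)
    (hT : 128 * (s * a * r ^ 2 * v ^ 2 * G ^ 2 / (e ^ 2 * g ^ 4)) ≤ T) :
    4 * v * Real.sqrt s * Real.sqrt (L * D / T + e ^ 2 / (32 * r ^ 2 * v ^ 2 * s)) ≤ e / r := by
  have hX : 0 < 128 * (s * a * r ^ 2 * v ^ 2 * G ^ 2 / (e ^ 2 * g ^ 4)) := by positivity
  have hTpos : 0 < T := hX.trans_le hT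
  have h1 : L * D / T ≤ e ^ 2 / (32 * r ^ 2 * v ^ 2 * s) := by
    calc L * D / T ≤ (4 * a * G / g ^ 3) * (G / g) /
          (128 * (s * a * r ^ 2 * v ^ 2 * G ^ 2 / (e ^ 2 * g ^ 4))) :=
          div_le_div₀ (by positivity) (mul_le_mul hL' hD hD0 (by positivity)) hX hT
      _ = _ := by
          field_simp
          ring
  have h0 : 0 ≤ L * D / T + e ^ 2 / (32 * r ^ 2 * v ^ 2 * s) := by positivity
  refine abs_le_of_sq_le_sq' ?_ (by positivity) |>.2
  rw [mul_pow, mul_pow, mul_pow, Real.sq_sqrt (by linarith), Real.sq_sqrt h0]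
  calc 4 ^ 2 * v ^ 2 * s * (L * D / T + e ^ 2 / (32 * r ^ 2 * v ^ 2 * s)) ≤
        4 ^ 2 * v ^ 2 * s * (e ^ 2 / (32 * r ^ 2 * v ^ 2 * s) +
          e ^ 2 / (32 * r ^ 2 * v ^ 2 * s)) := by gcongr
    _ = (e / r) ^ 2 := by
        field_simp
        ring

end Complexity

end

/-! ### Assembly of the three claims. -/

theorem theorem8 :
    ∃ c C : ℝ, 0 < c ∧ 0 < C ∧
    ∀ (S : Type u) (A : Type v) [Fintype S] [DecidableEq S] [Nonempty S]
      [Fintype A] [DecidableEq A] [Nonempty A]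
      (M : MDP S A) (Ω : (A → ℝ) → ℝ) (CΦ Ct lam : ℝ) (ν : stdSimplex ℝ S)
      (πstar : Policy S A) (ρν : ℝ),
      IsRegularizer Ω CΦ Ct →
      0 ≤ lam →
      (∀ s, 0 < ν.1 s) →
      IsOptimal M Ω lam ν πstar →
      (∀ (π : Policy S A) (s : S), visit M ν πstar.mat s / visit M ν π.mat s ≤ ρν) →
      -- `J_ν` is smooth on policies, with constant `4|A|(1+λCt)/(1-γ)³`
      SmoothOnPolicies (J M Ω lam ν)
        (4 * (Fintype.card A : ℝ) * (1 + lam * Ct) / (1 - M.γ) ^ 3) ∧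
      -- convergence with high probability, for every smoothness constant `L`
      (∀ (L ε δ : ℝ) (T N K : ℕ) (π₀ : Policy S A),
        0 < L → SmoothOnPolicies (J M Ω lam ν) L →
        0 < ε → ε ≤ 1 → 0 < δ → δ < 1 → 1 ≤ T →
        horizon c (Fintype.card A) M.γ lam CΦ Ct ε ≤ K →
        batchSize c (Fintype.card S) (Fintype.card A) M.γ lam Ct ε δ T ≤ N →
        ENNReal.ofReal (1 - δ) ≤
          (iteratesLaw M Ω lam ν K N (1 / L) π₀ T).toOuterMeasure
            {h | ∃ t : Fin T,
              J M Ω lam ν πstar.mat - J M Ω lam ν (h t.succ).mat ≤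
                4 * ρν * Real.sqrt (Fintype.card S) *
                  Real.sqrt (L * (J M Ω lam ν πstar.mat - J M Ω lam ν π₀.mat) / T + ε)}) ∧
      -- complexity of reaching accuracy `ε'` with respect to `μ`
      (∀ (μ : stdSimplex ℝ S) (ρ L ε' δ : ℝ) (π₀ : Policy S A),
        (∀ s, μ.1 s / ν.1 s ≤ ρ) →
        0 < L → SmoothOnPolicies (J M Ω lam ν) L →
        L ≤ 4 * (Fintype.card A : ℝ) * (1 + lam * Ct) / (1 - M.γ) ^ 3 →
        0 < ε' → ε' ≤ 1 → 0 < δ → δ < 1 →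
        let nS : ℝ := Fintype.card S
        let nA : ℝ := Fintype.card A
        let ε : ℝ := ε' ^ 2 / (32 * ρ ^ 2 * ρν ^ 2 * nS)
        let X : ℝ := nS * nA * ρ ^ 2 * ρν ^ 2 * (1 + lam * Ct) ^ 2 / (ε' ^ 2 * (1 - M.γ) ^ 4)
        let T : ℕ := ⌈c * X⌉₊
        let N : ℕ := ⌈batchSize c nS nA M.γ lam Ct ε δ T⌉₊
        let K : ℕ := ⌈horizon c nA M.γ lam CΦ Ct ε⌉₊
        (T : ℝ) ≤ C * X ∧
        ((T * N : ℕ) : ℝ) ≤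
          C * (nS ^ 4 * nA ^ 3 * ρ ^ 6 * ρν ^ 6 * (1 + lam * Ct) ^ 4 /
              (ε' ^ 6 * (1 - M.γ) ^ 8)) *
            Real.log (2 * nS * nA * ρ * ρν * (1 + lam * Ct) / (ε' * (1 - M.γ) * δ)) ∧
        ENNReal.ofReal (1 - δ) ≤
          (iteratesLaw M Ω lam ν K N (1 / L) π₀ T).toOuterMeasure
            {h | ∃ t : Fin T,
              J M Ω lam ν πstar.mat - J M Ω lam ν (h t.succ).mat ≤ ε' / ρ ∧
              ∀ π' : Policy S A,
                J M Ω lam μ π'.mat - J M Ω lam μ (h t.succ).mat ≤ ε'}) := by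
  refine ⟨128, 129 * 2 * 128 * 1024 * 9, by norm_num, by norm_num, ?_⟩
  intro S A _ _ _ _ _ _ M Ω CΦ Ct lam ν πstar ρν hΩ hlam hν hopt hvis
  refine ⟨smoothOnPolicies_J hΩ hlam ν, ?_, ?_⟩
  · intro L ε δ T N K π₀ hL hsm hε hε1 hδ hδ1 hT hK hN
    exact le_toOuterMeasure_exists_gap_le hΩ hlam hν hopt hvis π₀ hL hsm hε hε1 hδ hδ1 hT hK hN
  · intro μ ρ L ε' δ π₀ hμ hL hsm hL' he he1 hδ hδ1 nS nA ε X T N K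
    have hs : 1 ≤ nS := Nat.one_le_cast.2 Fintype.card_pos
    have ha : 1 ≤ nA := Nat.one_le_cast.2 Fintype.card_pos
    have hr : 1 ≤ ρ := one_le_of_ratio_le hν hμ
    have hv : 1 ≤ ρν := one_le_of_visit hν hvis
    have hG := hΩ.one_le_const hlam
    have hg := M.one_sub_pos
    have hX : 1 ≤ X := one_le_iterationScale hs ha hr hv hG he he1 hg (by linarith [M.γ_nonneg])
    have hε : 0 < ε := by positivity
    have hε1 : ε ≤ 1 := by
      have h1 : 1 ≤ ρ ^ 2 * ρν ^ 2 * nS := one_le_mul_of_one_le_of_one_le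
        (one_le_mul_of_one_le_of_one_le (one_le_pow₀ hr) (one_le_pow₀ hv)) hs
      have h2 : ε' ^ 2 ≤ 1 := pow_le_one₀ he.le he1
      rw [div_le_one (by positivity)]
      linarith
    have hTlow : 128 * X ≤ T := Nat.le_ceil _
    -- Rounding up adds at most `1 ≤ X`.
    have hTup : (T : ℝ) ≤ 129 * X := by
      have := Nat.ceil_lt_add_one (show 0 ≤ 128 * X by positivity)
      linarith
    have hT1 : 1 ≤ T := by
      have : (1 : ℝ) ≤ T := by linarith
      exact_mod_cast this
    refine ⟨by linarith,
      total_samples_le hs ha hr hv hG he he1 M.γ_nonneg M.γ_lt_one hδ hδ1 hT1 hTup hε1 rfl, ?_⟩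
    refine (le_toOuterMeasure_exists_gap_le hΩ hlam hν hopt hvis π₀ hL hsm hε hε1 hδ hδ1 hT1
      (K := K) (N := N) (Nat.le_ceil _) (Nat.le_ceil _)).trans
      (MeasureTheory.OuterMeasure.mono _ ?_)
    rintro h ⟨t, ht⟩
    have hacc := ht.trans (accuracy_le hs ha hr hv hG he hg hL hL' (sub_nonneg.2 (hopt π₀))
      (J_sub_J_le hΩ hlam πstar π₀) hTlow)
    refine ⟨t, hacc, fun π' => (hopt.J_sub_le hν hμ _ π').trans ?_⟩
    -- Accuracy `ε' / ρ` under `ν` is what the factor `ρ` of the transfer turns into `ε'` under `μ`.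
    have := mul_le_mul_of_nonneg_left hacc (zero_le_one.trans hr)
    rwa [mul_div_cancel₀ _ (by linarith : ρ ≠ 0)] at this
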